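/- Metric $\eta=\mathrm{diag}(1,-1,-1,-1)$, $(xy)=\eta_{\mu\nu}x^\mu y^\nu$; $H_m=\{p\in\mathbb R^4: p^2=m^2,\ p^0>0\}$ with the invariant measure $d\mu_m(p)=(2\pi)^{-3}\,d^3\vec p/(2p^0)$; $I_e$ is the string integration $(I_eX)(x)=\int_0^\infty dt\,X(x+te)$, in momentum space (on $e^{ipx}$, where $\partial_\mu= ip_\mu$) multiplication by $I_e(p)=i/(ep)$. *Massive fields.* For $m>0$ let $B_p$ ($p\in H_m$) be proper orthochronous Lorentz transformations with $B_p(m,0,0,0)^t=p$, let $E_3:\mathbb R^3\to\mathbb R^4$ be the embedding as space components, and let $(T_n)$ be an orthonormal basis of the symmetric traceless tensors in $(\mathbb R^3)^{\otimes s}$. The spin-$s$ Proca field $A^{P(s)}$ of mass $m$ is the free field with the intertwiner $u_n(p)=(B_pE_3)^{\otimes s}T_n$. Let $F^{P(s)}_{[\mu_1\nu_1]\dots[\mu_s\nu_s]}$ be its field strength (the curl in each index), $a^{(s,s)}_{\mu_1\dots\mu_s}(e,x)=\big((I_e)^sF^{P(s)}_{[\mu_1\nu_1]\dots[\mu_s\nu_s]}\big)(x)\,e^{\nu_1}\cdots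 e^{\nu_s}$, and, for $0\le r<s$, $-m\,a^{(s,r)}_{\mu_1\dots\mu_r}=\partial^\mu a^{(s,r+1)}_{\mu\mu_1\dots\mu_r}$. Put $N_0^{(s,0)}=\Big[\frac{\Gamma(\frac12+s)}{\Gamma(\frac12+\frac s2)\Gamma(1+\frac s2)}\Big]^{1/2}$. *Infinite-spin fields.* For $\kappa>0$, let $B_p$ ($p\in H_0$) be proper orthochronous Lorentz transformations with $B_p(1,0,0,1)^t=p$, $E_p(\vec k)=B_p(0,k^1,k^2,0)^t$, $J_e(p)_\mu{}^\nu=\delta_\mu^\nu-p_\mu e^\nu/(ep)$. The field $\phi^{\kappa(r)}$ is the free field with the intertwiner, with values in $L^2(\kappa S^1)$ (normalized invariant measure), $$u^{\kappa(r)}(e,p)(\vec k)=(-\kappa)^{-r}\big(J_e(p)E_p(\vec k)\big)^{\otimes r}\,e^{-i\kappa\sqrt{-e^2}/(ep)}\,e^{-i(eE_p(\vec k))/(ep)}.$$ For fields $X,Y$ with intertwiners $u_X,u_Y$ the two-point kernel is $\langle X(e),Y(e')\rangle(p)=\langle u_X(e,p),u_Y(e',p)\rangle$, the integrand over $H_m$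 in the two-point function. **Proposition.** In the Pauli-Lubanski limit $s\to\infty$ with $m=m_s$, $m_s^2s(s+1)=\kappa^2$ fixed, the fields $X^{(s,r)}(e,x)=N_0^{(s,0)}(1-m\sqrt{-e^2}\,I_e)^s\,a^{(s,r)}(e,x)$ converge, for each fixed rank $r$, to $\phi^{\kappa(r)}(e,x)$ up to unitary equivalence, that is, in the sense of their two-point functions. Precisely, whatever the choices of the $B_p$ and $T_n$, for all fixed ranks $r,r'$ and all tensor components: (i) for all spacelike $e,e'$ and $p\in H_0$ with $(ep)\ne0\ne(e'p)$, and all $p_s\in H_{m_s}$ with $p_s\to p$, the two-point kernels $\langle X^{(s,r)}(e),X^{(s,r')}(e')\rangle(p_s)$ converge to $\langle\phi^{\kappa(r)}(e),\phi^{\kappa(r')}(e')\rangle(p)$; (ii) for every Schwartz function $f(e,e',p)$ on $(\mathbb R^4)^3$ that vanishes unless $e$ and $e'$ are spacelike and such that $e/(ep)$ and $e'/(e'p)$ are bounded where $f\neq0$, the following integrals converge absolutely and $$\int d^4e\,d^4e'\,d\mu_{m_s}(p)\,f(e,e',p)\,\langle X^{(s,r)}(e),X^{(s,r')}(e')\rangle(p)\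 \longrightarrow\ \int d^4e\,d^4e'\,d\mu_0(p)\,f(e,e',p)\,\langle\phi^{\kappa(r)}(e),\phi^{\kappa(r')}(e')\rangle(p);$$ (iii) consequently the intertwiners converge up to unitary equivalence: for $p\in H_0$ and $p_s\in H_{m_s}$ with $p_s\to p$ there are isometric embeddings $V_s$ of the spin-$s$ representation space into $L^2(\kappa S^1)$ such that, for all $r$, all tensor components and all spacelike $e$ with $(ep)\ne0$, $V_s$ applied to the intertwiner of $X^{(s,r)}(e)$ at $p_s$ converges in $L^2(\kappa S^1)$ to $u^{\kappa(r)}(e,p)$. -/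

import Mathlib

noncomputable section

namespace InfiniteSpin

open MeasureTheory Filter Topology

/- ### Minkowski space -/

/-- Minkowski space with its coordinates (contravariant components). -/
abbrev Spacetime := Fin 4 → ℝ

/-- The diagonal of the metric `η = diag(1,-1,-1,-1)`. -/
def eta : Fin 4 → ℝ := ![1, -1, -1, -1]

/-- The Minkowski product `(xy) = η_{μν} x^μ y^ν`. -/
def mdot (x y : Spacetime) : ℝ := ∑ μ, eta μ * x μ * y μ

/-- The covariant components `x_μ = η_{μν} x^ν`. -/
def lower (x : Spacetime) (μ : Fin 4) : ℝ := eta μ * x μ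

/-- The proper orthochronous Lorentz group `SO(1,3)_+^↑`. -/
def IsProperLorentz (Λ : Matrix (Fin 4) (Fin 4) ℝ) : Prop :=
  Λ.transpose * Matrix.diagonal eta * Λ = Matrix.diagonal eta ∧ Λ.det = 1 ∧ 0 < Λ 0 0

/-- The positive-energy mass shell `H_m`. -/
def massShell (m : ℝ) : Set Spacetime := {p | mdot p p = m ^ 2 ∧ 0 < p 0}

/-- The reference momentum of the massive Wigner representation. -/
def massiveRef (m : ℝ) : Spacetime := ![m, 0, 0, 0]

/-- The reference momentum of the massless Wigner representation. -/
def masslessRef : Spacetime := ![1, 0, 0, 1]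

/-- `B` is a choice of standard boosts `B_p` with `B_p p_ref = p` for all `p` on the shell `H`. -/
def IsBoostFamily (H : Set Spacetime) (pref : Spacetime)
    (B : Spacetime → Matrix (Fin 4) (Fin 4) ℝ) : Prop :=
  ∀ p ∈ H, IsProperLorentz (B p) ∧ (B p).mulVec pref = p

/-- The point with spatial momentum `k` on the mass shell `H_m`. -/
def shellPoint (m : ℝ) (k : Fin 3 → ℝ) : Spacetime :=
  Fin.cons (Real.sqrt (m ^ 2 + ∑ i, k i ^ 2)) k

/-- The Lorentz invariant measure `(2π)⁻³ d⁴p δ(p² - m²) θ(p⁰) = (2π)⁻³ d³k / (2 p⁰)` on `H_m`,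
as a measure on momentum space. -/
def shellMeasure (m : ℝ) : Measure Spacetime :=
  Measure.map (shellPoint m)
    ((volume : Measure (Fin 3 → ℝ)).withDensity fun k =>
      ENNReal.ofReal (1 / ((2 * Real.pi) ^ 3 * (2 * shellPoint m k 0))))

/-- A space-time derivative `∂_μ` in momentum space, acting on `e^{ipx}`. -/
def momDeriv (p : Spacetime) (μ : Fin 4) : ℂ := Complex.I * (lower p μ : ℂ)

/-- The string integration `I_e` in momentum space, acting on `e^{ipx}`: multiplication by
`i / (ep)` (at `(ep) ≠ 0`, where the boundary value `i / (ep)_+` is this function). -/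
def stringInt (e p : Spacetime) : ℂ := Complex.I / (mdot e p : ℂ)

/- ### Massive fields of spin `s` -/

/-- The symmetric traceless tensors in `(ℝ³)^{⊗ s}`, the spin `s` representation of `SO(3)`. -/
def TracelessSym (s : ℕ) : Submodule ℝ (EuclideanSpace ℝ (Fin s → Fin 3)) where
  carrier := {t | (∀ (σ : Equiv.Perm (Fin s)) (j : Fin s → Fin 3), t (j ∘ σ) = t j) ∧
    ∀ i i' : Fin s, i ≠ i' → ∀ j : Fin s → Fin 3,
      ∑ a : Fin 3, t (Function.update (Function.update j i a) i' a) = 0}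
  add_mem' := by
    rintro x y ⟨hx, hx'⟩ ⟨hy, hy'⟩
    refine ⟨fun σ j => by simp [hx σ j, hy σ j], fun i i' h j => ?_⟩
    simp [Finset.sum_add_distrib, hx' i i' h j, hy' i i' h j]
  zero_mem' := by simp
  smul_mem' := by
    rintro c x ⟨hx, hx'⟩
    refine ⟨fun σ j => by simp [hx σ j], fun i i' h j => ?_⟩
    simp [← Finset.mul_sum, hx' i i' h j]

/-- The dimension of the spin `s` representation. -/
abbrev spinDim (s : ℕ) : ℕ := Module.finrank ℝ (TracelessSym s)

/-- The covariant components `((B_p E₃)^{⊗ s} t)_{μ₁…μ_s}` of the intertwiner of the Proca field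
that belongs to `t ∈ (ℝ³)^{⊗ s}`; `b` is the matrix `B_p`, and `E₃` embeds `ℝ³` as the space
components. -/
def procaIntertwiner {s : ℕ} (b : Matrix (Fin 4) (Fin 4) ℝ)
    (t : EuclideanSpace ℝ (Fin s → Fin 3)) (μ : Fin s → Fin 4) : ℂ :=
  ((∑ j : Fin s → Fin 3, (∏ i, eta (μ i) * b (μ i) (j i).succ) * t j : ℝ) : ℂ)

/-- The total field strength `F_{[μ₁ν₁]…[μ_sν_s]}` of `A_{μ₁…μ_s}`: the curl
`∂_μ A_ν - ∂_ν A_μ` taken in each of the `s` indices. -/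
def fieldStrength {s : ℕ} (p : Spacetime) (A : (Fin s → Fin 4) → ℂ) (μ ν : Fin s → Fin 4) : ℂ :=
  ∑ l : Fin s → Fin 4,
    (∏ i, (momDeriv p (μ i) * (if l i = ν i then 1 else 0)
      - momDeriv p (ν i) * (if l i = μ i then 1 else 0))) * A l

/-- The string-localized potential
`a^{(s,s)}_{μ₁…μ_s} = (I_e)^s F_{[μ₁ν₁]…[μ_sν_s]} e^{ν₁}…e^{ν_s}`. -/
def stringPotential {s : ℕ} (e p : Spacetime) (A : (Fin s → Fin 4) → ℂ) (μ : Fin s → Fin 4) : ℂ :=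
  stringInt e p ^ s * ∑ ν : Fin s → Fin 4, (∏ i, (e (ν i) : ℂ)) * fieldStrength p A μ ν

/-- The descending recursion `-m a^{(s,r)}_{μ₁…μ_r} = ∂^μ a^{(s,r+1)}_{μμ₁…μ_r}`, started at
`r = s` with the tensor `X` and iterated `k = s - r` times. -/
def descend {s : ℕ} (m : ℝ) (p : Spacetime) (X : (Fin s → Fin 4) → ℂ) :
    (k r : ℕ) → r + k = s → (Fin r → Fin 4) → ℂ
  | 0, _, h, μ => X fun i => μ (Fin.cast (by omega) i)
  | k + 1, r, h, μ =>
      -(1 / (m : ℂ)) * ∑ ν : Fin 4, (eta ν : ℂ) * momDeriv p ν *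
        descend m p X k (r + 1) (by omega) (Fin.cons ν μ)

/-- The component of the intertwiner of the escort field `a^{(s,r)}_{μ₁…μ_r}(e,x)`, `r ≤ s`, that
belongs to `t ∈ (ℝ³)^{⊗ s}` (there is no such field for `r > s`; the value is then `0`). -/
def escortIntertwiner (m : ℝ) {s : ℕ} (b : Matrix (Fin 4) (Fin 4) ℝ)
    (t : EuclideanSpace ℝ (Fin s → Fin 3)) (r : ℕ) (e p : Spacetime) (μ : Fin r → Fin 4) : ℂ :=
  if h : r ≤ s then
    descend m p (stringPotential e p (procaIntertwiner b t)) (s - r) r (by omega) μ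
  else 0

/-- The normalization factor
`N₀^{(s,0)} = (Γ(1/2 + s) / (Γ(1/2 + s/2) Γ(1 + s/2)))^{1/2}`. -/
def normFactor (s : ℕ) : ℝ :=
  Real.sqrt (Real.Gamma (1 / 2 + s) / (Real.Gamma (1 / 2 + s / 2) * Real.Gamma (1 + s / 2)))

/-- The mass in the Pauli-Lubanski limit: `m² s(s+1) = κ²`. -/
def plMass (κ : ℝ) (s : ℕ) : ℝ := κ / Real.sqrt (s * (s + 1))

/-- The intertwiner of `N₀^{(s,0)} (1 - m √(-e²) I_e)^s a^{(s,r)}_{μ₁…μ_r}(e,x)` with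
`m² s(s+1) = κ²`, as a vector in the spin `s` representation space `ℂ^{2s+1}`, for an
orthonormal basis `T` of the symmetric traceless tensors and standard boosts `B`. -/
def massiveIntertwiner (κ : ℝ) (s : ℕ)
    (T : OrthonormalBasis (Fin (spinDim s)) ℝ (TracelessSym s))
    (B : Spacetime → Matrix (Fin 4) (Fin 4) ℝ)
    (r : ℕ) (e p : Spacetime) (μ : Fin r → Fin 4) : EuclideanSpace ℂ (Fin (spinDim s)) :=
  WithLp.toLp 2 fun n =>
    (normFactor s : ℂ) *
      (1 - (plMass κ s : ℂ) * (Real.sqrt (-mdot e e) : ℂ) * stringInt e p) ^ s *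
      escortIntertwiner (plMass κ s) (B p) (T n : EuclideanSpace ℝ (Fin s → Fin 3)) r e p μ

/-- The two-point kernel `⟨X_μ(e), Y_μ'(e')⟩(p)` of the fields with the above intertwiners (ranks
`r` and `r'`): the integrand over `H_m` in the Fourier representation of the vacuum two-point
function. -/
def massiveKernel (κ : ℝ) (s : ℕ)
    (T : OrthonormalBasis (Fin (spinDim s)) ℝ (TracelessSym s))
    (B : Spacetime → Matrix (Fin 4) (Fin 4) ℝ) {r r' : ℕ}
    (μ : Fin r → Fin 4) (μ' : Fin r' → Fin 4) (e e' p : Spacetime) : ℂ :=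
  ∑ n, (starRingEnd ℂ) (massiveIntertwiner κ s T B r e p μ n) *
    massiveIntertwiner κ s T B r' e' p μ' n

/- ### Infinite-spin fields -/

/-- The normalized rotation invariant measure on the circle `κS¹`, in the angle `φ`. -/
def circleMeasure : Measure ℝ :=
  ENNReal.ofReal (1 / (2 * Real.pi)) • volume.restrict (Set.Ioc 0 (2 * Real.pi))

/-- `E_p(k) = B_p (0, k¹, k², 0)ᵗ` for `k = κ (cos φ, sin φ)`; `b` is the matrix `B_p`. -/
def transverse (κ : ℝ) (b : Matrix (Fin 4) (Fin 4) ℝ) (φ : ℝ) : Spacetime :=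
  b.mulVec ![0, κ * Real.cos φ, κ * Real.sin φ, 0]

/-- The matrix `J_e(p)_μ^ν = δ_μ^ν - p_μ e^ν / (ep)`. -/
def stringProj (e p : Spacetime) (μ ν : Fin 4) : ℝ :=
  (if μ = ν then 1 else 0) - lower p μ * e ν / mdot e p

/-- The standard infinite-spin intertwiner
`u^{κ(0)}(e,p)(k) = exp(-iκ √(-e²)/(ep)) exp(-i (e E_p(k))/(ep))`. -/
def standardIntertwiner (κ : ℝ) (B : Spacetime → Matrix (Fin 4) (Fin 4) ℝ)
    (e p : Spacetime) (φ : ℝ) : ℂ :=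
  Complex.exp (-Complex.I * (κ * Real.sqrt (-mdot e e) / mdot e p : ℝ)) *
    Complex.exp (-Complex.I * (mdot e (transverse κ (B p) φ) / mdot e p : ℝ))

/-- The intertwiner `u^{κ(r)}(e,p)(k) = (-κ)^{-r} (J_e(p) E_p(k))^{⊗ r} u^{κ(0)}(e,p)(k)` of the
infinite-spin tensor field `φ^{κ(r)}_{μ₁…μ_r}(e,x)`. -/
def infIntertwiner (κ : ℝ) (B : Spacetime → Matrix (Fin 4) (Fin 4) ℝ)
    (r : ℕ) (e p : Spacetime) (μ : Fin r → Fin 4) (φ : ℝ) : ℂ :=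
  (((-κ)⁻¹ ^ r *
      ∏ i, ∑ ν, stringProj e p (μ i) ν * lower (transverse κ (B p) φ) ν : ℝ) : ℂ) *
    standardIntertwiner κ B e p φ

/-- The two-point kernel `⟨φ^{κ(r)}_μ(e), φ^{κ(r')}_μ'(e')⟩(p)`. -/
def infKernel (κ : ℝ) (B : Spacetime → Matrix (Fin 4) (Fin 4) ℝ) {r r' : ℕ}
    (μ : Fin r → Fin 4) (μ' : Fin r' → Fin 4) (e e' p : Spacetime) : ℂ :=
  ∫ φ, (starRingEnd ℂ) (infIntertwiner κ B r e p μ φ) * infIntertwiner κ B r' e' p μ' φ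
    ∂circleMeasure

/- ### Test functions -/

/-- Test functions `f(e,e',p)` supported at spacelike `e`, `e'`, such that the vectors
`e/(ep)` and `e'/(e'p)` are bounded on the support. -/
def IsStringTest (f : SchwartzMap (Spacetime × Spacetime × Spacetime) ℂ) : Prop :=
  ∃ C : ℝ, ∀ e e' p : Spacetime, f (e, e', p) ≠ 0 →
    mdot e e < 0 ∧ mdot e' e' < 0 ∧ ‖e‖ ≤ C * |mdot e p| ∧ ‖e'‖ ≤ C * |mdot e' p|

/-- Integration over `e`, `e'` and over the mass shell `H_m`. -/
def smearingMeasure (m : ℝ) : Measure (Spacetime × Spacetime × Spacetime) :=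
  (volume : Measure Spacetime).prod ((volume : Measure Spacetime).prod (shellMeasure m))

end InfiniteSpin

end

noncomputable section

namespace InfiniteSpin

open MeasureTheory Filter Topology

/-! ### Averages over the unit circle -/

/-! The massive two-point kernel is a sum over a basis of the spin-s representation, and the
reproducing kernel of the symmetric traceless tensors removes the basis. With N = `normFactor s`,
the sum N² Σ_k T_k(x,…,x) T_k(y,…,y) is Laplace's integral for a Legendre polynomial: the circle
average of (D + βz + γ/z)^s with D = x·y and βγ = ((x·y)² − x²y²)/4 (`sum_tensorForm_power`). Indeed
n^{⊗s} is traceless for null n, so at null n the sum without N² is (x·n)^s (`sum_tensorForm_null`),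
and the average of T_k(n,…,n) over a circle of null vectors with axis y is N² T_k(y,…,y)
(`integral_tensorForm_null`).

The escort field of rank r is i^{s−r} times T_k with r slots filled by rows of J_e(p) and s − r
slots filled by m e/(ep), all taken in the rest frame (`descend_proca`). It is therefore, up to a
factor, the coefficient of z₁⋯z_r in the diagonal value of T_k at ζ = e/(ep) + λ Σ zᵢ J_e(p)_{μᵢ}
(`escortForm_generating`). All these ζ satisfy (ζp) = 1, so that D = 1 − m²(ζξ), and the
discriminant is m²((ζ−ξ)² + O(m²)). As only the product βγ matters, the kernel is the average of (1
+ m((ζ−ξ)² z/2 + z⁻¹/2) + O(m²))^s. Since s·m → κ, it tends to the average of exp(κ((ζ−ξ)² z/2 +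
z⁻¹/2)), a Bessel function of κ√(−(ζ−ξ)²) (`tendsto_pairKernel`).

On the massless side ζ − ξ is orthogonal to p, so its square is minus the squared length of its
transverse part, and the same Bessel function is the average of the plane waves exp(i(ζ−ξ)E_p)
(`limKernel_eq`). Their coefficients of z₁⋯z_r produce the tensor factors J_e E_p (`infKernel_eq`).
The factors (1 − m√(−e²) I_e)^s tend to the remaining phases (`tendsto_stringPhase`).

The smeared statement follows by dominated convergence from a bound that is polynomial in p and
uniform in s (`exists_massiveKernel_bound`). The statement on intertwiners is a general fact on
Hilbert spaces: convergence of Gram matrices implies convergence of the vectors after suitable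
isometric embeddings (`exists_isometry_tendsto_of_tendsto_gram`). -/

instance : IsProbabilityMeasure circleMeasure := by
  constructor
  have h : (0 : ℝ) < 2 * Real.pi := by positivity
  simp only [circleMeasure, Measure.smul_apply, Measure.restrict_apply MeasurableSet.univ,
    Set.univ_inter, Real.volume_Ioc, smul_eq_mul, sub_zero]
  rw [← ENNReal.ofReal_mul (by positivity), one_div, inv_mul_cancel₀ h.ne', ENNReal.ofReal_one]

/-- The point of the unit circle with the angle `φ`. -/
def unitPhase (φ : ℝ) : ℂ := Complex.exp (φ * Complex.I)

lemma unitPhase_ne_zero (φ : ℝ) : unitPhase φ ≠ 0 := Complex.exp_ne_zero _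

@[simp] lemma norm_unitPhase (φ : ℝ) : ‖unitPhase φ‖ = 1 := Complex.norm_exp_ofReal_mul_I φ

@[fun_prop] lemma continuous_unitPhase : Continuous unitPhase := by
  unfold unitPhase; fun_prop

@[fun_prop] lemma continuous_unitPhase_inv : Continuous fun φ => (unitPhase φ)⁻¹ :=
  continuous_unitPhase.inv₀ unitPhase_ne_zero

lemma integral_circleMeasure (f : ℝ → ℂ) :
    ∫ φ, f φ ∂circleMeasure = (1 / (2 * Real.pi) : ℝ) • ∫ φ in (0 : ℝ)..2 * Real.pi, f φ := by
  rw [circleMeasure, integral_smul_measure, ENNReal.toReal_ofReal (by positivity),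
    intervalIntegral.integral_of_le (by positivity)]

lemma unitPhase_zpow (φ : ℝ) (n : ℤ) :
    unitPhase φ ^ n = Complex.exp ((n * Complex.I) * φ) := by
  rw [unitPhase, ← Complex.exp_int_mul]; ring_nf

lemma integral_unitPhase_zpow (n : ℤ) :
    ∫ φ, unitPhase φ ^ n ∂circleMeasure = if n = 0 then 1 else 0 := by
  split_ifs with h
  · simp [h]
  · simp_rw [integral_circleMeasure, unitPhase_zpow]
    have hc : (n * Complex.I : ℂ) ≠ 0 := mul_ne_zero (by exact_mod_cast h) Complex.I_ne_zero
    rw [integral_exp_mul_complex hc]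
    have : (n * Complex.I : ℂ) * ((2 * Real.pi : ℝ) : ℂ) = n * (2 * Real.pi * Complex.I) := by
      push_cast; ring
    rw [this, Complex.exp_int_mul_two_pi_mul_I]
    simp

lemma integrable_of_continuous_of_bound {α : Type*} [TopologicalSpace α] [MeasurableSpace α]
    [OpensMeasurableSpace α] {μ : Measure α} [IsFiniteMeasure μ] {f : α → ℂ}
    (hf : Continuous f) (C : ℝ) (hC : ∀ x, ‖f x‖ ≤ C) : Integrable f μ :=
  Integrable.of_bound (Measurable.aestronglyMeasurable hf.measurable) C (Eventually.of_forall hC)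

lemma integrable_unitPhase_zpow (n : ℤ) :
    Integrable (fun φ => unitPhase φ ^ n) circleMeasure := by
  refine integrable_of_continuous_of_bound ?_ 1 (fun φ => by simp [norm_zpow])
  exact continuous_unitPhase.zpow₀ n (fun φ => Or.inl (unitPhase_ne_zero φ))

lemma unitPhase_monomial (β γ : ℂ) (φ : ℝ) (n j : ℕ) :
    (β * unitPhase φ) ^ j * (γ * (unitPhase φ)⁻¹) ^ (n - j) * (n.choose j : ℂ) =
      (β ^ j * γ ^ (n - j) * (n.choose j : ℂ)) * unitPhase φ ^ ((j : ℤ) - ((n - j : ℕ) : ℤ)) := by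
  rw [zpow_sub₀ (unitPhase_ne_zero φ), zpow_natCast, zpow_natCast, mul_pow, mul_pow, inv_pow]
  ring

/-- Only the term with equally many factors z and z⁻¹ survives, so β and γ enter through their
product alone. -/
lemma integral_linear_pow (β γ : ℂ) (n : ℕ) :
    ∫ φ, (β * unitPhase φ + γ * (unitPhase φ)⁻¹) ^ n ∂circleMeasure =
      if Even n then (β * γ) ^ (n / 2) * (n.choose (n / 2) : ℂ) else 0 := by
  simp_rw [add_pow, unitPhase_monomial]
  rw [integral_finsetSum _ (fun j _ => (integrable_unitPhase_zpow _).const_mul _)]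
  simp_rw [integral_const_mul, integral_unitPhase_zpow]
  split_ifs with h
  · obtain ⟨k, rfl⟩ := h
    have hk : (k + k) / 2 = k := by omega
    rw [hk, Finset.sum_eq_single k]
    · simp [mul_pow]
    · intro j hj hjk
      rw [Finset.mem_range] at hj
      rw [if_neg (by omega), mul_zero]
    · simp
  · refine Finset.sum_eq_zero fun j hj => ?_
    rw [Finset.mem_range] at hj
    rw [if_neg, mul_zero]
    intro h'
    exact h ⟨j, by omega⟩

lemma norm_linear_le (β γ : ℂ) (φ : ℝ) :
    ‖β * unitPhase φ + γ * (unitPhase φ)⁻¹‖ ≤ ‖β‖ + ‖γ‖ :=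
  (norm_add_le _ _).trans (by simp)

/-- The average of `(D + β z + γ z⁻¹) ^ n` over the unit circle, as a function of `D` and
`P = β γ`. -/
def laplaceSum (n : ℕ) (D P : ℂ) : ℂ :=
  ∑ j ∈ Finset.range (n + 1), D ^ j * (n.choose j : ℂ) *
    if Even (n - j) then P ^ ((n - j) / 2) * ((n - j).choose ((n - j) / 2) : ℂ) else 0

lemma integral_const_add_linear_pow (D β γ : ℂ) (n : ℕ) :
    ∫ φ, (D + (β * unitPhase φ + γ * (unitPhase φ)⁻¹)) ^ n ∂circleMeasure =
      laplaceSum n D (β * γ) := by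
  simp_rw [add_pow D, laplaceSum, ← integral_linear_pow]
  rw [integral_finsetSum]
  · refine Finset.sum_congr rfl fun j _ => ?_
    rw [← integral_const_mul]
    congr 1; ext φ; ring
  · intro j _
    refine (Integrable.mul_const (Integrable.const_mul ?_ _) _)
    refine integrable_of_continuous_of_bound (by fun_prop) ((‖β‖ + ‖γ‖) ^ (n - j)) fun φ => ?_
    rw [norm_pow]
    exact pow_le_pow_left₀ (norm_nonneg _) (norm_linear_le β γ φ) _

/-- This freedom to redistribute a product between β and γ avoids every square root of a
discriminant. -/
lemma integral_const_add_linear_pow_congr {β γ β' γ' : ℂ} (h : β * γ = β' * γ') (D : ℂ) (n : ℕ) :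
    ∫ φ, (D + (β * unitPhase φ + γ * (unitPhase φ)⁻¹)) ^ n ∂circleMeasure =
      ∫ φ, (D + (β' * unitPhase φ + γ' * (unitPhase φ)⁻¹)) ^ n ∂circleMeasure := by
  rw [integral_const_add_linear_pow, integral_const_add_linear_pow, h]

lemma norm_one_add_pow_le {x : ℂ} {M : ℝ} {n : ℕ} (h : n * ‖x‖ ≤ M) :
    ‖(1 + x) ^ n‖ ≤ Real.exp M := by
  rw [norm_pow]
  calc ‖1 + x‖ ^ n ≤ (Real.exp ‖x‖) ^ n := by
        refine pow_le_pow_left₀ (norm_nonneg _) ?_ n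
        calc ‖1 + x‖ ≤ 1 + ‖x‖ := (norm_add_le _ _).trans (by simp)
          _ ≤ Real.exp ‖x‖ := by linarith [Real.add_one_le_exp ‖x‖]
    _ = Real.exp (n * ‖x‖) := by rw [← Real.exp_nat_mul]
    _ ≤ Real.exp M := Real.exp_le_exp.mpr h

/-- Dominated convergence with the bound |1 + x/n|^n ≤ e^{|x|}. It carries identities for averages
of powers over to averages of exponentials. -/
lemma tendsto_integral_one_add_pow {f g : ℝ → ℂ} (hf : Continuous f) (hg : Continuous g)
    {M N : ℝ} (hM : ∀ φ, ‖f φ‖ ≤ M) (hN : ∀ φ, ‖g φ‖ ≤ N) :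
    Tendsto (fun n : ℕ => ∫ φ, g φ * (1 + (n : ℂ)⁻¹ * f φ) ^ n ∂circleMeasure) atTop
      (𝓝 (∫ φ, g φ * Complex.exp (f φ) ∂circleMeasure)) := by
  refine tendsto_integral_of_dominated_convergence (fun _ => N * Real.exp M)
    (fun n => (by fun_prop : Continuous _).aestronglyMeasurable) (integrable_const _)
    (fun n => Eventually.of_forall fun φ => ?_) (Eventually.of_forall fun φ => ?_)
  · rw [norm_mul]
    refine mul_le_mul (hN φ) (norm_one_add_pow_le ?_) (norm_nonneg _)
      ((norm_nonneg _).trans (hN φ))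
    rcases eq_or_ne n 0 with rfl | hn
    · simpa using (norm_nonneg _).trans (hM φ)
    · rw [norm_mul, norm_inv, Complex.norm_natCast,
        mul_inv_cancel_left₀ (by exact_mod_cast hn : (n : ℝ) ≠ 0)]
      exact hM φ
  · refine Tendsto.const_mul _ (Complex.tendsto_one_add_pow_exp_of_tendsto ?_)
    refine tendsto_const_nhds.congr' ?_
    filter_upwards [eventually_ne_atTop 0] with n hn
    rw [mul_inv_cancel_left₀ (by exact_mod_cast hn : (n : ℂ) ≠ 0)]

/-- Both sides are limits of averages of n-th powers, which agree for each n. -/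
lemma integral_exp_linear_congr {β γ β' γ' : ℂ} (h : β * γ = β' * γ') :
    ∫ φ, Complex.exp (β * unitPhase φ + γ * (unitPhase φ)⁻¹) ∂circleMeasure =
      ∫ φ, Complex.exp (β' * unitPhase φ + γ' * (unitPhase φ)⁻¹) ∂circleMeasure := by
  have key : ∀ b c : ℂ, Tendsto (fun n : ℕ => ∫ φ, (1 + ((n : ℂ)⁻¹ * b * unitPhase φ +
      (n : ℂ)⁻¹ * c * (unitPhase φ)⁻¹)) ^ n ∂circleMeasure) atTop
      (𝓝 (∫ φ, Complex.exp (b * unitPhase φ + c * (unitPhase φ)⁻¹) ∂circleMeasure)) := by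
    intro b c
    have := tendsto_integral_one_add_pow (f := fun φ => b * unitPhase φ + c * (unitPhase φ)⁻¹)
      (g := fun _ => 1) (N := 1) (by fun_prop) (by fun_prop) (norm_linear_le b c) (by simp)
    simpa [mul_add, mul_assoc] using this
  refine tendsto_nhds_unique (key β γ) ((key β' γ').congr fun n => ?_)
  refine integral_const_add_linear_pow_congr ?_ 1 n
  calc _ = (n : ℂ)⁻¹ * (n : ℂ)⁻¹ * (β' * γ') := by ring
    _ = _ := by rw [← h]; ring

lemma integral_inv_mul_one_add_pow (c : ℂ) (n : ℕ) :
    ∫ φ, (unitPhase φ)⁻¹ * (1 + c * unitPhase φ) ^ n ∂circleMeasure = n * c := by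
  have h : ∀ φ : ℝ, (unitPhase φ)⁻¹ * (1 + c * unitPhase φ) ^ n =
      ∑ j ∈ Finset.range (n + 1), (c ^ j * (n.choose j : ℂ)) * unitPhase φ ^ ((j : ℤ) - 1) := by
    intro φ
    rw [add_comm (1 : ℂ), add_pow, Finset.mul_sum]
    refine Finset.sum_congr rfl fun j _ => ?_
    rw [zpow_sub₀ (unitPhase_ne_zero φ), zpow_natCast, zpow_one, mul_pow, one_pow]
    ring
  simp_rw [h]
  rw [integral_finsetSum _ (fun j _ => (integrable_unitPhase_zpow _).const_mul _)]
  simp_rw [integral_const_mul, integral_unitPhase_zpow]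
  rcases Nat.eq_zero_or_pos n with rfl | hn
  · simp
  rw [Finset.sum_eq_single 1]
  · simp [mul_comm]
  · intro j _ hj
    rw [if_neg (by omega), mul_zero]
  · intro h; simp at h; omega

/-- The coefficient of z in exp(cz), again obtained from n-th powers. It is the one-variable case of
the extraction used for plane waves. -/
lemma integral_inv_mul_exp (c : ℂ) :
    ∫ φ, (unitPhase φ)⁻¹ * Complex.exp (c * unitPhase φ) ∂circleMeasure = c := by
  refine tendsto_nhds_unique (tendsto_integral_one_add_pow (f := fun φ => c * unitPhase φ)
    (g := fun φ => (unitPhase φ)⁻¹) (M := ‖c‖) (N := 1) (by fun_prop) (by fun_prop)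
    (fun φ => by simp) (by simp)) ?_
  simp_rw [← mul_assoc, integral_inv_mul_one_add_pow]
  refine tendsto_const_nhds.congr' ?_
  filter_upwards [eventually_ne_atTop 0] with n hn
  rw [mul_inv_cancel_left₀ (by exact_mod_cast hn : (n : ℂ) ≠ 0)]

/-- The duplication formula turns the Gamma quotient into (2s−1)!!/s!, the leading coefficient of
the Legendre polynomial P_s. The product form is the one in which the Wallis integral is available.
-/
lemma normFactor_sq (s : ℕ) :
    normFactor s ^ 2 = 2 ^ s * ∏ i ∈ Finset.range s, ((2 * i + 1 : ℝ) / (2 * i + 2)) := by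
  have hprod : (∏ i ∈ Finset.range s, ((2 * i + 1 : ℝ) / (2 * i + 2))) =
      ((2 * s - 1 : ℕ).doubleFactorial : ℝ) / (2 ^ s * s.factorial) := by
    induction s with
    | zero => simp
    | succ k ih =>
      rw [Finset.prod_range_succ, ih]
      have : (2 * (k + 1) - 1).doubleFactorial = (2 * k + 1) * (2 * k - 1).doubleFactorial := by
        -- For `k = 0` the truncated difference `2 * k - 1` is 0, with double factorial 1, so this
        -- case is separate.
        rcases k with _ | k
        · simp
        · have : 2 * (k + 1 + 1) - 1 = (2 * (k + 1) - 1) + 2 := by omega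
          rw [this, Nat.doubleFactorial_add_two]
          congr 1
      rw [this, Nat.factorial_succ]
      have : (k.factorial : ℝ) ≠ 0 := by positivity
      push_cast
      field_simp
      rw [pow_succ]
  have hdup := Real.Gamma_mul_Gamma_add_half (1 / 2 + s / 2 : ℝ)
  have h1 : (1 / 2 + s / 2 : ℝ) + 1 / 2 = 1 + s / 2 := by ring
  have h2 : 2 * (1 / 2 + s / 2 : ℝ) = s + 1 := by ring
  rw [h1, h2, Real.Gamma_nat_eq_factorial] at hdup
  have h3 : (2 : ℝ) ^ (1 - ((s : ℝ) + 1)) = (2 ^ s)⁻¹ := by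
    rw [show (1 - ((s : ℝ) + 1)) = -(s : ℝ) by ring, Real.rpow_neg (by norm_num),
      Real.rpow_natCast]
  have h4 : Real.Gamma (1 / 2 + s) = ((2 * s - 1 : ℕ).doubleFactorial : ℝ) *
      Real.sqrt Real.pi / 2 ^ s := by
    rw [add_comm]; exact Real.Gamma_nat_add_half s
  have hpi : Real.sqrt Real.pi ≠ 0 := by positivity
  have hf : (s.factorial : ℝ) ≠ 0 := by positivity
  rw [normFactor, Real.sq_sqrt (div_nonneg (Real.Gamma_nonneg_of_nonneg (by positivity))
    (mul_nonneg (Real.Gamma_nonneg_of_nonneg (by positivity))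
      (Real.Gamma_nonneg_of_nonneg (by positivity)))), hdup, h3, h4, hprod]
  field_simp

/-- Flipping both signs keeps the product βγ and replaces 1 + cos φ by 1 − cos φ = 2 sin²(φ/2),
which gives a Wallis integral. -/
lemma integral_one_add_half_pow (s : ℕ) :
    ∫ φ, (1 + (1 / 2 * unitPhase φ + 1 / 2 * (unitPhase φ)⁻¹)) ^ s ∂circleMeasure =
      ((normFactor s ^ 2 : ℝ) : ℂ) := by
  rw [integral_const_add_linear_pow_congr (β' := -(1 / 2)) (γ' := -(1 / 2)) (by ring)]
  have h : ∀ φ : ℝ, (1 + (-(1 / 2) * unitPhase φ + -(1 / 2) * (unitPhase φ)⁻¹)) ^ s =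
      ((2 ^ s * Real.sin (φ / 2) ^ (2 * s) : ℝ) : ℂ) := by
    intro φ
    have : (1 + (-(1 / 2) * unitPhase φ + -(1 / 2) * (unitPhase φ)⁻¹)) =
        ((2 * Real.sin (φ / 2) ^ 2 : ℝ) : ℂ) := by
      rw [unitPhase, ← Complex.exp_neg, Real.sin_sq_eq_half_sub, mul_div_cancel₀ _ two_ne_zero]
      push_cast
      rw [Complex.cos, neg_mul]
      ring_nf
    rw [this, pow_mul]; push_cast; ring
  simp_rw [h]
  rw [integral_complex_ofReal, normFactor_sq]
  congr 1
  have h2 : ∫ φ in (0 : ℝ)..2 * Real.pi, Real.sin (φ / 2) ^ (2 * s) =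
      2 * ∫ x in (0 : ℝ)..Real.pi, Real.sin x ^ (2 * s) := by
    rw [intervalIntegral.integral_comp_div (fun x => Real.sin x ^ (2 * s)) two_ne_zero]
    simp
  rw [circleMeasure, integral_smul_measure, ENNReal.toReal_ofReal (by positivity),
    ← intervalIntegral.integral_of_le (by positivity), intervalIntegral.integral_const_mul, h2,
    integral_sin_pow_even, smul_eq_mul]
  field_simp

/-! ### Averages over a torus -/

/-- The normalized invariant measure on the torus with `r` angles. -/
abbrev torusMeasure (r : ℕ) : Measure (Fin r → ℝ) := Measure.pi fun _ => circleMeasure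

lemma integral_torus_monomial (r : ℕ) (n : Fin r → ℕ) :
    ∫ θ, (∏ i, (unitPhase (θ i))⁻¹) * ∏ i, unitPhase (θ i) ^ n i ∂torusMeasure r =
      if ∀ i, n i = 1 then 1 else 0 := by
  simp_rw [← Finset.prod_mul_distrib]
  rw [integral_fintype_prod_eq_prod (fun i φ => (unitPhase φ)⁻¹ * unitPhase φ ^ n i)]
  have : ∀ i, ∫ φ, (unitPhase φ)⁻¹ * unitPhase φ ^ n i ∂circleMeasure =
      if n i = 1 then 1 else 0 := by
    intro i
    have : ∀ φ, (unitPhase φ)⁻¹ * unitPhase φ ^ n i = unitPhase φ ^ ((n i : ℤ) - 1) := by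
      intro φ
      rw [zpow_sub₀ (unitPhase_ne_zero φ), zpow_natCast, zpow_one]; ring
    simp_rw [this, integral_unitPhase_zpow]
    congr 1
    simp only [sub_eq_zero, Nat.cast_eq_one]
  simp_rw [this]
  rw [Finset.prod_ite_zero]
  simp

lemma integral_torus_exp (r : ℕ) (c : Fin r → ℂ) :
    ∫ θ, (∏ i, (unitPhase (θ i))⁻¹) * Complex.exp (∑ i, c i * unitPhase (θ i)) ∂torusMeasure r =
      ∏ i, c i := by
  simp_rw [Complex.exp_sum, ← Finset.prod_mul_distrib]
  rw [integral_fintype_prod_eq_prod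
    (fun i φ => (unitPhase φ)⁻¹ * Complex.exp (c i * unitPhase φ))]
  simp_rw [integral_inv_mul_exp]

/-! ### Multilinear forms -/

section Multilinear

variable {E : Type*} [AddCommGroup E] [Module ℂ E]

/-- A word `c` records the expansion of a multilinear form at x + Σ zᵢuᵢ: `none` puts x into a slot,
`some i` puts zᵢuᵢ. -/
lemma prod_option_elim {r s : ℕ} (z : Fin r → ℂ) (c : Fin s → Option (Fin r)) :
    ∏ l, (c l).elim 1 z = ∏ i, z i ^ (Finset.univ.filter fun l => c l = some i).card := by
  have h : ∀ l, (c l).elim 1 z = ∏ i, if c l = some i then z i else 1 := by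
    intro l
    rcases c l with _ | i
    · simp
    · simp [Finset.prod_ite_eq]
  simp_rw [h]
  rw [Finset.prod_comm]
  refine Finset.prod_congr rfl fun i _ => ?_
  rw [Finset.prod_ite]
  simp

lemma eq_partialInv_of_forall {r s : ℕ} {c : Fin s → Option (Fin r)} {e : Fin r ↪ Fin s}
    (h : ∀ l i, c l = some i ↔ e i = l) : Function.partialInv e = c := by
  funext l
  ext i
  rw [h, e.injective.isPartialInv]

/-- The coefficient of `z₁ ⋯ z_r` in `f (x + ∑ zᵢ uᵢ, …, x + ∑ zᵢ uᵢ)` for a symmetric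
multilinear form `f`, as an average over the torus. -/
lemma integral_torus_multilinear {r s : ℕ} (hrs : r ≤ s)
    (f : MultilinearMap ℂ (fun _ : Fin s => E) ℂ)
    (hf : ∀ (σ : Equiv.Perm (Fin s)) (g : Fin s → E), f (fun i => g (σ i)) = f g)
    (x : E) (u : Fin r → E) :
    ∫ θ, (∏ i, (unitPhase (θ i))⁻¹) * f (fun _ => x + ∑ i, unitPhase (θ i) • u i)
      ∂torusMeasure r =
      (s.descFactorial r : ℂ) * f (fun l => if h : (l : ℕ) < r then u ⟨l, h⟩ else x) := by
  have hexp : ∀ θ : Fin r → ℝ, f (fun _ => x + ∑ i, unitPhase (θ i) • u i) =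
      ∑ c : Fin s → Option (Fin r), (∏ i, unitPhase (θ i) ^
        (Finset.univ.filter fun l => c l = some i).card) * f (fun l => (c l).elim x u) := by
    intro θ
    have h1 : x + ∑ i, unitPhase (θ i) • u i =
        ∑ o : Option (Fin r), (o.elim 1 fun i => unitPhase (θ i)) • o.elim x u := by
      rw [Fintype.sum_option]; simp
    rw [h1, f.map_sum]
    refine Finset.sum_congr rfl fun c _ => ?_
    rw [f.map_smul_univ, prod_option_elim, smul_eq_mul]
  simp_rw [hexp, Finset.mul_sum, ← mul_assoc]
  rw [integral_finsetSum]
  swap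
  · intro c _
    refine Integrable.mul_const (integrable_of_continuous_of_bound ?_ 1 fun θ => ?_) _
    · exact (continuous_finsetProd _ fun i _ => continuous_unitPhase_inv.comp
        (continuous_apply i)).mul (by fun_prop)
    simp [norm_prod]
  simp_rw [integral_mul_const, integral_torus_monomial]
  simp_rw [ite_mul, one_mul, zero_mul]
  rw [← Finset.sum_filter]
  -- The torus average keeps the words that contain every letter `some i` exactly once. These are
  -- the partial inverses of the injections of `Fin r` into `Fin s`, whose number is the descending
  -- factorial.
  have hsum : ∑ e : Fin r ↪ Fin s, f (fun l => (Function.partialInv e l).elim x u) =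
      ∑ c ∈ Finset.univ.filter (fun c : Fin s → Option (Fin r) =>
        ∀ i, (Finset.univ.filter fun l => c l = some i).card = 1),
        f (fun l => (c l).elim x u) := by
    refine Finset.sum_nbij (fun e => Function.partialInv e) ?_ ?_ ?_ (fun _ _ => rfl)
    · intro e _
      simp only [Finset.mem_filter, Finset.mem_univ, true_and]
      intro i
      rw [Finset.card_eq_one]
      refine ⟨e i, ?_⟩
      ext l
      simp only [Finset.mem_filter, Finset.mem_univ, true_and, Finset.mem_singleton]
      rw [e.injective.isPartialInv i l]; exact eq_comm
    · intro e _ e' _ h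
      ext i : 1
      have h1 := Function.partialInv_left e.injective i
      have h2 : Function.partialInv e' (e i) = some i := by
        rw [← h1]; exact (congrFun h (e i)).symm
      exact ((e'.injective.isPartialInv i (e i)).1 h2).symm
    · intro c hc
      simp only [Finset.coe_filter, Finset.mem_univ, true_and, Set.mem_ofPred_eq] at hc
      choose e he using fun i => Finset.card_eq_one.1 (hc i)
      have he' : ∀ i l, c l = some i ↔ l = e i := by
        intro i l
        have := congrArg (l ∈ ·) (he i)
        simpa using this
      have hinj : Function.Injective e := by
        intro i i' h
        have h1 := (he' i (e i)).2 rfl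
        have h2 := (he' i' (e i)).2 h
        exact Option.some_injective _ (h1.symm.trans h2)
      refine ⟨⟨e, hinj⟩, by simp, ?_⟩
      refine eq_partialInv_of_forall fun l i => ?_
      rw [he']; exact eq_comm
  rw [← hsum]
  -- An injection extends to a permutation of all slots, so by symmetry each surviving word
  -- contributes as much as the one with the uᵢ in the first r slots.
  have hconst : ∀ e : Fin r ↪ Fin s, f (fun l => (Function.partialInv e l).elim x u) =
      f (fun l => if h : (l : ℕ) < r then u ⟨l, h⟩ else x) := by
    intro e
    obtain ⟨σ, hσ⟩ : ∃ σ : Equiv.Perm (Fin s), ∀ i, σ (Fin.castLE hrs i) = e i := by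
      let a : {l : Fin s // (l : ℕ) < r} ≃ Fin r :=
        ⟨fun l => ⟨l.1, l.2⟩, fun i => ⟨Fin.castLE hrs i, i.2⟩, fun l => by ext; rfl,
          fun i => by ext; rfl⟩
      let b : Fin r ≃ {l : Fin s // l ∈ Set.range e} := Equiv.ofInjective e e.injective
      refine ⟨(a.trans b).extendSubtype, fun i => ?_⟩
      exact Equiv.extendSubtype_apply_of_mem (a.trans b) (Fin.castLE hrs i) i.2
    rw [← hf σ]
    congr 1
    funext l
    split_ifs with h
    · have : e ⟨l, h⟩ = σ l := (hσ ⟨l, h⟩).symm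
      rw [← this, Function.partialInv_left e.injective]
      rfl
    · have : Function.partialInv e (σ l) = none := by
        rw [Option.eq_none_iff_forall_ne_some]
        intro i hi
        have h1 := (e.injective.isPartialInv i (σ l)).1 hi
        rw [← hσ] at h1
        exact h ((σ.injective h1) ▸ i.2)
      rw [this]
      rfl
  simp_rw [hconst]
  simp [Fintype.card_embedding_eq]

end Multilinear

/-! ### Symmetric traceless tensors evaluated on complex vectors. -/

/-- The multilinear form on `ℂ³` that belongs to a real tensor. -/
def tensorForm {s : ℕ} (t : EuclideanSpace ℝ (Fin s → Fin 3)) :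
    MultilinearMap ℂ (fun _ : Fin s => Fin 3 → ℂ) ℂ :=
  ∑ j : Fin s → Fin 3, ((t j : ℝ) : ℂ) •
    (MultilinearMap.mkPiAlgebra ℂ (Fin s) ℂ).compLinearMap fun i => LinearMap.proj (j i)

lemma tensorForm_apply {s : ℕ} (t : EuclideanSpace ℝ (Fin s → Fin 3)) (g : Fin s → Fin 3 → ℂ) :
    tensorForm t g = ∑ j : Fin s → Fin 3, (∏ i, g i (j i)) * (t j : ℂ) := by
  simp [tensorForm, mul_comm]

lemma tensorForm_perm {s : ℕ} (t : TracelessSym s) (σ : Equiv.Perm (Fin s))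
    (g : Fin s → Fin 3 → ℂ) :
    tensorForm t.1 (fun i => g (σ i)) = tensorForm t.1 g := by
  rw [tensorForm_apply, tensorForm_apply]
  refine Fintype.sum_equiv (Equiv.arrowCongr σ (Equiv.refl _)) _ _ fun j => ?_
  congr 1
  · rw [← Equiv.prod_comp σ (fun i => g i _)]
    simp [Equiv.arrowCongr]
  · congr 1
    exact (t.2.1 σ.symm j).symm

lemma tensorForm_trace {s : ℕ} (t : TracelessSym s) {i i' : Fin s} (hi : i ≠ i')
    (g : Fin s → Fin 3 → ℂ) :
    ∑ a : Fin 3, tensorForm t.1 (Function.update (Function.update g i (Pi.single a 1)) i'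
      (Pi.single a 1)) = 0 := by
  classical
  let P : (Fin s → Fin 3) → ℂ := fun j => ∏ k ∈ (Finset.univ.erase i).erase i', g k (j k)
  have hterm : ∀ a, tensorForm t.1 (Function.update (Function.update g i (Pi.single a 1)) i'
      (Pi.single a 1)) = ∑ j : Fin s → Fin 3,
        if j i = a ∧ j i' = a then P j * (t.1 j : ℂ) else 0 := by
    intro a
    rw [tensorForm_apply]
    refine Finset.sum_congr rfl fun j _ => ?_
    rw [← Finset.mul_prod_erase Finset.univ _ (Finset.mem_univ i),
      ← Finset.mul_prod_erase (Finset.univ.erase i) _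
        (Finset.mem_erase.2 ⟨hi.symm, Finset.mem_univ i'⟩)]
    have hP : ∏ k ∈ (Finset.univ.erase i).erase i',
        Function.update (Function.update g i (Pi.single a 1)) i' (Pi.single a 1) k (j k) = P j := by
      refine Finset.prod_congr rfl fun k hk => ?_
      simp only [Finset.mem_erase] at hk
      rw [Function.update_of_ne hk.1, Function.update_of_ne hk.2.1]
    rw [hP, Function.update_self, Function.update_of_ne hi, Function.update_self]
    simp only [Pi.single_apply]
    by_cases h1 : j i = a <;> by_cases h2 : j i' = a <;> simp [h1, h2]
  simp_rw [hterm]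
  -- Resetting the entries at `i` and `i'` to 0 makes the common value `a` an independent index, so
  -- that the trace condition on components applies for each fixed remainder of `j`.
  have hzero : ∑ j : Fin s → Fin 3, ∑ a : Fin 3, (if j i = 0 ∧ j i' = 0 then
      P j * (t.1 (Function.update (Function.update j i a) i' a) : ℂ) else 0) = 0 := by
    refine Finset.sum_eq_zero fun j _ => ?_
    split_ifs
    · rw [← Finset.mul_sum]
      have := t.2.2 i i' hi j
      rw [← Complex.ofReal_sum, this]; simp
    · simp
  refine Eq.trans ?_ hzero
  rw [Finset.sum_comm, ← Fintype.sum_prod_type', ← Fintype.sum_prod_type']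
  rw [← Finset.sum_filter (fun x : (Fin s → Fin 3) × Fin 3 => x.1 i = x.2 ∧ x.1 i' = x.2),
    ← Finset.sum_filter (fun x : (Fin s → Fin 3) × Fin 3 => x.1 i = 0 ∧ x.1 i' = 0)]
  refine Finset.sum_nbij' (fun x => (Function.update (Function.update x.1 i 0) i' 0, x.2))
    (fun x => (Function.update (Function.update x.1 i x.2) i' x.2, x.2)) ?_ ?_ ?_ ?_ ?_
  · rintro ⟨j, a⟩ _
    simp [Function.update_of_ne hi]
  · rintro ⟨j, a⟩ _
    simp [Function.update_of_ne hi]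
  · rintro ⟨j, a⟩ h
    simp only [Finset.mem_filter, Finset.mem_univ, true_and] at h
    simp only [Prod.mk.injEq, and_true]
    funext k
    by_cases hk : k = i'
    · subst hk; simp [h.2]
    by_cases hk' : k = i
    · subst hk'; simp [hk, h.1]
    simp [hk, hk']
  · rintro ⟨j, a⟩ h
    simp only [Finset.mem_filter, Finset.mem_univ, true_and] at h
    simp only [Prod.mk.injEq, and_true]
    funext k
    by_cases hk : k = i'
    · subst hk; simp [h.2]
    by_cases hk' : k = i
    · subst hk'; simp [hk, h.1]
    simp [hk, hk']
  · rintro ⟨j, a⟩ h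
    simp only [Finset.mem_filter, Finset.mem_univ, true_and] at h
    have h1 : P (Function.update (Function.update j i 0) i' 0) = P j := by
      refine Finset.prod_congr rfl fun k hk => ?_
      simp only [Finset.mem_erase] at hk
      rw [Function.update_of_ne hk.1, Function.update_of_ne hk.2.1]
    have h2 : Function.update (Function.update (Function.update (Function.update j i 0) i' 0)
        i a) i' a = j := by
      funext k
      by_cases hk : k = i'
      · subst hk; simp [h.2]
      by_cases hk' : k = i
      · subst hk'; simp [hk, h.1]
      simp [hk, hk']
    simp only [h1, h2]

lemma tensorForm_swap {s : ℕ} (t : TracelessSym s) {i i' : Fin s} (hi : i ≠ i')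
    (g : Fin s → Fin 3 → ℂ) (u v : Fin 3 → ℂ) :
    tensorForm t.1 (Function.update (Function.update g i u) i' v) =
      tensorForm t.1 (Function.update (Function.update g i v) i' u) := by
  rw [← tensorForm_perm t (Equiv.swap i i')]
  congr 1
  funext k
  by_cases hk : k = i'
  · subst hk; simp [hi]
  by_cases hk' : k = i
  · subst hk'; simp [hk]
  rw [Equiv.swap_apply_of_ne_of_ne hk' hk]
  simp [hk, hk']

lemma tensorForm_bilinear {s : ℕ} (t : TracelessSym s) {i i' : Fin s} (hi : i ≠ i')
    (g : Fin s → Fin 3 → ℂ) (u v : Fin 3 → ℂ) :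
    tensorForm t.1 (Function.update (Function.update g i u) i' v) =
      ∑ a, ∑ b, u a * v b * tensorForm t.1 (Function.update (Function.update g i (Pi.single a 1)) i'
        (Pi.single b 1)) := by
  have hex : ∀ w : Fin 3 → ℂ, w = ∑ a, w a • (Pi.single a 1 : Fin 3 → ℂ) := by
    intro w
    funext b
    simp [Pi.single_apply]
  have h1 : ∀ (G : Fin s → Fin 3 → ℂ) (k : Fin s) (w : Fin 3 → ℂ),
      tensorForm t.1 (Function.update G k w) =
        ∑ a, w a * tensorForm t.1 (Function.update G k (Pi.single a 1)) := by
    intro G k w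
    conv_lhs => rw [hex w]
    rw [MultilinearMap.map_update_sum]
    simp_rw [MultilinearMap.map_update_smul, smul_eq_mul]
  rw [Function.update_comm hi, h1]
  simp_rw [Function.update_comm hi.symm _ _ g]
  refine Finset.sum_congr rfl fun a _ => ?_
  rw [h1, Finset.mul_sum]
  exact Finset.sum_congr rfl fun b _ => by ring

/-- For `y yᵀ + (l l'ᵀ + l' lᵀ) / 2 = q`, a pair `l, l'` in a traceless symmetric tensor may be
traded for `-y, y`. -/
lemma tensorForm_null_pair {s : ℕ} (t : TracelessSym s) {i i' : Fin s} (hi : i ≠ i')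
    {y l l' : Fin 3 → ℂ} {q : ℂ}
    (hF : ∀ a b, l a * l' b + l b * l' a + 2 * (y a * y b) = if a = b then 2 * q else 0)
    (g : Fin s → Fin 3 → ℂ) :
    tensorForm t.1 (Function.update (Function.update g i l) i' l') =
      -tensorForm t.1 (Function.update (Function.update g i y) i' y) := by
  have h1 := tensorForm_bilinear t hi g l l'
  have h2 := tensorForm_bilinear t hi g l' l
  have h3 := tensorForm_bilinear t hi g y y
  rw [tensorForm_swap t hi g l' l] at h2
  have h4 := tensorForm_trace t hi g
  set M := fun a b => tensorForm t.1 (Function.update (Function.update g i (Pi.single a 1)) i'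
        (Pi.single b 1)) with hM
  -- By `hF` the weight is 2q times the identity matrix, so the sum is a multiple of the trace.
  have h5 : ∑ a, ∑ b, (l a * l' b + l b * l' a + 2 * (y a * y b)) * M a b = 0 := by
    simp_rw [hF, ite_mul, zero_mul, Finset.sum_ite_eq, Finset.mem_univ, if_true]
    rw [← Finset.mul_sum, h4, mul_zero]
  have h6 : ∑ a, ∑ b, (l a * l' b + l b * l' a + 2 * (y a * y b)) * M a b =
      (∑ a, ∑ b, l a * l' b * M a b) + (∑ a, ∑ b, l' a * l b * M a b) +
        2 * ∑ a, ∑ b, y a * y b * M a b := by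
    simp_rw [Finset.mul_sum, ← Finset.sum_add_distrib]
    exact Finset.sum_congr rfl fun a _ => Finset.sum_congr rfl fun b _ => by ring
  have h7 : 2 * (tensorForm t.1 (Function.update (Function.update g i l) i' l') +
      tensorForm t.1 (Function.update (Function.update g i y) i' y)) = 0 := by
    rw [← h5, h6]
    rw [← h1, ← h2, ← h3]; ring
  have h8 := (mul_eq_zero.1 h7).resolve_left two_ne_zero
  exact eq_neg_of_add_eq_zero_left h8

/-- Each removal of one l together with one l' replaces the pair by y, y and costs a sign. -/
lemma tensorForm_balanced_word {s : ℕ} (t : TracelessSym s) {y l l' : Fin 3 → ℂ} {q : ℂ}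
    (hF : ∀ a b, l a * l' b + l b * l' a + 2 * (y a * y b) = if a = b then 2 * q else 0)
    (k : ℕ) : ∀ c : Fin s → Fin 3, (Finset.univ.filter fun i => c i = 1).card = k →
      (Finset.univ.filter fun i => c i = 2).card = k →
      tensorForm t.1 (fun i => ![y, l, l'] (c i)) = (-1) ^ k * tensorForm t.1 (fun _ => y) := by
  induction k with
  | zero =>
    intro c h1 h2
    have h : ∀ i, c i = 0 := by
      intro i
      have h1' : c i ≠ 1 := fun h => by
        have := Finset.card_eq_zero.1 h1
        simpa [h] using congrArg (i ∈ ·) this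
      have h2' : c i ≠ 2 := fun h => by
        have := Finset.card_eq_zero.1 h2
        simpa [h] using congrArg (i ∈ ·) this
      generalize c i = a at *
      fin_cases a <;> simp_all
    simp [h]
  | succ k ih =>
    intro c h1 h2
    obtain ⟨i, hi⟩ := Finset.card_pos.1 (by omega : 0 < (Finset.univ.filter fun i => c i = 1).card)
    obtain ⟨i', hi'⟩ :=
      Finset.card_pos.1 (by omega : 0 < (Finset.univ.filter fun i => c i = 2).card)
    have hci : c i = 1 := by simpa using hi
    have hci' : c i' = 2 := by simpa using hi'
    have hne : i ≠ i' := by rintro rfl; rw [hci] at hci'; exact absurd hci' (by decide)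
    set c' := Function.update (Function.update c i 0) i' 0 with hc'
    have e1 : (Finset.univ.filter fun j => c' j = 1) =
        (Finset.univ.filter fun j => c j = 1).erase i := by
      ext j
      simp only [Finset.mem_filter, Finset.mem_univ, true_and, Finset.mem_erase, hc']
      by_cases hj : j = i'
      · subst hj; simp [hci']
      by_cases hj' : j = i
      · subst hj'; simp [hj]
      simp [hj, hj']
    have e2 : (Finset.univ.filter fun j => c' j = 2) =
        (Finset.univ.filter fun j => c j = 2).erase i' := by
      ext j
      simp only [Finset.mem_filter, Finset.mem_univ, true_and, Finset.mem_erase, hc']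
      by_cases hj : j = i'
      · subst hj; simp
      by_cases hj' : j = i
      · subst hj'; simp [hj, hci]
      simp [hj, hj']
    have h3 := ih c' (by rw [e1, Finset.card_erase_of_mem hi, h1]; rfl)
      (by rw [e2, Finset.card_erase_of_mem hi', h2]; rfl)
    have h4 := tensorForm_null_pair t hne hF fun j => ![y, l, l'] (c j)
    have g1 : Function.update (Function.update (fun j => ![y, l, l'] (c j)) i l) i' l' =
        fun j => ![y, l, l'] (c j) := by
      funext j
      by_cases hj : j = i'
      · subst hj; simp [hci']
      by_cases hj' : j = i
      · subst hj'; simp [hj, hci]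
      simp [hj, hj']
    have g2 : Function.update (Function.update (fun j => ![y, l, l'] (c j)) i y) i' y =
        fun j => ![y, l, l'] (c' j) := by
      funext j
      by_cases hj : j = i'
      · subst hj; simp [hc']
      by_cases hj' : j = i
      · subst hj'; simp [hj, hc']
      simp [hj, hj', hc']
    rw [g1, g2, h3] at h4
    rw [h4, pow_succ]; ring

lemma prod_word {s : ℕ} (c : Fin s → Fin 3) (b₁ b₂ : ℂ) :
    ∏ i, ![1, b₁, b₂] (c i) = b₁ ^ (Finset.univ.filter fun i => c i = 1).card *
      b₂ ^ (Finset.univ.filter fun i => c i = 2).card := by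
  have h : ∀ i, ![1, b₁, b₂] (c i) = (if c i = 1 then b₁ else 1) * (if c i = 2 then b₂ else 1) := by
    intro i
    generalize c i = a
    fin_cases a <;> simp
  simp_rw [h]
  rw [Finset.prod_mul_distrib, Finset.prod_ite, Finset.prod_ite]
  simp

lemma integral_word {s : ℕ} (c : Fin s → Fin 3) (b₁ b₂ : ℂ) :
    ∫ φ, ∏ i, ![1, b₁ * unitPhase φ, b₂ * (unitPhase φ)⁻¹] (c i) ∂circleMeasure =
      if (Finset.univ.filter fun i => c i = 1).card = (Finset.univ.filter fun i => c i = 2).card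
      then (b₁ * b₂) ^ (Finset.univ.filter fun i => c i = 1).card else 0 := by
  simp_rw [prod_word]
  generalize (Finset.univ.filter fun i => c i = 1).card = m
  generalize (Finset.univ.filter fun i => c i = 2).card = n
  have h : ∀ φ, (b₁ * unitPhase φ) ^ m * (b₂ * (unitPhase φ)⁻¹) ^ n =
      b₁ ^ m * b₂ ^ n * unitPhase φ ^ ((m : ℤ) - n) := by
    intro φ
    rw [zpow_sub₀ (unitPhase_ne_zero φ), zpow_natCast, zpow_natCast, mul_pow, mul_pow, inv_pow]
    ring
  simp_rw [h, integral_const_mul, integral_unitPhase_zpow]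
  by_cases hmn : m = n
  · simp [hmn, mul_pow]
  · rw [if_neg hmn, if_neg (by omega), mul_zero]

lemma integrable_word {s : ℕ} (c : Fin s → Fin 3) (b₁ b₂ : ℂ) :
    Integrable (fun φ => ∏ i, ![1, b₁ * unitPhase φ, b₂ * (unitPhase φ)⁻¹] (c i))
      circleMeasure := by
  simp_rw [prod_word]
  refine integrable_of_continuous_of_bound (by fun_prop)
    (‖b₁‖ ^ (Finset.univ.filter fun i => c i = 1).card *
      ‖b₂‖ ^ (Finset.univ.filter fun i => c i = 2).card) fun φ => ?_
  simp

/-- The mean value of a traceless symmetric tensor over null vectors with the axis `y`. -/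
lemma integral_tensorForm_null {s : ℕ} (t : TracelessSym s) {y l l' : Fin 3 → ℂ} {q : ℂ}
    (hF : ∀ a b, l a * l' b + l b * l' a + 2 * (y a * y b) = if a = b then 2 * q else 0) :
    ∫ φ, tensorForm t.1 (fun _ => y + ((Complex.I / 2 * unitPhase φ) • l +
      (Complex.I / 2 * (unitPhase φ)⁻¹) • l')) ∂circleMeasure =
      ((normFactor s ^ 2 : ℝ) : ℂ) * tensorForm t.1 (fun _ => y) := by
  have hexp : ∀ φ, tensorForm t.1 (fun _ => y + ((Complex.I / 2 * unitPhase φ) • l +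
      (Complex.I / 2 * (unitPhase φ)⁻¹) • l')) = ∑ c : Fin s → Fin 3,
        (∏ i, ![1, Complex.I / 2 * unitPhase φ, Complex.I / 2 * (unitPhase φ)⁻¹] (c i)) *
          tensorForm t.1 (fun i => ![y, l, l'] (c i)) := by
    intro φ
    have h1 : y + ((Complex.I / 2 * unitPhase φ) • l + (Complex.I / 2 * (unitPhase φ)⁻¹) • l') =
        ∑ a : Fin 3, ![1, Complex.I / 2 * unitPhase φ, Complex.I / 2 * (unitPhase φ)⁻¹] a •
          ![y, l, l'] a := by
      simp [Fin.sum_univ_three, add_assoc]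
    rw [h1, MultilinearMap.map_sum]
    refine Finset.sum_congr rfl fun c _ => ?_
    rw [MultilinearMap.map_smul_univ, smul_eq_mul]
  simp_rw [hexp]
  rw [integral_finsetSum _ fun c _ => (integrable_word c _ _).mul_const _]
  -- The comparison is word by word. A pair l, l' has weight (i/2)² and contributes the sign −1,
  -- which together give (1/2)², the weight of a pair z, z⁻¹ in this scalar expansion.
  have hexp' : ∀ φ, (1 + (1 / 2 * unitPhase φ + 1 / 2 * (unitPhase φ)⁻¹)) ^ s =
      ∑ c : Fin s → Fin 3, ∏ i, ![1, 1 / 2 * unitPhase φ, 1 / 2 * (unitPhase φ)⁻¹] (c i) := by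
    intro φ
    have h1 : 1 + (1 / 2 * unitPhase φ + 1 / 2 * (unitPhase φ)⁻¹) =
        ∑ a : Fin 3, ![1, 1 / 2 * unitPhase φ, 1 / 2 * (unitPhase φ)⁻¹] a := by
      simp [Fin.sum_univ_three, add_assoc]
    rw [h1, Finset.sum_pow']
    simp
  rw [← integral_one_add_half_pow]
  simp_rw [hexp']
  rw [integral_finsetSum _ fun c _ => integrable_word c _ _, Finset.sum_mul]
  refine Finset.sum_congr rfl fun c _ => ?_
  rw [integral_mul_const, integral_word, integral_word]
  split_ifs with h
  · rw [tensorForm_balanced_word t hF _ c rfl h.symm, ← mul_assoc, ← mul_pow]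
    congr 2
    rw [div_mul_div_comm, Complex.I_mul_I]; ring
  · simp

/-! ### The reproducing kernel of the spin-s representation. -/

/-- The reproducing property of an orthonormal basis of the traceless symmetric tensors at a
null vector. -/
lemma sum_tensorForm_null {s : ℕ} (T : OrthonormalBasis (Fin (spinDim s)) ℝ (TracelessSym s))
    (g : Fin s → Fin 3 → ℂ) {n : Fin 3 → ℂ} (hn : n ⬝ᵥ n = 0) :
    ∑ k, tensorForm (T k).1 g * tensorForm (T k).1 (fun _ => n) = ∏ i, g i ⬝ᵥ n := by
  have hrep : ∀ H : TracelessSym s, ∀ G : (Fin s → Fin 3) → ℂ,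
      ∑ k, (∑ j, G j * ((T k).1 j : ℂ)) * (∑ j, ((H.1 j : ℝ) : ℂ) * ((T k).1 j : ℂ)) =
        ∑ j, G j * (H.1 j : ℂ) := by
    intro H G
    have h1 : ∀ k, (∑ j, ((H.1 j : ℝ) : ℂ) * ((T k).1 j : ℂ)) =
        ((inner ℝ (T k) H : ℝ) : ℂ) := by
      intro k
      rw [Submodule.coe_inner, PiLp.inner_apply]
      simp
    have h2 : ∀ j, ((H.1 j : ℝ) : ℂ) = ∑ k, ((inner ℝ (T k) H : ℝ) : ℂ) * ((T k).1 j : ℂ) := by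
      intro j
      conv_lhs => rw [← T.sum_repr' H]
      simp
    simp_rw [h1]
    conv_rhs =>
      enter [2, j]
      rw [h2 j, Finset.mul_sum]
    rw [Finset.sum_comm]
    refine Finset.sum_congr rfl fun k _ => ?_
    rw [Finset.sum_mul]
    exact Finset.sum_congr rfl fun j _ => by ring
  -- The trace of n^{⊗s} in any two slots has the factor n·n = 0. Its real and imaginary parts thus
  -- lie in the real space spanned by the basis, and each is expanded in it.
  let N : (Fin s → Fin 3) → ℂ := fun j => ∏ i, n (j i)
  have hsym : ∀ (σ : Equiv.Perm (Fin s)) (j : Fin s → Fin 3), N (j ∘ σ) = N j := fun σ j =>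
    Equiv.prod_comp σ fun i => n (j i)
  have htr : ∀ i i' : Fin s, i ≠ i' → ∀ j : Fin s → Fin 3,
      ∑ a : Fin 3, N (Function.update (Function.update j i a) i' a) = 0 := by
    intro i i' hi j
    have : ∀ a, N (Function.update (Function.update j i a) i' a) =
        n a * n a * ∏ k ∈ (Finset.univ.erase i).erase i', n (j k) := by
      intro a
      simp only [N]
      rw [← Finset.mul_prod_erase Finset.univ _ (Finset.mem_univ i),
        ← Finset.mul_prod_erase (Finset.univ.erase i) _
          (Finset.mem_erase.2 ⟨hi.symm, Finset.mem_univ i'⟩), ← mul_assoc]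
      congr 1
      · simp [hi]
      · refine Finset.prod_congr rfl fun k hk => ?_
        simp only [Finset.mem_erase] at hk
        rw [Function.update_of_ne hk.1, Function.update_of_ne hk.2.1]
    simp_rw [this]
    rw [← Finset.sum_mul]
    have h0 : ∑ a, n a * n a = 0 := hn
    rw [h0, zero_mul]
  let Hr : TracelessSym s := ⟨WithLp.toLp 2 fun j => (N j).re, fun σ j => by
      simp only [hsym], fun i i' hi j => by
      have := congrArg Complex.re (htr i i' hi j)
      simpa using this⟩
  let Hi : TracelessSym s := ⟨WithLp.toLp 2 fun j => (N j).im, fun σ j => by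
      simp only [hsym], fun i i' hi j => by
      have := congrArg Complex.im (htr i i' hi j)
      simpa using this⟩
  have hN : ∀ j, N j = (Hr.1 j : ℂ) + (Hi.1 j : ℂ) * Complex.I := fun j =>
    (Complex.re_add_im (N j)).symm
  have hprod : ∏ i, g i ⬝ᵥ n = ∑ j : Fin s → Fin 3, (∏ i, g i (j i)) * N j := by
    simp_rw [dotProduct]
    rw [Finset.prod_univ_sum]
    simp [N, Finset.prod_mul_distrib]
  have e1 := hrep Hr fun j => ∏ i, g i (j i)
  have e2 := hrep Hi fun j => ∏ i, g i (j i)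
  have hf : ∀ k, tensorForm (T k).1 (fun _ => n) =
      (∑ j, ((Hr.1 j : ℝ) : ℂ) * ((T k).1 j : ℂ)) +
        (∑ j, ((Hi.1 j : ℝ) : ℂ) * ((T k).1 j : ℂ)) * Complex.I := by
    intro k
    rw [tensorForm_apply, Finset.sum_mul, ← Finset.sum_add_distrib]
    refine Finset.sum_congr rfl fun j _ => ?_
    change N j * _ = _
    rw [hN]; ring
  simp_rw [hf, tensorForm_apply, mul_add, ← mul_assoc]
  rw [Finset.sum_add_distrib, e1, ← Finset.sum_mul, e2, hprod]
  simp_rw [hN, mul_add, ← mul_assoc]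
  rw [Finset.sum_add_distrib, Finset.sum_mul]

/-- A nonzero real vector `y` can be completed by complex null vectors `l, l'` to a frame. -/
lemma exists_null_frame {y : Fin 3 → ℝ} (hy : y ≠ 0) : ∃ l l' : Fin 3 → ℂ,
    (∀ a b, l a * l' b + l b * l' a + 2 * ((y a : ℂ) * (y b : ℂ)) =
      if a = b then 2 * ((y ⬝ᵥ y : ℝ) : ℂ) else 0) ∧
    l ⬝ᵥ l = 0 ∧ l' ⬝ᵥ l' = 0 ∧ (fun a => (y a : ℂ)) ⬝ᵥ l = 0 ∧ (fun a => (y a : ℂ)) ⬝ᵥ l' = 0 ∧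
    l ⬝ᵥ l' = 2 * ((y ⬝ᵥ y : ℝ) : ℂ) := by
  let v : EuclideanSpace ℝ (Fin 3) := WithLp.toLp 2 y
  have hv : v ≠ 0 := fun h => hy (by simpa [v] using h)
  have hvn : ‖v‖ ≠ 0 := norm_ne_zero_iff.2 hv
  have hq : y ⬝ᵥ y = ‖v‖ ^ 2 := by
    rw [EuclideanSpace.norm_sq_eq]
    simp [v, dotProduct, sq]
  obtain ⟨b, hb⟩ := Orthonormal.exists_orthonormalBasis_extension_of_card_eq (𝕜 := ℝ)
    (E := EuclideanSpace ℝ (Fin 3)) (ι := Fin 3) (by simp) (v := fun _ => ‖v‖⁻¹ • v) (s := {0})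
    (by
      rw [orthonormal_subsingleton_iff]
      intro i
      simp [norm_smul, hvn])
  have hb0 : b 0 = ‖v‖⁻¹ • v := hb 0 rfl
  have hy0 : ∀ i, y i = ‖v‖ * b 0 i := by
    intro i
    rw [hb0]
    simp [v, hvn]
  have hin : ∀ i j, ∑ k, b i k * b j k = if i = j then 1 else 0 := by
    intro i j
    have := orthonormal_iff_ite.1 b.orthonormal i j
    rw [PiLp.inner_apply] at this
    rw [← this]
    exact Finset.sum_congr rfl fun k _ => by simp [mul_comm]
  have hcomp : ∀ i j, ∑ k, b k i * b k j = if i = j then 1 else 0 := by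
    intro i j
    have := congrArg (fun w : EuclideanSpace ℝ (Fin 3) => w j)
      (b.sum_repr' (EuclideanSpace.single i (1 : ℝ)))
    simp only [WithLp.ofLp_sum, Finset.sum_apply, PiLp.smul_apply, smul_eq_mul] at this
    simp only [EuclideanSpace.inner_single_right] at this
    simpa [eq_comm] using this
  -- With b₀ = y/|y| completed to an orthonormal basis, l and l' are |y|(b₁ ± i b₂), and the frame
  -- identity is 2|y|² times the completeness relation.
  refine ⟨fun i => ‖v‖ * (b 1 i + Complex.I * b 2 i), fun i => ‖v‖ * (b 1 i - Complex.I * b 2 i),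
    ?_, ?_, ?_, ?_, ?_, ?_⟩
  · intro i j
    have h := hcomp i j
    rw [Fin.sum_univ_three] at h
    have h' : ((b 0 i * b 0 j + b 1 i * b 1 j + b 2 i * b 2 j : ℝ) : ℂ) =
        if i = j then 1 else 0 := by rw [h]; split_ifs <;> simp
    push_cast at h'
    rw [hq, hy0, hy0]
    push_cast
    have : (if i = j then 2 * (‖v‖ : ℂ) ^ 2 else 0) = 2 * (‖v‖ : ℂ) ^ 2 * if i = j then 1 else 0 := by
      split_ifs <;> simp
    rw [this, ← h']
    linear_combination (-2 * (‖v‖ : ℂ) ^ 2 * b 2 i * b 2 j) * Complex.I_sq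
  all_goals
    have h01 := hin 0 1
    have h02 := hin 0 2
    have h12 := hin 1 2
    have h11 := hin 1 1
    have h22 := hin 2 2
    rw [Fin.sum_univ_three] at h01 h02 h12 h11 h22
    norm_num at h01 h02 h12 h11 h22
    apply_fun Complex.ofReal at h01 h02 h12 h11 h22
    push_cast at h01 h02 h12 h11 h22
    simp only [dotProduct, Fin.sum_univ_three]
  · linear_combination (‖v‖ : ℂ) ^ 2 * h11 + 2 * Complex.I * (‖v‖ : ℂ) ^ 2 * h12 +
      (‖v‖ : ℂ) ^ 2 * (Complex.I) ^ 2 * h22 + (‖v‖ : ℂ) ^ 2 * Complex.I_sq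
  · linear_combination (‖v‖ : ℂ) ^ 2 * h11 - 2 * Complex.I * (‖v‖ : ℂ) ^ 2 * h12 +
      (‖v‖ : ℂ) ^ 2 * (Complex.I) ^ 2 * h22 + (‖v‖ : ℂ) ^ 2 * Complex.I_sq
  · simp only [hy0]; push_cast
    linear_combination (‖v‖ : ℂ) ^ 2 * h01 + Complex.I * (‖v‖ : ℂ) ^ 2 * h02
  · simp only [hy0]; push_cast
    linear_combination (‖v‖ : ℂ) ^ 2 * h01 - Complex.I * (‖v‖ : ℂ) ^ 2 * h02
  · have : y 0 * y 0 + y 1 * y 1 + y 2 * y 2 = ‖v‖ ^ 2 := by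
      rw [← hq, dotProduct, Fin.sum_univ_three]
    rw [this]; push_cast
    linear_combination (‖v‖ : ℂ) ^ 2 * h11 - (‖v‖ : ℂ) ^ 2 * (Complex.I) ^ 2 * h22 -
      (‖v‖ : ℂ) ^ 2 * Complex.I_sq

/-- The factor N² turns the value at y into an average over null vectors n with axis y; there the
reproducing property gives (x·n)^s, and the average of its powers is Laplace's integral. The frame
that defines n requires y to be real and nonzero. -/
lemma sum_tensorForm_power_real {s : ℕ}
    (T : OrthonormalBasis (Fin (spinDim s)) ℝ (TracelessSym s))
    (x : Fin 3 → ℂ) {y : Fin 3 → ℝ} (hy : y ≠ 0) :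
    ((normFactor s ^ 2 : ℝ) : ℂ) * ∑ k, tensorForm (T k).1 (fun _ => x) *
        tensorForm (T k).1 (fun _ a => (y a : ℂ)) =
      laplaceSum s (x ⬝ᵥ fun a => (y a : ℂ)) (((x ⬝ᵥ fun a => (y a : ℂ)) ^ 2 -
        (x ⬝ᵥ x) * ((fun a => (y a : ℂ)) ⬝ᵥ fun a => (y a : ℂ))) / 4) := by
  obtain ⟨l, l', hF, h1, h2, h3, h4, h5⟩ := exists_null_frame hy
  set Y : Fin 3 → ℂ := fun a => (y a : ℂ) with hY
  have hq : Y ⬝ᵥ Y = ((y ⬝ᵥ y : ℝ) : ℂ) := by simp [dotProduct, hY]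
  set n : ℝ → Fin 3 → ℂ := fun φ => Y + ((Complex.I / 2 * unitPhase φ) • l +
      (Complex.I / 2 * (unitPhase φ)⁻¹) • l') with hn
  have hnull : ∀ φ, n φ ⬝ᵥ n φ = 0 := by
    intro φ
    simp only [hn, dotProduct_add, add_dotProduct, smul_dotProduct, dotProduct_smul, smul_eq_mul,
      h1, h2, h3, h4, h5, dotProduct_comm l Y, dotProduct_comm l' Y, dotProduct_comm l' l, hq]
    have := mul_inv_cancel₀ (unitPhase_ne_zero φ)
    linear_combination ((y ⬝ᵥ y : ℝ) : ℂ) * (Complex.I ^ 2) * this +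
      ((y ⬝ᵥ y : ℝ) : ℂ) * Complex.I_sq
  have hdot : ∀ φ, x ⬝ᵥ n φ = x ⬝ᵥ Y + ((Complex.I / 2 * (x ⬝ᵥ l)) * unitPhase φ +
      (Complex.I / 2 * (x ⬝ᵥ l')) * (unitPhase φ)⁻¹) := by
    intro φ
    simp only [hn, dotProduct_add, dotProduct_smul, smul_eq_mul]
    ring
  have hint : ∀ k, Integrable (fun φ => tensorForm (T k).1 (fun _ => x) *
      tensorForm (T k).1 (fun _ => n φ)) circleMeasure := by
    intro k
    have hc : Continuous fun φ => tensorForm (T k).1 (fun _ => x) *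
      tensorForm (T k).1 (fun _ => n φ) := by
      simp_rw [tensorForm_apply, hn, Pi.add_apply, Pi.smul_apply]
      fun_prop
    obtain ⟨C, hC⟩ := (isCompact_Icc (a := (0 : ℝ)) (b := 2 * Real.pi)).exists_bound_of_continuousOn
      hc.continuousOn
    refine Integrable.of_bound hc.aestronglyMeasurable C ?_
    refine Measure.ae_smul_measure ?_ _
    filter_upwards [ae_restrict_mem measurableSet_Ioc] with φ hφ
    exact hC φ (Set.Ioc_subset_Icc_self hφ)
  calc _ = ∑ k, tensorForm (T k).1 (fun _ => x) *
        ∫ φ, tensorForm (T k).1 (fun _ => n φ) ∂circleMeasure := by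
        rw [Finset.mul_sum]
        refine Finset.sum_congr rfl fun k _ => ?_
        rw [integral_tensorForm_null (T k) hF]; ring
    _ = ∫ φ, (x ⬝ᵥ n φ) ^ s ∂circleMeasure := by
        simp_rw [← integral_const_mul]
        rw [← integral_finsetSum _ fun k _ => hint k]
        congr 1; ext φ
        rw [sum_tensorForm_null T (fun _ => x) (hnull φ)]
        simp
    _ = _ := by
        simp_rw [hdot]
        rw [integral_const_add_linear_pow]
        congr 1
        -- Contracting the frame identity with x twice gives (x·l)(x·l') = x²y² − (x·y)².
        have hxx : ∑ a, ∑ b, x a * x b * (l a * l' b + l b * l' a + 2 * (Y a * Y b)) =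
            2 * ((y ⬝ᵥ y : ℝ) : ℂ) * (x ⬝ᵥ x) := by
          simp_rw [hY, hF, mul_ite, mul_zero, Finset.sum_ite_eq, Finset.mem_univ, if_true,
            dotProduct, Finset.mul_sum]
          exact Finset.sum_congr rfl fun a _ => by ring
        have hxx' : ∑ a, ∑ b, x a * x b * (l a * l' b + l b * l' a + 2 * (Y a * Y b)) =
            2 * ((x ⬝ᵥ l) * (x ⬝ᵥ l')) + 2 * (x ⬝ᵥ Y) ^ 2 := by
          simp only [dotProduct, Fin.sum_univ_three]; ring
        rw [hq]
        linear_combination ((x ⬝ᵥ l) * (x ⬝ᵥ l') / 4) * Complex.I_sq + (hxx' - hxx) / 8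

lemma differentiable_laplaceSum {D P : ℂ → ℂ} (hD : Differentiable ℂ D) (hP : Differentiable ℂ P)
    (s : ℕ) : Differentiable ℂ fun z => laplaceSum s (D z) (P z) := by
  unfold laplaceSum
  refine Differentiable.fun_sum fun j _ => ?_
  split_ifs <;> fun_prop

/-- The reproducing kernel of the traceless symmetric tensors at powers of complex vectors. -/
lemma sum_tensorForm_power {s : ℕ}
    (T : OrthonormalBasis (Fin (spinDim s)) ℝ (TracelessSym s)) (x y : Fin 3 → ℂ) :
    ((normFactor s ^ 2 : ℝ) : ℂ) * ∑ k, tensorForm (T k).1 (fun _ => x) *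
        tensorForm (T k).1 (fun _ => y) =
      laplaceSum s (x ⬝ᵥ y) (((x ⬝ᵥ y) ^ 2 - (x ⬝ᵥ x) * (y ⬝ᵥ y)) / 4) := by
  -- Both sides are entire in z and agree at the real z near 0, z ≠ 0, where u + zv is a nonzero
  -- real vector. The identity theorem extends this to all z, and z = i reaches complex vectors.
  have key : ∀ u v : Fin 3 → ℝ, (u ≠ 0 ∨ v ≠ 0) → ∀ z : ℂ,
      ((normFactor s ^ 2 : ℝ) : ℂ) * ∑ k, tensorForm (T k).1 (fun _ => x) *
        tensorForm (T k).1 (fun _ a => (u a : ℂ) + z * (v a : ℂ)) =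
      laplaceSum s (x ⬝ᵥ fun a => (u a : ℂ) + z * (v a : ℂ))
        (((x ⬝ᵥ fun a => (u a : ℂ) + z * (v a : ℂ)) ^ 2 - (x ⬝ᵥ x) *
          ((fun a => (u a : ℂ) + z * (v a : ℂ)) ⬝ᵥ fun a => (u a : ℂ) + z * (v a : ℂ))) / 4) := by
    intro u v huv
    have hdL : Differentiable ℂ fun z : ℂ => ((normFactor s ^ 2 : ℝ) : ℂ) *
        ∑ k, tensorForm (T k).1 (fun _ => x) *
        tensorForm (T k).1 (fun _ a => (u a : ℂ) + z * (v a : ℂ)) := by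
      simp_rw [tensorForm_apply]
      fun_prop
    have hdR : Differentiable ℂ fun z : ℂ =>
      laplaceSum s (x ⬝ᵥ fun a => (u a : ℂ) + z * (v a : ℂ))
        (((x ⬝ᵥ fun a => (u a : ℂ) + z * (v a : ℂ)) ^ 2 - (x ⬝ᵥ x) *
          ((fun a => (u a : ℂ) + z * (v a : ℂ)) ⬝ᵥ fun a => (u a : ℂ) + z * (v a : ℂ))) / 4) := by
      refine differentiable_laplaceSum ?_ ?_ s <;>
      · simp only [dotProduct]
        fun_prop
    refine congrFun (AnalyticOnNhd.eq_of_frequently_eq (z₀ := 0)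
      (fun z _ => hdL.analyticAt z) (fun z _ => hdR.analyticAt z) ?_)
    have hev : ∀ᶠ τ : ℝ in 𝓝[≠] 0, u + τ • v ≠ 0 := by
      by_cases hu : u = 0
      · filter_upwards [self_mem_nhdsWithin] with τ hτ
        rw [hu, zero_add]
        exact smul_ne_zero hτ (huv.resolve_left (fun h => h hu))
      · refine nhdsWithin_le_nhds ?_
        have : ContinuousAt (fun τ : ℝ => u + τ • v) 0 := by fun_prop
        exact this.eventually_ne (by simpa using hu)
    have htend : Tendsto (fun τ : ℝ => (τ : ℂ)) (𝓝[≠] 0) (𝓝[≠] 0) := by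
      refine tendsto_nhdsWithin_iff.2 ⟨?_, ?_⟩
      · exact tendsto_nhdsWithin_of_tendsto_nhds (by
          simpa using (Complex.continuous_ofReal.tendsto 0))
      · filter_upwards [self_mem_nhdsWithin] with τ hτ
        simpa using hτ
    refine htend.frequently (Eventually.frequently ?_)
    filter_upwards [hev] with τ hτ
    have := sum_tensorForm_power_real T x hτ
    simpa using this
  by_cases hy : y = 0
  -- The zero vector lies on the line through 0 in any nonzero direction, here (1,1,1).
  · have := key 0 1 (Or.inr one_ne_zero) 0
    subst hy
    simpa [Pi.zero_def] using this
  · have := key (fun a => (y a).re) (fun a => (y a).im) (by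
      by_contra! h
      refine hy (funext fun a => Complex.ext ?_ ?_)
      · exact congrFun h.1 a
      · exact congrFun h.2 a) Complex.I
    have hye : (fun a => ((y a).re : ℂ) + Complex.I * ((y a).im : ℂ)) = y := by
      funext a
      rw [mul_comm]; exact Complex.re_add_im (y a)
    rw [hye] at this
    exact this

/-! ### Lorentz matrices -/

lemma eta_mul_self (μ : Fin 4) : eta μ * eta μ = 1 := by
  fin_cases μ <;> simp [eta]

lemma IsProperLorentz.mul_eta_mul_transpose {b : Matrix (Fin 4) (Fin 4) ℝ}
    (hb : IsProperLorentz b) : b * Matrix.diagonal eta * b.transpose = Matrix.diagonal eta := by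
  have hD : Matrix.diagonal eta * Matrix.diagonal eta = (1 : Matrix (Fin 4) (Fin 4) ℝ) := by
    rw [Matrix.diagonal_mul_diagonal]
    simp_rw [eta_mul_self]
    exact Matrix.diagonal_one
  have h1 : (Matrix.diagonal eta * b.transpose * Matrix.diagonal eta) * b = 1 := by
    rw [mul_assoc, mul_assoc, ← mul_assoc b.transpose, hb.1, hD]
  have h2 := mul_eq_one_comm.1 h1
  calc _ = b * (Matrix.diagonal eta * b.transpose * Matrix.diagonal eta) *
        Matrix.diagonal eta := by
        simp only [mul_assoc, hD, mul_one]
    _ = _ := by rw [h2, one_mul]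

lemma IsProperLorentz.completeness {b : Matrix (Fin 4) (Fin 4) ℝ}
    (hb : IsProperLorentz b) (μ ν : Fin 4) :
    b μ 0 * b ν 0 - ∑ a : Fin 3, b μ a.succ * b ν a.succ = if μ = ν then eta μ else 0 := by
  have h := congrFun (congrFun hb.mul_eta_mul_transpose μ) ν
  rw [Matrix.mul_apply, Fin.sum_univ_succ] at h
  simp only [Matrix.mul_diagonal, Matrix.transpose_apply, Matrix.diagonal_apply] at h
  rw [← h, sub_eq_add_neg, ← Finset.sum_neg_distrib]
  congr 1
  · simp [eta]
  · refine Finset.sum_congr rfl fun a _ => ?_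
    fin_cases a <;> simp [eta]

lemma mulVec_massiveRef {b : Matrix (Fin 4) (Fin 4) ℝ} {m : ℝ} {p : Spacetime}
    (h : b.mulVec (massiveRef m) = p) (μ : Fin 4) : p μ = m * b μ 0 := by
  rw [← h]
  simp [Matrix.mulVec, dotProduct, massiveRef, Fin.sum_univ_succ, mul_comm]

lemma lower_mul_eq_mdot (e p : Spacetime) : ∑ ν, e ν * lower p ν = mdot e p := by
  simp only [lower, mdot]
  exact Finset.sum_congr rfl fun ν _ => by ring

/-- The complex bilinear extension of the Minkowski product. -/
def cdot (ζ ξ : Fin 4 → ℂ) : ℂ := ∑ ν, (eta ν : ℂ) * ζ ν * ξ ν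

/-- The space components, with respect to the standard boost `b` at mass `m`, of a vector. -/
def restVec (m : ℝ) (b : Matrix (Fin 4) (Fin 4) ℝ) : (Fin 4 → ℂ) →ₗ[ℂ] (Fin 3 → ℂ) where
  toFun ζ a := m * ∑ ν, ζ ν * ((eta ν * b ν a.succ : ℝ) : ℂ)
  map_add' ζ ξ := by
    funext a
    simp [add_mul, Finset.sum_add_distrib, mul_add]
  map_smul' c ζ := by
    funext a
    simp only [Pi.smul_apply, smul_eq_mul, RingHom.id_apply, Finset.mul_sum]
    exact Finset.sum_congr rfl fun ν _ => by ring

/-- This is the polarization sum of the Proca field, multiplied by m²: the time column of b is p/m,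
and completeness of the columns expresses the sum over the space columns by p and η. The choice of
the boost drops out here. -/
lemma restVec_dotProduct {b : Matrix (Fin 4) (Fin 4) ℝ} (hb : IsProperLorentz b) {m : ℝ}
    {p : Spacetime} (h : b.mulVec (massiveRef m) = p) (ζ ξ : Fin 4 → ℂ) :
    restVec m b ζ ⬝ᵥ restVec m b ξ =
      cdot ζ (fun ν => p ν) * cdot ξ (fun ν => p ν) - (m : ℂ) ^ 2 * cdot ζ ξ := by
  have h1 : ∀ ν ν' : Fin 4, (∑ a : Fin 3, (b ν a.succ : ℂ) * (b ν' a.succ : ℂ)) =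
      b ν 0 * b ν' 0 - if ν = ν' then (eta ν : ℂ) else 0 := by
    intro ν ν'
    have := congrArg Complex.ofReal (hb.completeness ν ν')
    push_cast at this
    rw [apply_ite Complex.ofReal] at this
    rw [Complex.ofReal_zero] at this
    rw [← this]; ring
  have h2 : restVec m b ζ ⬝ᵥ restVec m b ξ = (m : ℂ) ^ 2 * ∑ ν, ∑ ν',
      ζ ν * ξ ν' * eta ν * eta ν' * ∑ a : Fin 3, (b ν a.succ : ℂ) * (b ν' a.succ : ℂ) := by
    simp only [dotProduct, restVec, LinearMap.coe_mk, AddHom.coe_mk]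
    calc _ = ∑ a : Fin 3, ∑ ν, ∑ ν', ((m : ℂ) * (ζ ν * ((eta ν * b ν a.succ : ℝ) : ℂ))) *
          ((m : ℂ) * (ξ ν' * ((eta ν' * b ν' a.succ : ℝ) : ℂ))) := by
          refine Finset.sum_congr rfl fun a _ => ?_
          rw [Finset.mul_sum, Finset.mul_sum, Finset.sum_mul_sum]
      _ = _ := by
          simp only [Finset.mul_sum]
          rw [Finset.sum_comm]
          refine Finset.sum_congr rfl fun ν _ => ?_
          rw [Finset.sum_comm]
          refine Finset.sum_congr rfl fun ν' _ => ?_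
          refine Finset.sum_congr rfl fun a _ => ?_
          push_cast; ring
  rw [h2]
  simp_rw [h1, mul_sub, Finset.sum_sub_distrib, mul_ite, mul_zero, Finset.sum_ite_eq,
    Finset.mem_univ, if_true, mul_sub]
  congr 1
  · simp only [cdot, mulVec_massiveRef h, Finset.mul_sum, Finset.sum_mul]
    rw [Finset.sum_comm]
    refine Finset.sum_congr rfl fun ν _ => Finset.sum_congr rfl fun ν' _ => ?_
    push_cast; ring
  · congr 1
    simp only [cdot]
    refine Finset.sum_congr rfl fun ν _ => ?_
    have := congrArg Complex.ofReal (eta_mul_self ν)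
    push_cast at this
    linear_combination (eta ν * ζ ν * ξ ν : ℂ) * this

/-! ### The escort fields -/

/-- The vector `(e / (ep))^ν`. -/
def stringDir (e p : Spacetime) (ν : Fin 4) : ℂ := ((e ν / mdot e p : ℝ) : ℂ)

/-- The row `J_e(p)_μ^ν` of the string projection as a complex vector. -/
def projRow (e p : Spacetime) (μ : Fin 4) (ν : Fin 4) : ℂ := ((stringProj e p μ ν : ℝ) : ℂ)

/-- The slot vector of an open index of an escort field. -/
def openVec (b : Matrix (Fin 4) (Fin 4) ℝ) (e p : Spacetime) (μ : Fin 4) : Fin 3 → ℂ :=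
  restVec 1 b (projRow e p μ)

/-- The slot vector of a contracted index of an escort field. -/
def closedVec (m : ℝ) (b : Matrix (Fin 4) (Fin 4) ℝ) (e p : Spacetime) : Fin 3 → ℂ :=
  restVec m b (stringDir e p)

lemma contract_slots {s : ℕ} {ι κ : Type*} [Fintype ι] [Fintype κ] [DecidableEq ι]
    (f : Fin s → ι → ℂ) (g : Fin s → ι → κ → ℂ) (h : (Fin s → κ) → ℂ) :
    ∑ ν : Fin s → ι, (∏ i, f i (ν i)) * ∑ l : Fin s → κ, (∏ i, g i (ν i) (l i)) * h l =
      ∑ l : Fin s → κ, (∏ i, ∑ n, f i n * g i n (l i)) * h l := by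
  simp_rw [Finset.mul_sum]
  rw [Finset.sum_comm]
  refine Finset.sum_congr rfl fun l _ => ?_
  rw [Finset.prod_univ_sum, Finset.sum_mul]
  simp only [Fintype.piFinset_univ]
  refine Finset.sum_congr rfl fun ν _ => ?_
  rw [Finset.prod_mul_distrib]; ring

/-- Everything factorizes over the slots. In each slot, string integration of the curl contracted
with e gives (i/(ep))(i p_μ e^ν − i(ep) δ_μ^ν) = J_e(p)_μ^ν. -/
lemma stringPotential_proca {s : ℕ} (b : Matrix (Fin 4) (Fin 4) ℝ) {e p : Spacetime}
    (hep : mdot e p ≠ 0) (t : EuclideanSpace ℝ (Fin s → Fin 3)) (μ : Fin s → Fin 4) :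
    stringPotential e p (procaIntertwiner b t) μ = tensorForm t fun i => openVec b e p (μ i) := by
  have hA : ∀ l, procaIntertwiner b t l = ∑ j : Fin s → Fin 3,
      (∏ i, ((eta (l i) * b (l i) (j i).succ : ℝ) : ℂ)) * (t j : ℂ) := by
    intro l
    simp [procaIntertwiner]
  rw [stringPotential, tensorForm_apply]
  simp only [fieldStrength]
  rw [contract_slots (fun _ n => (e n : ℂ)) (fun i n l =>
    momDeriv p (μ i) * (if l = n then 1 else 0) - momDeriv p n * (if l = μ i then 1 else 0))]
  simp_rw [hA]
  rw [contract_slots (fun i l => ∑ n, (e n : ℂ) * (momDeriv p (μ i) * (if l = n then 1 else 0) -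
    momDeriv p n * (if l = μ i then 1 else 0)))
    (fun i l a => ((eta l * b l (Fin.succ a) : ℝ) : ℂ)), Finset.mul_sum]
  refine Finset.sum_congr rfl fun j _ => ?_
  rw [← mul_assoc]
  congr 1
  rw [← Fin.prod_const, ← Finset.prod_mul_distrib]
  refine Finset.prod_congr rfl fun i _ => ?_
  have hsum : ∀ l, ∑ n, (e n : ℂ) * (momDeriv p (μ i) * (if l = n then 1 else 0) -
      momDeriv p n * (if l = μ i then 1 else 0)) =
      momDeriv p (μ i) * e l - Complex.I * (mdot e p : ℂ) * (if μ i = l then 1 else 0) := by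
    intro l
    rw [← lower_mul_eq_mdot]
    simp_rw [mul_sub, Finset.sum_sub_distrib, mul_ite, mul_one, mul_zero, Finset.sum_ite_eq,
      Finset.mem_univ, if_true, eq_comm (a := l)]
    congr 1
    · ring
    · split_ifs
      · push_cast
        rw [Finset.mul_sum]
        refine Finset.sum_congr rfl fun n _ => ?_
        rw [momDeriv]; ring
      · simp
  simp_rw [hsum]
  have hep' : (mdot e p : ℂ) ≠ 0 := by exact_mod_cast hep
  simp only [openVec, restVec, LinearMap.coe_mk, AddHom.coe_mk, Finset.mul_sum]
  refine Finset.sum_congr rfl fun l _ => ?_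
  simp only [projRow, stringProj, stringInt, momDeriv]
  push_cast
  have hI := Complex.I_sq
  have hx : (((if μ i = l then (1 : ℝ) else 0) : ℝ) : ℂ) = if μ i = l then 1 else 0 := by
    split_ifs <;> simp
  rw [hx]
  field_simp
  linear_combination (eta l * b l (j i).succ * (lower p (μ i) * e l -
    mdot e p * (if μ i = l then 1 else 0)) : ℂ) * hI

/-- The divergence of the projection is p^ν − m² e^ν/(ep). The first term has no space components in
the rest frame, and the prefactor −i/m turns the second into i m e^ν/(ep). -/
lemma sum_openVec {b : Matrix (Fin 4) (Fin 4) ℝ} (hb : IsProperLorentz b) {m : ℝ} (hm : m ≠ 0)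
    {e p : Spacetime} (h : b.mulVec (massiveRef m) = p) (hp : mdot p p = m ^ 2) :
    ∑ ν : Fin 4, (-(1 / (m : ℂ)) * ((eta ν : ℂ) * momDeriv p ν)) • openVec b e p ν =
      Complex.I • closedVec m b e p := by
  have hm' : (m : ℂ) ≠ 0 := by exact_mod_cast hm
  have horth : ∀ a : Fin 3, ∑ ν, p ν * (eta ν * b ν a.succ) = 0 := by
    intro a
    have := congrFun (congrFun hb.1 0) a.succ
    rw [Matrix.mul_apply] at this
    simp only [Matrix.mul_diagonal, Matrix.transpose_apply, Matrix.diagonal_apply] at this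
    rw [if_neg (Fin.succ_ne_zero a).symm] at this
    simp_rw [mulVec_massiveRef h]
    rw [← mul_zero m, ← this, Finset.mul_sum]
    exact Finset.sum_congr rfl fun ν _ => by ring
  have hproj : ∀ ν, ∑ μ, p μ * stringProj e p μ ν = p ν - m ^ 2 * e ν / mdot e p := by
    intro ν
    simp only [stringProj, mul_sub, Finset.sum_sub_distrib, mul_ite, mul_one, mul_zero,
      Finset.sum_ite_eq', Finset.mem_univ, if_true]
    congr 1
    rw [← hp, ← lower_mul_eq_mdot p p, Finset.sum_mul, Finset.sum_div]
    exact Finset.sum_congr rfl fun μ _ => by ring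
  have hcoef : ∀ ν, -(1 / (m : ℂ)) * ((eta ν : ℂ) * momDeriv p ν) =
      -(Complex.I / m) * (p ν : ℂ) := by
    intro ν
    have := congrArg Complex.ofReal (eta_mul_self ν)
    push_cast at this
    rw [momDeriv, lower]
    push_cast
    linear_combination (-(Complex.I / m) * (p ν : ℂ)) * this
  simp_rw [hcoef, openVec, ← map_smul, ← map_sum]
  funext a
  simp only [closedVec, Pi.smul_apply, smul_eq_mul]
  have hL : ∀ n, (∑ ν, (-(Complex.I / m) * (p ν : ℂ)) • projRow e p ν) n =
      -(Complex.I / m) * ((p n - m ^ 2 * e n / mdot e p : ℝ) : ℂ) := by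
    intro n
    rw [← hproj, Finset.sum_apply]
    push_cast
    rw [Finset.mul_sum]
    refine Finset.sum_congr rfl fun ν _ => ?_
    simp [projRow]; ring
  simp only [restVec, LinearMap.coe_mk, AddHom.coe_mk]
  simp_rw [hL]
  have horth' := congrArg Complex.ofReal (horth a)
  push_cast at horth'
  have : ∀ ν, -(Complex.I / m) * ((p ν - m ^ 2 * e ν / mdot e p : ℝ) : ℂ) *
      ((eta ν * b ν a.succ : ℝ) : ℂ) = -(Complex.I / m) * ((p ν : ℂ) * (eta ν * b ν a.succ)) +
      Complex.I * (m * (stringDir e p ν * ((eta ν * b ν a.succ : ℝ) : ℂ))) := by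
    intro ν
    simp only [stringDir]
    push_cast
    field_simp
    ring
  simp_rw [this, Finset.sum_add_distrib, ← Finset.mul_sum, horth']
  push_cast
  ring

/-- Each step of the recursion contracts one open slot, which becomes i times a closed slot. -/
lemma descend_proca {s : ℕ} {b : Matrix (Fin 4) (Fin 4) ℝ} (hb : IsProperLorentz b) {m : ℝ}
    (hm : m ≠ 0) {e p : Spacetime} (h : b.mulVec (massiveRef m) = p) (hp : mdot p p = m ^ 2)
    (hep : mdot e p ≠ 0) (t : TracelessSym s) :
    ∀ (k r : ℕ) (hrk : r + k = s) (μ : Fin r → Fin 4),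
      descend m p (stringPotential e p (procaIntertwiner b t.1)) k r hrk μ =
        Complex.I ^ k * tensorForm t.1 (fun l => if h : (l : ℕ) < r then openVec b e p (μ ⟨l, h⟩)
          else closedVec m b e p) := by
  intro k
  induction k with
  | zero =>
    intro r hrk μ
    obtain rfl : r = s := by omega
    rw [descend, stringPotential_proca b hep]
    simp
  | succ k ih =>
    intro r hrk μ
    rw [descend]
    simp_rw [ih]
    let z : Fin s := ⟨0, by omega⟩
    -- The new index sits in slot 0 and shifts the others by one. The value of `G` at slot 0 is
    -- immaterial because it gets overwritten.
    let G : Fin s → Fin 3 → ℂ := fun l => if h : (l : ℕ) - 1 < r then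
      openVec b e p (μ ⟨l - 1, h⟩) else closedVec m b e p
    have hG : ∀ ν : Fin 4, (fun l : Fin s => if h : (l : ℕ) < r + 1 then
        openVec b e p ((Fin.cons ν μ : Fin (r + 1) → Fin 4) ⟨l, h⟩) else closedVec m b e p) =
        Function.update G z (openVec b e p ν) := by
      intro ν
      funext l
      rcases l with ⟨l, hl⟩
      rcases l with _ | l
      · simp [z, Function.update]
      · rw [Function.update_of_ne (by simp [z, Fin.ext_iff])]
        simp only [G, Nat.add_sub_cancel, Nat.add_lt_add_iff_right]
        congr 1
    simp_rw [hG]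
    have h1 : -(1 / (m : ℂ)) * ∑ ν : Fin 4, (eta ν : ℂ) * momDeriv p ν *
        (Complex.I ^ k * tensorForm t.1 (Function.update G z (openVec b e p ν))) =
        Complex.I ^ k * tensorForm t.1 (Function.update G z
          (∑ ν : Fin 4, (-(1 / (m : ℂ)) * ((eta ν : ℂ) * momDeriv p ν)) • openVec b e p ν)) := by
      rw [MultilinearMap.map_update_sum]
      simp_rw [MultilinearMap.map_update_smul, smul_eq_mul, Finset.mul_sum]
      exact Finset.sum_congr rfl fun ν _ => by ring
    rw [h1, sum_openVec hb hm h hp, MultilinearMap.map_update_smul, smul_eq_mul, ← mul_assoc,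
      ← pow_succ]
    congr 1
    have hr : r < s := by omega
    -- The cycle moves the freshly closed slot 0 to position r, behind the open slots, without
    -- disturbing their order.
    rw [← tensorForm_perm t (Fin.cycleRange ⟨r, hr⟩)]
    congr 1
    funext l
    have : NeZero s := ⟨by omega⟩
    have hz : z = 0 := by ext; rfl
    rcases lt_trichotomy l ⟨r, hr⟩ with hl | hl | hl
    · have hv := Fin.coe_cycleRange_of_lt hl
      have hl' : (l : ℕ) < r := hl
      rw [Function.update_of_ne, dif_pos hl']
      · simp only [G, hv, Nat.add_sub_cancel, dif_pos hl']
      · intro hc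
        rw [hc] at hv
        simp [z] at hv
    · subst hl
      rw [Fin.cycleRange_self, ← hz, Function.update_self]
      simp
    · have hl' : r < (l : ℕ) := hl
      rw [Fin.cycleRange_of_gt hl, Function.update_of_ne, dif_neg (by omega)]
      · simp only [G]
        rw [dif_neg (by omega)]
      · intro hc
        rw [hc] at hl'
        simp [z] at hl'

/-! ### Generating functions of the escort fields. -/

/-- The generating vector `e / (ep) + λ ∑ᵢ zᵢ J_e(p)_{μᵢ}` of an escort field. -/
def genVec (lam : ℝ) {r : ℕ} (e p : Spacetime) (μ : Fin r → Fin 4) (θ : Fin r → ℝ) : Fin 4 → ℂ :=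
  stringDir e p + ∑ i, (unitPhase (θ i) * (lam : ℂ)) • projRow e p (μ i)

/-- The projection to the coefficient of `z₁ ⋯ z_r` on the torus. -/
def torusChar {r : ℕ} (θ : Fin r → ℝ) : ℂ := ∏ i, (unitPhase (θ i))⁻¹

@[fun_prop] lemma continuous_torusChar {r : ℕ} : Continuous (torusChar : (Fin r → ℝ) → ℂ) :=
  continuous_finsetProd _ fun i _ => continuous_unitPhase_inv.comp (continuous_apply i)

@[simp] lemma norm_torusChar {r : ℕ} (θ : Fin r → ℝ) : ‖torusChar θ‖ = 1 := by
  simp [torusChar, norm_prod]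

lemma cdot_add_left (ζ ξ χ : Fin 4 → ℂ) : cdot (ζ + ξ) χ = cdot ζ χ + cdot ξ χ := by
  simp [cdot, mul_add, add_mul, Finset.sum_add_distrib]

lemma cdot_smul_left (c : ℂ) (ζ χ : Fin 4 → ℂ) : cdot (c • ζ) χ = c * cdot ζ χ := by
  simp only [cdot, Pi.smul_apply, smul_eq_mul, Finset.mul_sum]
  exact Finset.sum_congr rfl fun ν _ => by ring

lemma cdot_sum_left {ι : Type*} (S : Finset ι) (f : ι → Fin 4 → ℂ) (χ : Fin 4 → ℂ) :
    cdot (∑ i ∈ S, f i) χ = ∑ i ∈ S, cdot (f i) χ := by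
  simp only [cdot, Finset.sum_apply, Finset.mul_sum, Finset.sum_mul]
  rw [Finset.sum_comm]

lemma cdot_comm (ζ χ : Fin 4 → ℂ) : cdot ζ χ = cdot χ ζ := by
  simp only [cdot]
  exact Finset.sum_congr rfl fun ν _ => by ring

lemma cdot_ofReal (x y : Spacetime) : cdot (fun ν => (x ν : ℂ)) (fun ν => (y ν : ℂ)) =
    (mdot x y : ℂ) := by
  simp [cdot, mdot]

lemma cdot_stringDir {e p : Spacetime} (hep : mdot e p ≠ 0) :
    cdot (stringDir e p) (fun ν => (p ν : ℂ)) = 1 := by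
  have h : stringDir e p = ((mdot e p : ℂ)⁻¹) • fun ν => (e ν : ℂ) := by
    funext ν
    simp [stringDir, div_eq_inv_mul]
  rw [h, cdot_smul_left, cdot_ofReal, inv_mul_cancel₀ (by exact_mod_cast hep)]

lemma cdot_projRow {e p : Spacetime} (hep : mdot e p ≠ 0) (μ : Fin 4) :
    cdot (projRow e p μ) (fun ν => (p ν : ℂ)) = 0 := by
  have h : ∑ ν, stringProj e p μ ν * lower p ν = 0 := by
    have h1 : ∀ ν, stringProj e p μ ν * lower p ν = (if μ = ν then lower p ν else 0) -
        lower p μ / mdot e p * (e ν * lower p ν) := by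
      intro ν
      rw [stringProj]
      split_ifs <;> ring
    simp_rw [h1, Finset.sum_sub_distrib, ← Finset.mul_sum, lower_mul_eq_mdot, Finset.sum_ite_eq,
      Finset.mem_univ, if_true]
    field_simp
    ring
  have h2 : cdot (projRow e p μ) (fun ν => (p ν : ℂ)) =
      ((∑ ν, stringProj e p μ ν * lower p ν : ℝ) : ℂ) := by
    simp only [cdot, projRow, lower]
    push_cast
    exact Finset.sum_congr rfl fun ν _ => by ring
  rw [h2, h, Complex.ofReal_zero]

lemma cdot_genVec (lam : ℝ) {r : ℕ} {e p : Spacetime} (hep : mdot e p ≠ 0) (μ : Fin r → Fin 4)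
    (θ : Fin r → ℝ) : cdot (genVec lam e p μ θ) (fun ν => (p ν : ℂ)) = 1 := by
  rw [genVec, cdot_add_left, cdot_stringDir hep, cdot_sum_left]
  simp [cdot_smul_left, cdot_projRow hep]

lemma prod_ite_lt {r s : ℕ} (hrs : r ≤ s) (c : ℂ) :
    ∏ l : Fin s, (if (l : ℕ) < r then c else 1) = c ^ r := by
  obtain ⟨k, rfl⟩ := Nat.exists_eq_add_of_le hrs
  rw [Fin.prod_univ_add]
  simp

/-- The tensor of an escort field, with its open and its contracted indices. -/
def escortForm {s : ℕ} (m : ℝ) (b : Matrix (Fin 4) (Fin 4) ℝ) (t : TracelessSym s) (r : ℕ)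
    (e p : Spacetime) (μ : Fin r → Fin 4) : ℂ :=
  tensorForm t.1 (fun l => if h : (l : ℕ) < r then openVec b e p (μ ⟨l, h⟩)
    else closedVec m b e p)

/-- Values with mixed slots are reduced to diagonal values, for which the reproducing kernel is
explicit. The parameter λ is the radius of the circles in a Cauchy formula; it is left free because
the uniform bounds need a radius depending on p. -/
lemma escortForm_generating {r s : ℕ} (hrs : r ≤ s) (m lam : ℝ) (b : Matrix (Fin 4) (Fin 4) ℝ)
    (t : TracelessSym s) (e p : Spacetime) (μ : Fin r → Fin 4) :
    ∫ θ, torusChar θ * tensorForm t.1 (fun _ => restVec m b (genVec lam e p μ θ))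
      ∂torusMeasure r =
      ((lam * m : ℝ) : ℂ) ^ r * (s.descFactorial r : ℂ) * escortForm m b t r e p μ := by
  have h1 : ∀ θ, restVec m b (genVec lam e p μ θ) = closedVec m b e p +
      ∑ i, unitPhase (θ i) • (((lam * m : ℝ) : ℂ) • openVec b e p (μ i)) := by
    intro θ
    rw [genVec, map_add, map_sum, closedVec]
    congr 1
    refine Finset.sum_congr rfl fun i _ => ?_
    rw [map_smul, openVec]
    funext a
    simp only [restVec, LinearMap.coe_mk, AddHom.coe_mk, Pi.smul_apply, smul_eq_mul]
    push_cast
    ring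
  simp_rw [h1, torusChar]
  rw [integral_torus_multilinear hrs (tensorForm t.1) (tensorForm_perm t)]
  have h2 : (fun l : Fin s => if h : (l : ℕ) < r then
      ((lam * m : ℝ) : ℂ) • openVec b e p (μ ⟨l, h⟩) else closedVec m b e p) =
      fun l : Fin s => (if (l : ℕ) < r then ((lam * m : ℝ) : ℂ) else 1) •
        (if h : (l : ℕ) < r then openVec b e p (μ ⟨l, h⟩) else closedVec m b e p) := by
    funext l
    split_ifs <;> simp
  rw [h2, MultilinearMap.map_smul_univ, prod_ite_lt hrs, escortForm, smul_eq_mul]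
  ring

lemma conj_tensorForm {s : ℕ} (t : EuclideanSpace ℝ (Fin s → Fin 3)) {g : Fin s → Fin 3 → ℂ}
    (hg : ∀ i a, (starRingEnd ℂ) (g i a) = g i a) :
    (starRingEnd ℂ) (tensorForm t g) = tensorForm t g := by
  simp [tensorForm_apply, hg]

lemma conj_escortForm {s : ℕ} (m : ℝ) (b : Matrix (Fin 4) (Fin 4) ℝ) (t : TracelessSym s) (r : ℕ)
    (e p : Spacetime) (μ : Fin r → Fin 4) :
    (starRingEnd ℂ) (escortForm m b t r e p μ) = escortForm m b t r e p μ := by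
  refine conj_tensorForm _ fun i a => ?_
  split_ifs <;>
  · simp only [openVec, closedVec, restVec, LinearMap.coe_mk, AddHom.coe_mk, map_mul, map_sum,
      Complex.conj_ofReal, projRow, stringDir]

/-! ### The massive two-point kernel in closed form. -/

/-- The generating kernel of the massive fields. -/
def pairKernel (s : ℕ) (m : ℝ) (ζ ξ : Fin 4 → ℂ) : ℂ :=
  ∫ φ, (1 + (-((m : ℂ) ^ 2 * cdot ζ ξ) + m * ((cdot ζ ζ + cdot ξ ξ - 2 * cdot ζ ξ +
    (m : ℂ) ^ 2 * (cdot ζ ξ ^ 2 - cdot ζ ζ * cdot ξ ξ)) / 2 * unitPhase φ +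
      1 / 2 * (unitPhase φ)⁻¹))) ^ s ∂circleMeasure

/-- With (ζp) = (ξp) = 1 the rest-frame products are 1 − m²(ζξ), 1 − m²ζ² and 1 − m²ξ², so the
discriminant has a factor m². It is split so that z and z⁻¹ each carry one factor m, as the limit
s·m → κ requires. -/
lemma sum_tensorForm_restVec {s : ℕ}
    (T : OrthonormalBasis (Fin (spinDim s)) ℝ (TracelessSym s))
    {b : Matrix (Fin 4) (Fin 4) ℝ} (hb : IsProperLorentz b) {m : ℝ}
    {p : Spacetime} (h : b.mulVec (massiveRef m) = p) {ζ ξ : Fin 4 → ℂ}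
    (hζ : cdot ζ (fun ν => (p ν : ℂ)) = 1) (hξ : cdot ξ (fun ν => (p ν : ℂ)) = 1) :
    ((normFactor s ^ 2 : ℝ) : ℂ) * ∑ k, tensorForm (T k).1 (fun _ => restVec m b ζ) *
        tensorForm (T k).1 (fun _ => restVec m b ξ) = pairKernel s m ζ ξ := by
  rw [sum_tensorForm_power, restVec_dotProduct hb h, restVec_dotProduct hb h,
    restVec_dotProduct hb h, hζ, hξ, pairKernel]
  have : ∀ φ, (1 + (-((m : ℂ) ^ 2 * cdot ζ ξ) + m * ((cdot ζ ζ + cdot ξ ξ - 2 * cdot ζ ξ +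
      (m : ℂ) ^ 2 * (cdot ζ ξ ^ 2 - cdot ζ ζ * cdot ξ ξ)) / 2 * unitPhase φ +
      1 / 2 * (unitPhase φ)⁻¹))) = (1 - (m : ℂ) ^ 2 * cdot ζ ξ) +
      ((m * (cdot ζ ζ + cdot ξ ξ - 2 * cdot ζ ξ +
      (m : ℂ) ^ 2 * (cdot ζ ξ ^ 2 - cdot ζ ζ * cdot ξ ξ)) / 2) * unitPhase φ +
      (m / 2) * (unitPhase φ)⁻¹) := fun φ => by ring
  simp_rw [this]
  rw [integral_const_add_linear_pow]
  congr 1 <;> ring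

/-- The coefficient of the generating kernel, as an average over the torus. -/
def torusKernel (s : ℕ) (m lam : ℝ) {r r' : ℕ} (μ : Fin r → Fin 4) (μ' : Fin r' → Fin 4)
    (e e' p : Spacetime) : ℂ :=
  ∫ θ : (Fin r → ℝ) × (Fin r' → ℝ), torusChar θ.1 * torusChar θ.2 *
    pairKernel s m (genVec lam e p μ θ.1) (genVec lam e' p μ' θ.2)
      ∂(torusMeasure r).prod (torusMeasure r')

/-- The factor by which the massive fields and the escort fields differ. -/
def stringPhase (s : ℕ) (m : ℝ) (e p : Spacetime) : ℂ :=
  (1 - (m : ℂ) * (Real.sqrt (-mdot e e) : ℂ) * stringInt e p) ^ s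

lemma continuous_genVec (lam : ℝ) {r : ℕ} (e p : Spacetime) (μ : Fin r → Fin 4) :
    Continuous (genVec lam e p μ) := by
  unfold genVec; fun_prop

lemma continuous_restVec (m : ℝ) (b : Matrix (Fin 4) (Fin 4) ℝ) : Continuous (restVec m b) :=
  LinearMap.continuous_of_finiteDimensional _

lemma continuous_tensorForm_diag {s : ℕ} (t : EuclideanSpace ℝ (Fin s → Fin 3)) :
    Continuous fun x : Fin 3 → ℂ => tensorForm t fun _ => x := by
  simp_rw [tensorForm_apply]; fun_prop

lemma norm_genVec_apply_le (lam : ℝ) {r : ℕ} (e p : Spacetime) (μ : Fin r → Fin 4)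
    (θ : Fin r → ℝ) :
    ‖genVec lam e p μ θ‖ ≤ ‖stringDir e p‖ + ∑ i, |lam| * ‖projRow e p (μ i)‖ := by
  rw [genVec]
  refine (norm_add_le _ _).trans (add_le_add_right ((norm_sum_le _ _).trans
    (Finset.sum_le_sum fun i _ => ?_)) _)
  rw [norm_smul, norm_mul]
  simp

lemma integrable_escort_generating {r s : ℕ} (m lam : ℝ) (b : Matrix (Fin 4) (Fin 4) ℝ)
    (t : TracelessSym s) (e p : Spacetime) (μ : Fin r → Fin 4) :
    Integrable (fun θ => torusChar θ * tensorForm t.1 (fun _ => restVec m b (genVec lam e p μ θ)))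
      (torusMeasure r) := by
  have hc : Continuous fun ζ : Fin 4 → ℂ => tensorForm t.1 (fun _ => restVec m b ζ) :=
    (continuous_tensorForm_diag t.1).comp (continuous_restVec m b)
  obtain ⟨C, hC⟩ := (isCompact_closedBall (0 : Fin 4 → ℂ) (‖stringDir e p‖ +
    ∑ i, |lam| * ‖projRow e p (μ i)‖)).exists_bound_of_continuousOn hc.continuousOn
  refine integrable_of_continuous_of_bound
    (continuous_torusChar.mul (hc.comp (continuous_genVec lam e p μ))) C fun θ => ?_
  rw [norm_mul, norm_torusChar, one_mul]
  exact hC _ (mem_closedBall_zero_iff.2 (norm_genVec_apply_le lam e p μ θ))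

lemma massiveIntertwiner_eq {κ : ℝ} {s r : ℕ} (hrs : r ≤ s)
    (T : OrthonormalBasis (Fin (spinDim s)) ℝ (TracelessSym s))
    {B : Spacetime → Matrix (Fin 4) (Fin 4) ℝ} {e p : Spacetime}
    (hm : plMass κ s ≠ 0) (hp : p ∈ massShell (plMass κ s)) (hb : IsProperLorentz (B p))
    (hBp : (B p).mulVec (massiveRef (plMass κ s)) = p) (hep : mdot e p ≠ 0)
    (μ : Fin r → Fin 4) (n : Fin (spinDim s)) :
    massiveIntertwiner κ s T B r e p μ n = (normFactor s : ℂ) * stringPhase s (plMass κ s) e p *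
      (Complex.I ^ (s - r) * escortForm (plMass κ s) (B p) (T n) r e p μ) := by
  change _ * _ * escortIntertwiner _ _ _ _ _ _ _ = _
  rw [escortIntertwiner, dif_pos hrs, descend_proca hb hm hBp hp.1 hep, stringPhase, escortForm]

lemma conj_I_pow_mul {r r' s : ℕ} (hrs : r ≤ s) (hrs' : r' ≤ s) :
    (starRingEnd ℂ) (Complex.I ^ (s - r)) * Complex.I ^ (s - r') =
      Complex.I ^ r * (-Complex.I) ^ r' := by
  obtain ⟨k, rfl⟩ := Nat.exists_eq_add_of_le hrs
  obtain ⟨k', hk⟩ := Nat.exists_eq_add_of_le hrs'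
  have h1 : r + k - r = k := by omega
  have h2 : r + k - r' = k' := by omega
  rw [h1, h2, map_pow, Complex.conj_I]
  have e1 : ∀ n : ℕ, (-Complex.I) ^ n * Complex.I ^ n = 1 := by
    intro n; rw [← mul_pow, neg_mul, Complex.I_mul_I, neg_neg, one_pow]
  calc (-Complex.I) ^ k * Complex.I ^ k' =
      ((-Complex.I) ^ r * Complex.I ^ r) * ((-Complex.I) ^ r' * Complex.I ^ r') *
        ((-Complex.I) ^ k * Complex.I ^ k') := by rw [e1, e1]; ring
    _ = ((-Complex.I) ^ (r + k) * Complex.I ^ (r' + k')) * (Complex.I ^ r * (-Complex.I) ^ r') := by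
        rw [pow_add, pow_add]; ring
    _ = _ := by rw [← hk, e1, one_mul]

/-- The two-point kernel of the massive fields as a coefficient of the generating kernel. -/
lemma massiveKernel_eq {κ : ℝ} {s r r' : ℕ} (hrs : r ≤ s) (hrs' : r' ≤ s)
    (T : OrthonormalBasis (Fin (spinDim s)) ℝ (TracelessSym s))
    {B : Spacetime → Matrix (Fin 4) (Fin 4) ℝ} {e e' p : Spacetime}
    (hm : plMass κ s ≠ 0) (hp : p ∈ massShell (plMass κ s)) (hb : IsProperLorentz (B p))
    (hBp : (B p).mulVec (massiveRef (plMass κ s)) = p) (hep : mdot e p ≠ 0) (hep' : mdot e' p ≠ 0)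
    (μ : Fin r → Fin 4) (μ' : Fin r' → Fin 4) (lam : ℝ) :
    ((lam * plMass κ s : ℝ) : ℂ) ^ (r + r') *
        ((s.descFactorial r : ℂ) * (s.descFactorial r' : ℂ)) * massiveKernel κ s T B μ μ' e e' p =
      (starRingEnd ℂ) (stringPhase s (plMass κ s) e p) * stringPhase s (plMass κ s) e' p *
        (Complex.I ^ r * (-Complex.I) ^ r') *
        torusKernel s (plMass κ s) lam μ μ' e e' p := by
  set m := plMass κ s
  have h1 : massiveKernel κ s T B μ μ' e e' p =
      (starRingEnd ℂ) (stringPhase s m e p) * stringPhase s m e' p *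
        (Complex.I ^ r * (-Complex.I) ^ r') * (((normFactor s ^ 2 : ℝ) : ℂ) *
        ∑ n, escortForm m (B p) (T n) r e p μ * escortForm m (B p) (T n) r' e' p μ') := by
    rw [massiveKernel, Finset.mul_sum, Finset.mul_sum, ← conj_I_pow_mul hrs hrs']
    refine Finset.sum_congr rfl fun n _ => ?_
    rw [massiveIntertwiner_eq hrs T hm hp hb hBp hep, massiveIntertwiner_eq hrs' T hm hp hb hBp hep']
    simp only [map_mul, conj_escortForm, Complex.conj_ofReal]
    push_cast
    ring
  have h2 : torusKernel s m lam μ μ' e e' p = ((lam * m : ℝ) : ℂ) ^ (r + r') *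
        ((s.descFactorial r : ℂ) * (s.descFactorial r' : ℂ)) * (((normFactor s ^ 2 : ℝ) : ℂ) *
        ∑ n, escortForm m (B p) (T n) r e p μ * escortForm m (B p) (T n) r' e' p μ') := by
    -- Undoing the sum over the basis makes each term a product of functions of the two sets of
    -- angles, so that coefficients can be extracted separately.
    have h3 : ∀ θ : (Fin r → ℝ) × (Fin r' → ℝ), torusChar θ.1 * torusChar θ.2 *
        pairKernel s m (genVec lam e p μ θ.1) (genVec lam e' p μ' θ.2) =
        ((normFactor s ^ 2 : ℝ) : ℂ) * ∑ n, (torusChar θ.1 *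
          tensorForm (T n).1 (fun _ => restVec m (B p) (genVec lam e p μ θ.1))) *
          (torusChar θ.2 *
          tensorForm (T n).1 (fun _ => restVec m (B p) (genVec lam e' p μ' θ.2))) := by
      intro θ
      rw [← sum_tensorForm_restVec T hb hBp (cdot_genVec lam hep μ θ.1)
        (cdot_genVec lam hep' μ' θ.2), Finset.mul_sum, Finset.mul_sum, Finset.mul_sum]
      exact Finset.sum_congr rfl fun n _ => by ring
    rw [torusKernel]
    simp_rw [h3]
    rw [integral_const_mul, integral_finsetSum]
    · rw [Finset.mul_sum, Finset.mul_sum, Finset.mul_sum]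
      refine Finset.sum_congr rfl fun n _ => ?_
      rw [integral_prod_mul (fun θ => torusChar θ *
          tensorForm (T n).1 (fun _ => restVec m (B p) (genVec lam e p μ θ)))
        (fun θ => torusChar θ *
          tensorForm (T n).1 (fun _ => restVec m (B p) (genVec lam e' p μ' θ))),
        escortForm_generating hrs, escortForm_generating hrs', pow_add]
      ring
    · intro n _
      exact (integrable_escort_generating m lam (B p) (T n) e p μ).mul_prod
        (integrable_escort_generating m lam (B p) (T n) e' p μ')
  rw [h1, h2]
  ring

/-! ### The infinite-spin fields -/

lemma norm_cdot_le (ζ ξ : Fin 4 → ℂ) : ‖cdot ζ ξ‖ ≤ 4 * (‖ζ‖ * ‖ξ‖) := by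
  refine (norm_sum_le _ _).trans ?_
  have h : ∀ ν ∈ Finset.univ, ‖(eta ν : ℂ) * ζ ν * ξ ν‖ ≤ ‖ζ‖ * ‖ξ‖ := by
    intro ν _
    have h1 : ‖(eta ν : ℂ)‖ = 1 := by fin_cases ν <;> simp [eta]
    rw [norm_mul, norm_mul, h1, one_mul]
    exact mul_le_mul (norm_le_pi_norm ζ ν) (norm_le_pi_norm ξ ν) (norm_nonneg _) (norm_nonneg _)
  refine (Finset.sum_le_sum h).trans ?_
  simp

@[fun_prop] lemma continuous_cdot {α : Type*} [TopologicalSpace α] {f g : α → Fin 4 → ℂ}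
    (hf : Continuous f) (hg : Continuous g) : Continuous fun x => cdot (f x) (g x) := by
  unfold cdot; fun_prop

/-- The generating kernel of the infinite-spin fields. -/
def limKernel (κ : ℝ) (ζ ξ : Fin 4 → ℂ) : ℂ :=
  ∫ φ, Complex.exp (κ * ((cdot ζ ζ + cdot ξ ξ - 2 * cdot ζ ξ) / 2 * unitPhase φ +
      1 / 2 * (unitPhase φ)⁻¹)) ∂circleMeasure

/-- The coefficient of the generating kernel of the infinite-spin fields. -/
def torusLimit (κ lam : ℝ) {r r' : ℕ} (μ : Fin r → Fin 4) (μ' : Fin r' → Fin 4)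
    (e e' p : Spacetime) : ℂ :=
  ∫ θ : (Fin r → ℝ) × (Fin r' → ℝ), torusChar θ.1 * torusChar θ.2 *
    limKernel κ (genVec lam e p μ θ.1) (genVec lam e' p μ' θ.2)
      ∂(torusMeasure r).prod (torusMeasure r')

/-- The phase factor of the infinite-spin fields. -/
def limPhase (κ : ℝ) (e p : Spacetime) : ℂ :=
  Complex.exp (-Complex.I * (κ * Real.sqrt (-mdot e e) / mdot e p : ℝ))

/-- Since p = b₀ + b₃, the time and third components contribute (δ(b₀ − b₃))(δp) = 0, and only the
transverse ones remain. -/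
lemma cdot_self_of_orthogonal {b : Matrix (Fin 4) (Fin 4) ℝ} (hb : IsProperLorentz b)
    {p : Spacetime} (h : b.mulVec masslessRef = p) {δ : Fin 4 → ℂ}
    (hδ : cdot δ (fun ν => (p ν : ℂ)) = 0) :
    cdot δ δ = -(cdot δ (fun ν => (b ν 1 : ℂ)) ^ 2 + cdot δ (fun ν => (b ν 2 : ℂ)) ^ 2) := by
  have h1 : ∀ μ ν : Fin 4, ((b μ 0 : ℂ) * b ν 0 - (b μ 1 * b ν 1 + b μ 2 * b ν 2 +
      b μ 3 * b ν 3)) = if μ = ν then (eta μ : ℂ) else 0 := by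
    intro μ ν
    have := congrArg Complex.ofReal (hb.completeness μ ν)
    rw [Fin.sum_univ_three, apply_ite Complex.ofReal] at this
    push_cast at this
    exact this
  have h2 : ∑ μ, ∑ ν, (eta μ * δ μ) * (eta ν * δ ν) * ((b μ 0 : ℂ) * b ν 0 -
      (b μ 1 * b ν 1 + b μ 2 * b ν 2 + b μ 3 * b ν 3)) = cdot δ δ := by
    simp_rw [h1, mul_ite, mul_zero, Finset.sum_ite_eq, Finset.mem_univ, if_true, cdot]
    refine Finset.sum_congr rfl fun ν _ => ?_
    have := congrArg Complex.ofReal (eta_mul_self ν)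
    push_cast at this
    linear_combination (eta ν * δ ν * δ ν : ℂ) * this
  have h3 : ∀ ν, (p ν : ℂ) = b ν 0 + b ν 3 := by
    intro ν
    rw [← h]
    simp [Matrix.mulVec, dotProduct, masslessRef, Fin.sum_univ_four]
  simp_rw [h3] at hδ
  rw [← h2]
  simp only [cdot, Fin.sum_univ_four] at hδ ⊢
  linear_combination ((eta 0 : ℂ) * δ 0 * (b 0 0 - b 0 3) + (eta 1 : ℂ) * δ 1 * (b 1 0 - b 1 3) +
    (eta 2 : ℂ) * δ 2 * (b 2 0 - b 2 3) + (eta 3 : ℂ) * δ 3 * (b 3 0 - b 3 3)) * hδ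

lemma cdot_transverse (κ : ℝ) (b : Matrix (Fin 4) (Fin 4) ℝ) (δ : Fin 4 → ℂ) (φ : ℝ) :
    cdot δ (fun ν => (transverse κ b φ ν : ℂ)) =
      κ * (Real.cos φ * cdot δ (fun ν => (b ν 1 : ℂ)) +
        Real.sin φ * cdot δ (fun ν => (b ν 2 : ℂ))) := by
  simp [transverse, Matrix.mulVec, dotProduct, cdot, Fin.sum_univ_four]
  ring

/-- The exponents have the form βz + γ/z, and βγ = κ²δ²/4 on both sides. The average thus depends on
δ² only and no longer on the boost. -/
lemma integral_exp_transverse {b : Matrix (Fin 4) (Fin 4) ℝ} (hb : IsProperLorentz b)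
    {p : Spacetime} (h : b.mulVec masslessRef = p) (κ : ℝ) {δ : Fin 4 → ℂ}
    (hδ : cdot δ (fun ν => (p ν : ℂ)) = 0) :
    ∫ φ, Complex.exp (Complex.I * cdot δ (fun ν => (transverse κ b φ ν : ℂ))) ∂circleMeasure =
      ∫ φ, Complex.exp (κ * (cdot δ δ / 2 * unitPhase φ + 1 / 2 * (unitPhase φ)⁻¹))
        ∂circleMeasure := by
  have h1 := cdot_self_of_orthogonal hb h hδ
  set D₁ := cdot δ (fun ν => (b ν 1 : ℂ))
  set D₂ := cdot δ (fun ν => (b ν 2 : ℂ))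
  have h2 : ∀ φ : ℝ, Complex.I * cdot δ (fun ν => (transverse κ b φ ν : ℂ)) =
      (Complex.I * κ * (D₁ - Complex.I * D₂) / 2) * unitPhase φ +
      (Complex.I * κ * (D₁ + Complex.I * D₂) / 2) * (unitPhase φ)⁻¹ := by
    intro φ
    rw [cdot_transverse, unitPhase, ← Complex.exp_neg, ← neg_mul, Complex.exp_mul_I,
      Complex.exp_mul_I, Complex.cos_neg, Complex.sin_neg]
    push_cast
    linear_combination (Complex.I * κ * Complex.sin φ * D₂) * Complex.I_sq
  have h3 : ∀ φ : ℝ, κ * (cdot δ δ / 2 * unitPhase φ + 1 / 2 * (unitPhase φ)⁻¹) =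
      (κ * cdot δ δ / 2) * unitPhase φ + (κ / 2) * (unitPhase φ)⁻¹ := fun φ => by ring
  simp_rw [h2, h3]
  refine integral_exp_linear_congr ?_
  rw [h1]
  linear_combination (κ ^ 2 / 4 * (D₁ ^ 2 - D₂ ^ 2 * (Complex.I ^ 2 - 1)) : ℂ) * Complex.I_sq

lemma cdot_sub_left (ζ ξ χ : Fin 4 → ℂ) : cdot (ζ - ξ) χ = cdot ζ χ - cdot ξ χ := by
  simp [cdot, mul_sub, sub_mul, Finset.sum_sub_distrib]

/-- Applied to δ = ζ − ξ, the plane wave splits into one factor for each field, which is the form of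
a two-point kernel on the circle. -/
lemma limKernel_eq {b : Matrix (Fin 4) (Fin 4) ℝ} (hb : IsProperLorentz b)
    {p : Spacetime} (h : b.mulVec masslessRef = p) (κ : ℝ) {ζ ξ : Fin 4 → ℂ}
    (hζ : cdot ζ (fun ν => (p ν : ℂ)) = 1) (hξ : cdot ξ (fun ν => (p ν : ℂ)) = 1) :
    limKernel κ ζ ξ = ∫ φ, Complex.exp (Complex.I * cdot ζ (fun ν => (transverse κ b φ ν : ℂ))) *
      Complex.exp (-Complex.I * cdot ξ (fun ν => (transverse κ b φ ν : ℂ))) ∂circleMeasure := by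
  have h1 : cdot (ζ - ξ) (fun ν => (p ν : ℂ)) = 0 := by rw [cdot_sub_left, hζ, hξ, sub_self]
  have h2 := integral_exp_transverse hb h κ h1
  have h3 : cdot (ζ - ξ) (ζ - ξ) = cdot ζ ζ + cdot ξ ξ - 2 * cdot ζ ξ := by
    rw [cdot_sub_left, cdot_comm ζ, cdot_comm ξ, cdot_sub_left, cdot_sub_left, cdot_comm ξ ζ]
    ring
  rw [h3] at h2
  rw [limKernel, ← h2]
  congr 1; ext φ
  rw [← Complex.exp_add, cdot_sub_left]
  ring_nf

lemma continuous_transverse (κ : ℝ) (b : Matrix (Fin 4) (Fin 4) ℝ) :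
    Continuous (transverse κ b) := by
  unfold transverse
  refine Continuous.matrix_mulVec continuous_const ?_
  refine continuous_pi fun i => ?_
  fin_cases i <;> simp <;> fun_prop

lemma exists_transverse_bound (κ : ℝ) (b : Matrix (Fin 4) (Fin 4) ℝ) :
    ∃ C, ∀ φ, ‖fun ν => (transverse κ b φ ν : ℂ)‖ ≤ C := by
  refine ⟨∑ ν, (|κ * b ν 1| + |κ * b ν 2|), fun φ => ?_⟩
  refine (pi_norm_le_iff_of_nonneg (by positivity)).2 fun ν => ?_
  refine le_trans ?_ (Finset.single_le_sum (f := fun ν => |κ * b ν 1| + |κ * b ν 2|)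
    (fun _ _ => by positivity) (Finset.mem_univ ν))
  rw [Complex.norm_real, Real.norm_eq_abs]
  have : transverse κ b φ ν = κ * b ν 1 * Real.cos φ + κ * b ν 2 * Real.sin φ := by
    simp [transverse, Matrix.mulVec, dotProduct, Fin.sum_univ_four]; ring
  rw [this]
  refine (abs_add_le _ _).trans (add_le_add ?_ ?_)
  · rw [abs_mul]; exact mul_le_of_le_one_right (abs_nonneg _) (Real.abs_cos_le_one φ)
  · rw [abs_mul]; exact mul_le_of_le_one_right (abs_nonneg _) (Real.abs_sin_le_one φ)

/-- The coefficient extraction for a plane wave. -/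
lemma integral_torus_plane_wave (lam : ℝ) {r : ℕ} (e p : Spacetime) (μ : Fin r → Fin 4)
    (c : ℂ) (E : Fin 4 → ℂ) :
    ∫ θ, torusChar θ * Complex.exp (c * cdot (genVec lam e p μ θ) E) ∂torusMeasure r =
      (c * lam) ^ r * (∏ i, cdot (projRow e p (μ i)) E) *
        Complex.exp (c * cdot (stringDir e p) E) := by
  have h : ∀ θ : Fin r → ℝ, torusChar θ * Complex.exp (c * cdot (genVec lam e p μ θ) E) =
      ((∏ i, (unitPhase (θ i))⁻¹) * Complex.exp (∑ i, (c * lam * cdot (projRow e p (μ i)) E) *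
        unitPhase (θ i))) * Complex.exp (c * cdot (stringDir e p) E) := by
    intro θ
    rw [mul_assoc, ← Complex.exp_add, torusChar, genVec, cdot_add_left, cdot_sum_left]
    simp_rw [cdot_smul_left]
    rw [mul_add, Finset.mul_sum, add_comm]
    congr 3
    exact Finset.sum_congr rfl fun i _ => by ring
  simp_rw [h]
  rw [integral_mul_const, integral_torus_exp, Finset.prod_mul_distrib]
  simp

/-- The two-point kernel of the infinite-spin fields as a coefficient of the generating kernel. -/
lemma infKernel_eq {κ : ℝ} (hκ : κ ≠ 0) {r r' : ℕ} {B : Spacetime → Matrix (Fin 4) (Fin 4) ℝ}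
    {e e' p : Spacetime} (hb : IsProperLorentz (B p)) (hBp : (B p).mulVec masslessRef = p)
    (hep : mdot e p ≠ 0) (hep' : mdot e' p ≠ 0)
    (μ : Fin r → Fin 4) (μ' : Fin r' → Fin 4) (lam : ℝ) :
    ((lam * κ : ℝ) : ℂ) ^ (r + r') * infKernel κ B μ μ' e e' p =
      (starRingEnd ℂ) (limPhase κ e p) * limPhase κ e' p *
        (Complex.I ^ r * (-Complex.I) ^ r') * torusLimit κ lam μ μ' e e' p := by
  set E : ℝ → Fin 4 → ℂ := fun φ ν => (transverse κ (B p) φ ν : ℂ) with hE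
  obtain ⟨C, hC⟩ := exists_transverse_bound κ (B p)
  have hEc : Continuous E := continuous_pi fun ν =>
    Complex.continuous_ofReal.comp ((continuous_apply ν).comp (continuous_transverse κ (B p)))
  have hproj : ∀ (e : Spacetime) (μ : Fin 4) (φ : ℝ), ((∑ ν, stringProj e p μ ν *
      lower (transverse κ (B p) φ) ν : ℝ) : ℂ) = cdot (projRow e p μ) (E φ) := by
    intro e μ φ
    simp only [cdot, projRow, hE, lower]
    push_cast
    exact Finset.sum_congr rfl fun ν _ => by ring
  have hdir : ∀ (e : Spacetime) (φ : ℝ), ((mdot e (transverse κ (B p) φ) / mdot e p : ℝ) : ℂ) =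
      cdot (stringDir e p) (E φ) := by
    intro e φ
    simp only [cdot, stringDir, hE, mdot]
    push_cast
    rw [Finset.sum_div]
    exact Finset.sum_congr rfl fun ν _ => by ring
  have hint : ∀ (r : ℕ) (e : Spacetime) (μ : Fin r → Fin 4) (φ : ℝ), infIntertwiner κ B r e p μ φ =
      ((-κ : ℂ)⁻¹ ^ r * ∏ i, cdot (projRow e p (μ i)) (E φ)) * (limPhase κ e p *
        Complex.exp (-Complex.I * cdot (stringDir e p) (E φ))) := by
    intro r e μ φ
    rw [infIntertwiner, standardIntertwiner, limPhase, ← hdir, Complex.ofReal_mul,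
      Complex.ofReal_prod]
    simp_rw [hproj]
    push_cast
    ring
  have hreal : ∀ (x : Fin 4 → ℝ) (φ : ℝ), (starRingEnd ℂ) (cdot (fun ν => (x ν : ℂ)) (E φ)) =
      cdot (fun ν => (x ν : ℂ)) (E φ) := by
    intro x φ
    simp [cdot, hE]
  have hconj : ∀ φ, (starRingEnd ℂ) (infIntertwiner κ B r e p μ φ) =
      ((-κ : ℂ)⁻¹ ^ r * ∏ i, cdot (projRow e p (μ i)) (E φ)) *
        ((starRingEnd ℂ) (limPhase κ e p) *
          Complex.exp (Complex.I * cdot (stringDir e p) (E φ))) := by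
    intro φ
    rw [hint]
    simp only [map_mul, map_pow, map_inv₀, map_neg, Complex.conj_ofReal, map_prod,
      ← Complex.exp_conj, Complex.conj_I, neg_neg]
    congr 2
    · congr 1
      exact funext fun i => hreal (stringProj e p (μ i)) φ
    · congr 3
      exact hreal (fun ν => e ν / mdot e p) φ
  -- Fubini brings the torus integral inside, where it extracts coefficients from a product of two
  -- plane waves at fixed φ.
  let F : ℝ → (Fin r → ℝ) × (Fin r' → ℝ) → ℂ := fun φ θ =>
    (torusChar θ.1 * Complex.exp (Complex.I * cdot (genVec lam e p μ θ.1) (E φ))) *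
    (torusChar θ.2 * Complex.exp (-Complex.I * cdot (genVec lam e' p μ' θ.2) (E φ)))
  have hFint : Integrable (Function.uncurry F)
      (circleMeasure.prod ((torusMeasure r).prod (torusMeasure r'))) := by
    have c1 := continuous_genVec lam e p μ
    have c2 := continuous_genVec lam e' p μ'
    refine integrable_of_continuous_of_bound (by simp only [F, Function.uncurry_def]; fun_prop)
      (Real.exp (4 * ((‖stringDir e p‖ + ∑ i, |lam| * ‖projRow e p (μ i)‖) * C)) *
        Real.exp (4 * ((‖stringDir e' p‖ + ∑ i, |lam| * ‖projRow e' p (μ' i)‖) * C))) fun x => ?_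
    have hb1 : ∀ (c : ℂ) (hc : ‖c‖ = 1) (ζ : Fin 4 → ℂ) (R : ℝ) (hR : ‖ζ‖ ≤ R),
        ‖Complex.exp (c * cdot ζ (E x.1))‖ ≤ Real.exp (4 * (R * C)) := by
      intro c hc ζ R hR
      refine (Complex.norm_exp_le_exp_norm _).trans (Real.exp_le_exp.2 ?_)
      rw [norm_mul, hc, one_mul]
      refine (norm_cdot_le _ _).trans ?_
      have := hC x.1
      have h0 := norm_nonneg ζ
      have h1 := norm_nonneg (E x.1)
      gcongr
      exact h0.trans hR
    simp only [F, Function.uncurry_def, norm_mul, norm_torusChar, one_mul]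
    exact mul_le_mul (hb1 _ (by simp) _ _ (norm_genVec_apply_le lam e p μ _))
      (hb1 _ (by simp) _ _ (norm_genVec_apply_le lam e' p μ' _)) (norm_nonneg _) (Real.exp_nonneg _)
  have hswap : torusLimit κ lam μ μ' e e' p = ∫ φ, ∫ θ, F φ θ
      ∂((torusMeasure r).prod (torusMeasure r')) ∂circleMeasure := by
    rw [integral_integral_swap hFint, torusLimit]
    congr 1; ext θ
    rw [limKernel_eq hb hBp κ (cdot_genVec lam hep μ θ.1) (cdot_genVec lam hep' μ' θ.2),
      ← integral_const_mul]
    congr 1; ext φ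
    simp only [F, hE]; ring
  have hF : ∀ φ, ∫ θ, F φ θ ∂((torusMeasure r).prod (torusMeasure r')) =
      ((Complex.I * lam) ^ r * (∏ i, cdot (projRow e p (μ i)) (E φ)) *
        Complex.exp (Complex.I * cdot (stringDir e p) (E φ))) *
      ((-Complex.I * lam) ^ r' * (∏ i, cdot (projRow e' p (μ' i)) (E φ)) *
        Complex.exp (-Complex.I * cdot (stringDir e' p) (E φ))) := by
    intro φ
    simp only [F]
    rw [integral_prod_mul (fun θ => torusChar θ *
      Complex.exp (Complex.I * cdot (genVec lam e p μ θ) (E φ)))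
      (fun θ => torusChar θ * Complex.exp (-Complex.I * cdot (genVec lam e' p μ' θ) (E φ))),
      integral_torus_plane_wave, integral_torus_plane_wave]
  rw [hswap, infKernel, ← integral_const_mul, ← integral_const_mul]
  congr 1; ext φ
  rw [hF, hconj, hint]
  have hκ' : (κ : ℂ) ≠ 0 := by exact_mod_cast hκ
  have e1 : ∀ n : ℕ, (κ : ℂ) ^ n * (-κ : ℂ)⁻¹ ^ n = (-1) ^ n := by
    intro n
    rw [← mul_pow]
    congr 1
    field_simp
  have e2 : ∀ n : ℕ, Complex.I ^ n * Complex.I ^ n = (-1) ^ n := by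
    intro n; rw [← mul_pow, Complex.I_mul_I]
  have e3 : ∀ n : ℕ, (-Complex.I) ^ n * (-Complex.I) ^ n = (-1) ^ n := by
    intro n; rw [← mul_pow, neg_mul_neg, Complex.I_mul_I]
  -- Each tensor index gives −1 on both sides: from κ·(−κ)⁻¹ on the left, and from (±i)², one factor
  -- by differentiating the plane wave and one from the recursion, on the right.
  calc _ = ((κ : ℂ) ^ r * (-κ : ℂ)⁻¹ ^ r) * ((κ : ℂ) ^ r' * (-κ : ℂ)⁻¹ ^ r') *
      ((lam : ℂ) ^ (r + r') * (∏ i, cdot (projRow e p (μ i)) (E φ)) *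
        (∏ i, cdot (projRow e' p (μ' i)) (E φ)) *
        (starRingEnd ℂ) (limPhase κ e p) * limPhase κ e' p *
        Complex.exp (Complex.I * cdot (stringDir e p) (E φ)) *
        Complex.exp (-Complex.I * cdot (stringDir e' p) (E φ))) := by
        push_cast; rw [mul_pow, pow_add, pow_add]; ring
    _ = _ := by
        rw [e1, e1, ← e2 r, ← e3 r', mul_pow, mul_pow, pow_add]; ring

/-! ### The Pauli-Lubanski limit of the two-point kernels -/

lemma plMass_pos {κ : ℝ} (hκ : 0 < κ) {s : ℕ} (hs : 1 ≤ s) : 0 < plMass κ s := by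
  have : (0 : ℝ) < s := by exact_mod_cast hs
  unfold plMass; positivity

lemma plMass_nonneg {κ : ℝ} (hκ : 0 < κ) (s : ℕ) : 0 ≤ plMass κ s := by
  unfold plMass; positivity

/-- This is the source of uniformity in s: any (1 + x)^s with |x| ≤ m·c is bounded by exp(κc). -/
lemma natCast_mul_plMass_le {κ : ℝ} (hκ : 0 < κ) (s : ℕ) : s * plMass κ s ≤ κ := by
  rcases Nat.eq_zero_or_pos s with rfl | hs
  · simpa using hκ.le
  have hs' : (0 : ℝ) < s := by exact_mod_cast hs
  have h : (s : ℝ) ≤ Real.sqrt (s * (s + 1)) := Real.le_sqrt_of_sq_le (by nlinarith)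
  rw [plMass, mul_div_assoc', div_le_iff₀ (hs'.trans_le h), mul_comm]
  exact mul_le_mul_of_nonneg_left h hκ.le

lemma plMass_le {κ : ℝ} (hκ : 0 < κ) (s : ℕ) : plMass κ s ≤ κ := by
  rcases Nat.eq_zero_or_pos s with rfl | hs
  · simpa [plMass] using hκ.le
  refine le_trans ?_ (natCast_mul_plMass_le hκ s)
  exact le_mul_of_one_le_left (plMass_nonneg hκ s) (by exact_mod_cast hs)

lemma tendsto_natCast_mul_plMass (κ : ℝ) :
    Tendsto (fun s : ℕ => (s : ℝ) * plMass κ s) atTop (𝓝 κ) := by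
  have h1 : Tendsto (fun s : ℕ => κ * Real.sqrt ((s : ℝ) / (s + 1))) atTop
      (𝓝 (κ * Real.sqrt 1)) := by
    refine Tendsto.const_mul _ ((Real.continuous_sqrt.tendsto 1).comp ?_)
    exact tendsto_natCast_div_add_atTop 1
  rw [Real.sqrt_one, mul_one] at h1
  refine h1.congr' ?_
  filter_upwards [eventually_gt_atTop 0] with s hs
  have hs' : (0 : ℝ) < s := by exact_mod_cast hs
  rw [plMass, Real.sqrt_div hs'.le, Real.sqrt_mul hs'.le]
  have h2 := Real.mul_self_sqrt hs'.le
  have h3 : Real.sqrt s ≠ 0 := by positivity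
  have h4 : Real.sqrt ((s : ℝ) + 1) ≠ 0 := by positivity
  field_simp
  linear_combination κ * h2

lemma tendsto_plMass (κ : ℝ) : Tendsto (plMass κ) atTop (𝓝 0) := by
  have h := (tendsto_natCast_mul_plMass κ).mul (tendsto_inv_atTop_nhds_zero_nat (𝕜 := ℝ))
  rw [mul_zero] at h
  refine h.congr' ?_
  filter_upwards [eventually_gt_atTop 0] with s hs
  have hs' : (s : ℝ) ≠ 0 := by exact_mod_cast hs.ne'
  field_simp

lemma tendsto_plMass_pow_mul_descFactorial (κ : ℝ) (r : ℕ) :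
    Tendsto (fun s : ℕ => plMass κ s ^ r * (s.descFactorial r : ℝ)) atTop (𝓝 (κ ^ r)) := by
  induction r with
  | zero => simp
  | succ r ih =>
    have h1 : Tendsto (fun s : ℕ => plMass κ s * ((s : ℝ) - r)) atTop (𝓝 κ) := by
      have := (tendsto_natCast_mul_plMass κ).sub ((tendsto_plMass κ).mul_const (r : ℝ))
      rw [zero_mul, sub_zero] at this
      exact this.congr fun s => by ring
    have h2 := ih.mul h1
    rw [← pow_succ] at h2
    refine h2.congr' ?_
    filter_upwards [eventually_ge_atTop r] with s hs
    rw [Nat.descFactorial_succ]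
    push_cast [hs]
    ring

lemma pairKernel_bound {κ : ℝ} (hκ : 0 < κ) (s : ℕ) {M : ℝ} {ζ ξ : Fin 4 → ℂ}
    (h1 : ‖cdot ζ ξ‖ ≤ M) (h2 : ‖cdot ζ ζ‖ ≤ M) (h3 : ‖cdot ξ ξ‖ ≤ M) (φ : ℝ) :
    ‖(1 + (-((plMass κ s : ℂ) ^ 2 * cdot ζ ξ) + plMass κ s * ((cdot ζ ζ + cdot ξ ξ - 2 * cdot ζ ξ +
      (plMass κ s : ℂ) ^ 2 * (cdot ζ ξ ^ 2 - cdot ζ ζ * cdot ξ ξ)) / 2 * unitPhase φ +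
      1 / 2 * (unitPhase φ)⁻¹))) ^ s‖ ≤
      Real.exp (κ * (κ * M + (2 * M + κ ^ 2 * M ^ 2 + 1))) := by
  set m := plMass κ s
  have hM : 0 ≤ M := (norm_nonneg _).trans h1
  have hm : 0 ≤ m := plMass_nonneg hκ s
  have hmκ : m ≤ κ := plMass_le hκ s
  have hE : ‖cdot ζ ζ + cdot ξ ξ - 2 * cdot ζ ξ +
      (m : ℂ) ^ 2 * (cdot ζ ξ ^ 2 - cdot ζ ζ * cdot ξ ξ)‖ ≤ 4 * M + κ ^ 2 * (2 * M ^ 2) := by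
    refine (norm_add_le _ _).trans (add_le_add ?_ ?_)
    · refine (norm_sub_le _ _).trans ?_
      have := norm_add_le (cdot ζ ζ) (cdot ξ ξ)
      rw [norm_mul, Complex.norm_ofNat]
      linarith
    · rw [norm_mul, norm_pow, Complex.norm_real, Real.norm_of_nonneg hm]
      have h4 : ‖cdot ζ ξ ^ 2 - cdot ζ ζ * cdot ξ ξ‖ ≤ 2 * M ^ 2 := by
        refine (norm_sub_le _ _).trans ?_
        rw [norm_pow, norm_mul]
        have e1 := pow_le_pow_left₀ (norm_nonneg _) h1 2
        have e2 := mul_le_mul h2 h3 (norm_nonneg _) hM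
        nlinarith
      gcongr
  refine norm_one_add_pow_le ?_
  have hx : ‖-((m : ℂ) ^ 2 * cdot ζ ξ) + m * ((cdot ζ ζ + cdot ξ ξ - 2 * cdot ζ ξ +
      (m : ℂ) ^ 2 * (cdot ζ ξ ^ 2 - cdot ζ ζ * cdot ξ ξ)) / 2 * unitPhase φ +
      1 / 2 * (unitPhase φ)⁻¹)‖ ≤ m * (κ * M + (2 * M + κ ^ 2 * M ^ 2 + 1)) := by
    refine (norm_add_le _ _).trans ?_
    rw [mul_add m]
    refine add_le_add ?_ ?_
    · rw [norm_neg, norm_mul, norm_pow, Complex.norm_real, Real.norm_of_nonneg hm, sq, mul_assoc]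
      gcongr
    · rw [norm_mul, Complex.norm_real, Real.norm_of_nonneg hm]
      refine mul_le_mul_of_nonneg_left ((norm_add_le _ _).trans ?_) hm
      rw [norm_mul, norm_mul, norm_inv, norm_unitPhase, norm_div, norm_div, norm_one,
        Complex.norm_ofNat]
      linarith
  calc (s : ℝ) * _ ≤ s * (m * (κ * M + (2 * M + κ ^ 2 * M ^ 2 + 1))) :=
        mul_le_mul_of_nonneg_left hx (Nat.cast_nonneg _)
    _ = (s * m) * (κ * M + (2 * M + κ ^ 2 * M ^ 2 + 1)) := by ring
    _ ≤ _ := mul_le_mul_of_nonneg_right (natCast_mul_plMass_le hκ s) (by positivity)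

lemma norm_pairKernel_le {κ : ℝ} (hκ : 0 < κ) (s : ℕ) {M : ℝ} {ζ ξ : Fin 4 → ℂ}
    (h1 : ‖cdot ζ ξ‖ ≤ M) (h2 : ‖cdot ζ ζ‖ ≤ M) (h3 : ‖cdot ξ ξ‖ ≤ M) :
    ‖pairKernel s (plMass κ s) ζ ξ‖ ≤
      Real.exp (κ * (κ * M + (2 * M + κ ^ 2 * M ^ 2 + 1))) := by
  refine (norm_integral_le_of_norm_le_const
    (Eventually.of_forall (pairKernel_bound hκ s h1 h2 h3))).trans ?_
  simp

lemma tendsto_ofReal_of_tendsto {α : Type*} {l : Filter α} {f : α → ℝ} {x : ℝ}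
    (h : Tendsto f l (𝓝 x)) : Tendsto (fun a => (f a : ℂ)) l (𝓝 (x : ℂ)) :=
  (Complex.continuous_ofReal.tendsto x).comp h

lemma tendsto_cdot {α : Type*} {l : Filter α} {f g : α → Fin 4 → ℂ} {ζ ξ : Fin 4 → ℂ}
    (hf : Tendsto f l (𝓝 ζ)) (hg : Tendsto g l (𝓝 ξ)) :
    Tendsto (fun a => cdot (f a) (g a)) l (𝓝 (cdot ζ ξ)) :=
  tendsto_finsetSum _ fun ν _ =>
    ((tendsto_pi_nhds.1 hf ν).const_mul _).mul (tendsto_pi_nhds.1 hg ν)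

/-- In (1 + x_s)^s one has s·x_s → κ((ζ₀−ξ₀)² z/2 + z⁻¹/2), because the terms with additional powers
of m vanish. -/
lemma tendsto_pairKernel {κ : ℝ} (hκ : 0 < κ) {ζ ξ : ℕ → Fin 4 → ℂ} {ζ₀ ξ₀ : Fin 4 → ℂ}
    (hζ : Tendsto ζ atTop (𝓝 ζ₀)) (hξ : Tendsto ξ atTop (𝓝 ξ₀)) :
    Tendsto (fun s => pairKernel s (plMass κ s) (ζ s) (ξ s)) atTop (𝓝 (limKernel κ ζ₀ ξ₀)) := by
  have c1 := tendsto_cdot hζ hξ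
  have c2 := tendsto_cdot hζ hζ
  have c3 := tendsto_cdot hξ hξ
  have hm := tendsto_ofReal_of_tendsto (tendsto_plMass κ)
  have hsm := tendsto_ofReal_of_tendsto (tendsto_natCast_mul_plMass κ)
  rw [Complex.ofReal_zero] at hm
  have n1 := norm_nonneg (cdot ζ₀ ξ₀)
  have n2 := norm_nonneg (cdot ζ₀ ζ₀)
  have n3 := norm_nonneg (cdot ξ₀ ξ₀)
  set M := ‖cdot ζ₀ ξ₀‖ + ‖cdot ζ₀ ζ₀‖ + ‖cdot ξ₀ ξ₀‖ + 1
  have hM1 : ∀ᶠ s in atTop, ‖cdot (ζ s) (ξ s)‖ ≤ M :=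
    c1.norm.eventually_le_const (by simp only [M]; linarith)
  have hM2 : ∀ᶠ s in atTop, ‖cdot (ζ s) (ζ s)‖ ≤ M :=
    c2.norm.eventually_le_const (by simp only [M]; linarith)
  have hM3 : ∀ᶠ s in atTop, ‖cdot (ξ s) (ξ s)‖ ≤ M :=
    c3.norm.eventually_le_const (by simp only [M]; linarith)
  refine tendsto_integral_filter_of_dominated_convergence
    (fun _ => Real.exp (κ * (κ * M + (2 * M + κ ^ 2 * M ^ 2 + 1)))) ?_ ?_ (integrable_const _) ?_
  · exact Eventually.of_forall fun s => (by fun_prop : Continuous _).aestronglyMeasurable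
  · filter_upwards [hM1, hM2, hM3] with s h1 h2 h3
    exact Eventually.of_forall (pairKernel_bound hκ s h1 h2 h3)
  · refine Eventually.of_forall fun φ => Complex.tendsto_one_add_pow_exp_of_tendsto ?_
    have hlim := (hsm.mul ((hm.mul c1).neg)).add (hsm.mul ((((((c2.add c3).sub (c1.const_mul 2)).add
      ((hm.pow 2).mul ((c1.pow 2).sub (c2.mul c3)))).div_const 2).mul_const (unitPhase φ)).add_const
        (1 / 2 * (unitPhase φ)⁻¹)))
    have hval : (κ : ℂ) * -(0 * cdot ζ₀ ξ₀) + κ * ((cdot ζ₀ ζ₀ + cdot ξ₀ ξ₀ - 2 * cdot ζ₀ ξ₀ +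
        0 ^ 2 * (cdot ζ₀ ξ₀ ^ 2 - cdot ζ₀ ζ₀ * cdot ξ₀ ξ₀)) / 2 * unitPhase φ +
        1 / 2 * (unitPhase φ)⁻¹) = κ * ((cdot ζ₀ ζ₀ + cdot ξ₀ ξ₀ - 2 * cdot ζ₀ ξ₀) / 2 *
        unitPhase φ + 1 / 2 * (unitPhase φ)⁻¹) := by ring
    rw [hval] at hlim
    refine hlim.congr fun s => ?_
    push_cast
    ring

lemma measurable_pairKernel (s : ℕ) (m : ℝ) :
    Measurable fun x : (Fin 4 → ℂ) × (Fin 4 → ℂ) => pairKernel s m x.1 x.2 := by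
  unfold pairKernel
  refine (StronglyMeasurable.integral_prod_right' (f := fun y : ((Fin 4 → ℂ) × (Fin 4 → ℂ)) × ℝ =>
    (1 + (-((m : ℂ) ^ 2 * cdot y.1.1 y.1.2) + m * ((cdot y.1.1 y.1.1 + cdot y.1.2 y.1.2 -
      2 * cdot y.1.1 y.1.2 + (m : ℂ) ^ 2 * (cdot y.1.1 y.1.2 ^ 2 -
      cdot y.1.1 y.1.1 * cdot y.1.2 y.1.2)) / 2 * unitPhase y.2 +
      1 / 2 * (unitPhase y.2)⁻¹))) ^ s) ?_).measurable
  have h1 : Continuous fun y : ((Fin 4 → ℂ) × (Fin 4 → ℂ)) × ℝ => (unitPhase y.2)⁻¹ :=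
    continuous_unitPhase_inv.comp continuous_snd
  exact (by fun_prop : Continuous _).stronglyMeasurable

lemma measurable_pairKernel_comp {α : Type*} [MeasurableSpace α] {f g : α → Fin 4 → ℂ}
    (hf : Measurable f) (hg : Measurable g) (s : ℕ) (m : ℝ) :
    Measurable fun x => pairKernel s m (f x) (g x) := by
  have h := (measurable_pairKernel s m).comp (hf.prodMk hg)
  exact h

lemma measurable_limKernel (κ : ℝ) :
    Measurable fun x : (Fin 4 → ℂ) × (Fin 4 → ℂ) => limKernel κ x.1 x.2 := by
  unfold limKernel
  refine (StronglyMeasurable.integral_prod_right' (f := fun y : ((Fin 4 → ℂ) × (Fin 4 → ℂ)) × ℝ =>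
    Complex.exp (κ * ((cdot y.1.1 y.1.1 + cdot y.1.2 y.1.2 -
      2 * cdot y.1.1 y.1.2) / 2 * unitPhase y.2 + 1 / 2 * (unitPhase y.2)⁻¹))) ?_).measurable
  have h1 : Continuous fun y : ((Fin 4 → ℂ) × (Fin 4 → ℂ)) × ℝ => (unitPhase y.2)⁻¹ :=
    continuous_unitPhase_inv.comp continuous_snd
  exact (by fun_prop : Continuous _).stronglyMeasurable

lemma norm_cdot_le_of_le {R : ℝ} {ζ ξ : Fin 4 → ℂ} (hζ : ‖ζ‖ ≤ R) (hξ : ‖ξ‖ ≤ R) :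
    ‖cdot ζ ξ‖ ≤ 4 * R ^ 2 := by
  refine (norm_cdot_le ζ ξ).trans ?_
  rw [sq]
  have := mul_le_mul hζ hξ (norm_nonneg _) ((norm_nonneg _).trans hζ)
  linarith

/-- A bound on the generating kernel for vectors of norm at most `R`. -/
def pairBound (κ R : ℝ) : ℝ :=
  Real.exp (κ * (κ * (4 * R ^ 2) + (2 * (4 * R ^ 2) + κ ^ 2 * (4 * R ^ 2) ^ 2 + 1)))

lemma norm_pairKernel_le_pairBound {κ : ℝ} (hκ : 0 < κ) (s : ℕ) {R : ℝ} {ζ ξ : Fin 4 → ℂ}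
    (hζ : ‖ζ‖ ≤ R) (hξ : ‖ξ‖ ≤ R) : ‖pairKernel s (plMass κ s) ζ ξ‖ ≤ pairBound κ R :=
  norm_pairKernel_le hκ s (norm_cdot_le_of_le hζ hξ) (norm_cdot_le_of_le hζ hζ)
    (norm_cdot_le_of_le hξ hξ)

lemma continuous_mdot : Continuous fun x : Spacetime × Spacetime => mdot x.1 x.2 := by
  unfold mdot; fun_prop

lemma tendsto_mdot {q : ℕ → Spacetime} {p : Spacetime} (hq : Tendsto q atTop (𝓝 p))
    (e : Spacetime) : Tendsto (fun s => mdot e (q s)) atTop (𝓝 (mdot e p)) :=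
  (continuous_mdot.tendsto (e, p)).comp (tendsto_const_nhds.prodMk_nhds hq)

lemma tendsto_stringDir {q : ℕ → Spacetime} {p : Spacetime} (hq : Tendsto q atTop (𝓝 p))
    {e : Spacetime} (hep : mdot e p ≠ 0) :
    Tendsto (fun s => stringDir e (q s)) atTop (𝓝 (stringDir e p)) :=
  tendsto_pi_nhds.2 fun _ => tendsto_ofReal_of_tendsto
    (tendsto_const_nhds.div (tendsto_mdot hq e) hep)

lemma tendsto_projRow {q : ℕ → Spacetime} {p : Spacetime} (hq : Tendsto q atTop (𝓝 p))
    {e : Spacetime} (hep : mdot e p ≠ 0) (μ : Fin 4) :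
    Tendsto (fun s => projRow e (q s) μ) atTop (𝓝 (projRow e p μ)) := by
  refine tendsto_pi_nhds.2 fun ν => tendsto_ofReal_of_tendsto ?_
  refine tendsto_const_nhds.sub (Tendsto.div ?_ (tendsto_mdot hq e) hep)
  exact (((continuous_apply μ).tendsto p).comp hq |>.const_mul (eta μ)).mul_const (e ν)

lemma tendsto_genVec {q : ℕ → Spacetime} {p : Spacetime} (hq : Tendsto q atTop (𝓝 p))
    {e : Spacetime} (hep : mdot e p ≠ 0) (lam : ℝ) {r : ℕ} (μ : Fin r → Fin 4) (θ : Fin r → ℝ) :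
    Tendsto (fun s => genVec lam e (q s) μ θ) atTop (𝓝 (genVec lam e p μ θ)) :=
  (tendsto_stringDir hq hep).add (tendsto_finsetSum _ fun i _ =>
    (tendsto_projRow hq hep (μ i)).const_smul _)

lemma eventually_genVec_bound {q : ℕ → Spacetime} {p : Spacetime} (hq : Tendsto q atTop (𝓝 p))
    {e : Spacetime} (hep : mdot e p ≠ 0) (lam : ℝ) {r : ℕ} (μ : Fin r → Fin 4) :
    ∃ R, ∀ᶠ s in atTop, ∀ θ, ‖genVec lam e (q s) μ θ‖ ≤ R := by
  have h : Tendsto (fun s => ‖stringDir e (q s)‖ + ∑ i, |lam| * ‖projRow e (q s) (μ i)‖) atTop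
      (𝓝 (‖stringDir e p‖ + ∑ i, |lam| * ‖projRow e p (μ i)‖)) :=
    (tendsto_stringDir hq hep).norm.add (tendsto_finsetSum _ fun i _ =>
      (tendsto_projRow hq hep (μ i)).norm.const_mul _)
  refine ⟨‖stringDir e p‖ + ∑ i, |lam| * ‖projRow e p (μ i)‖ + 1, ?_⟩
  filter_upwards [h.eventually_le_const (lt_add_one _)] with s hs θ
  exact (norm_genVec_apply_le lam e (q s) μ θ).trans hs

lemma tendsto_torusKernel {κ : ℝ} (hκ : 0 < κ) (lam : ℝ) {r r' : ℕ} (μ : Fin r → Fin 4)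
    (μ' : Fin r' → Fin 4) {e e' p : Spacetime} {q : ℕ → Spacetime} (hq : Tendsto q atTop (𝓝 p))
    (hep : mdot e p ≠ 0) (hep' : mdot e' p ≠ 0) :
    Tendsto (fun s => torusKernel s (plMass κ s) lam μ μ' e e' (q s)) atTop
      (𝓝 (torusLimit κ lam μ μ' e e' p)) := by
  obtain ⟨R, hR⟩ := eventually_genVec_bound hq hep lam μ
  obtain ⟨R', hR'⟩ := eventually_genVec_bound hq hep' lam μ'
  refine tendsto_integral_filter_of_dominated_convergence
    (fun _ => pairBound κ (max R R')) ?_ ?_ (integrable_const _) ?_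
  · refine Eventually.of_forall fun s => Measurable.aestronglyMeasurable ?_
    have c1 := (continuous_genVec lam e (q s) μ).measurable
    have c2 := (continuous_genVec lam e' (q s) μ').measurable
    have c3 : Continuous fun θ : (Fin r → ℝ) × (Fin r' → ℝ) =>
      torusChar θ.1 * torusChar θ.2 := by fun_prop
    have c4 := measurable_pairKernel_comp (c1.comp measurable_fst) (c2.comp measurable_snd) s (plMass κ s)
    exact c3.measurable.mul c4
  · filter_upwards [hR, hR'] with s h h'
    refine Eventually.of_forall fun θ => ?_
    rw [norm_mul, norm_mul, norm_torusChar, norm_torusChar, one_mul, one_mul]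
    exact norm_pairKernel_le_pairBound hκ s ((h _).trans (le_max_left _ _))
      ((h' _).trans (le_max_right _ _))
  · exact Eventually.of_forall fun θ => (tendsto_pairKernel hκ (tendsto_genVec hq hep lam μ θ.1)
      (tendsto_genVec hq hep' lam μ' θ.2)).const_mul _

lemma tendsto_stringPhase {κ : ℝ} {e p : Spacetime} {q : ℕ → Spacetime}
    (hq : Tendsto q atTop (𝓝 p)) (hep : mdot e p ≠ 0) :
    Tendsto (fun s => stringPhase s (plMass κ s) e (q s)) atTop (𝓝 (limPhase κ e p)) := by
  have h : Tendsto (fun s : ℕ => (s : ℂ) * -((plMass κ s : ℂ) * (Real.sqrt (-mdot e e) : ℂ) *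
      stringInt e (q s))) atTop
      (𝓝 (-Complex.I * (κ * Real.sqrt (-mdot e e) / mdot e p : ℝ))) := by
    have h1 := tendsto_ofReal_of_tendsto (((tendsto_natCast_mul_plMass κ).mul_const
      (Real.sqrt (-mdot e e))).div (tendsto_mdot hq e) hep)
    refine (h1.const_mul (-Complex.I)).congr fun s => ?_
    rw [stringInt, Pi.div_apply]
    push_cast
    ring
  refine (Complex.tendsto_one_add_pow_exp_of_tendsto h).congr fun s => ?_
  rw [stringPhase, sub_eq_add_neg]

/-! ### Closed formulas for the kernels and their limit. -/

/-- The closed form of the two-point kernel of the massive fields. -/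
def massiveFormula (κ : ℝ) (s : ℕ) (lam : ℝ) {r r' : ℕ} (μ : Fin r → Fin 4) (μ' : Fin r' → Fin 4)
    (e e' p : Spacetime) : ℂ :=
  (((lam * plMass κ s : ℝ) : ℂ) ^ (r + r') *
      ((s.descFactorial r : ℂ) * (s.descFactorial r' : ℂ)))⁻¹ *
    ((starRingEnd ℂ) (stringPhase s (plMass κ s) e p) * stringPhase s (plMass κ s) e' p *
      (Complex.I ^ r * (-Complex.I) ^ r') * torusKernel s (plMass κ s) lam μ μ' e e' p)

/-- The closed form of the two-point kernel of the infinite-spin fields. -/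
def infFormula (κ : ℝ) {r r' : ℕ} (μ : Fin r → Fin 4) (μ' : Fin r' → Fin 4)
    (e e' p : Spacetime) : ℂ :=
  ((κ : ℂ) ^ (r + r'))⁻¹ *
    ((starRingEnd ℂ) (limPhase κ e p) * limPhase κ e' p *
      (Complex.I ^ r * (-Complex.I) ^ r') * torusLimit κ 1 μ μ' e e' p)

/-- The formula contains neither the basis nor the boosts, which may be chosen without any
regularity in p; so it is what measurability and limits are proved for. It also shows that the
formula has the same value for every λ ≠ 0. -/
lemma massiveKernel_eq_massiveFormula {κ : ℝ} (hκ : 0 < κ) {s r r' : ℕ} (hs : 1 ≤ s)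
    (T : OrthonormalBasis (Fin (spinDim s)) ℝ (TracelessSym s))
    {B : Spacetime → Matrix (Fin 4) (Fin 4) ℝ}
    (hB : IsBoostFamily (massShell (plMass κ s)) (massiveRef (plMass κ s)) B) {e e' p : Spacetime}
    (hp : p ∈ massShell (plMass κ s)) (hep : mdot e p ≠ 0) (hep' : mdot e' p ≠ 0)
    (μ : Fin r → Fin 4) (μ' : Fin r' → Fin 4) {lam : ℝ} (hlam : lam ≠ 0) :
    massiveKernel κ s T B μ μ' e e' p = massiveFormula κ s lam μ μ' e e' p := by
  have hm : plMass κ s ≠ 0 := (plMass_pos hκ hs).ne'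
  by_cases h : r ≤ s ∧ r' ≤ s
  · rw [massiveFormula, ← massiveKernel_eq h.1 h.2 T hm hp (hB p hp).1 (hB p hp).2 hep hep' μ μ'
      lam, inv_mul_cancel_left₀]
    refine mul_ne_zero (pow_ne_zero _ ?_) (mul_ne_zero ?_ ?_)
    · exact_mod_cast mul_ne_zero hlam hm
    · exact_mod_cast (Nat.descFactorial_pos.2 h.1).ne'
    · exact_mod_cast (Nat.descFactorial_pos.2 h.2).ne'
  -- For a rank above the spin both sides are 0: the field is 0 by convention, and the vanishing
  -- descending factorial has inverse 0.
  · have hzero : s < r ∨ s < r' := by omega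
    have h1 : massiveKernel κ s T B μ μ' e e' p = 0 := by
      refine Finset.sum_eq_zero fun n _ => ?_
      rcases hzero with h | h
      · simp [massiveIntertwiner, escortIntertwiner, h.not_ge]
      · simp [massiveIntertwiner, escortIntertwiner, h.not_ge]
    have h2 : (s.descFactorial r : ℂ) * (s.descFactorial r' : ℂ) = 0 := by
      rcases hzero with h | h
      · simp [Nat.descFactorial_eq_zero_iff_lt.2 h]
      · simp [Nat.descFactorial_eq_zero_iff_lt.2 h]
    rw [h1, massiveFormula, h2, mul_zero, inv_zero, zero_mul]

lemma infKernel_eq_infFormula {κ : ℝ} (hκ : 0 < κ) {r r' : ℕ}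
    {B : Spacetime → Matrix (Fin 4) (Fin 4) ℝ} (hB : IsBoostFamily (massShell 0) masslessRef B)
    {e e' p : Spacetime} (hp : p ∈ massShell 0) (hep : mdot e p ≠ 0) (hep' : mdot e' p ≠ 0)
    (μ : Fin r → Fin 4) (μ' : Fin r' → Fin 4) :
    infKernel κ B μ μ' e e' p = infFormula κ μ μ' e e' p := by
  rw [infFormula, ← infKernel_eq hκ.ne' (hB p hp).1 (hB p hp).2 hep hep' μ μ' 1, one_mul,
    inv_mul_cancel_left₀]
  exact pow_ne_zero _ (by exact_mod_cast hκ.ne')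

lemma tendsto_massiveFormula {κ : ℝ} (hκ : 0 < κ) {r r' : ℕ} (μ : Fin r → Fin 4)
    (μ' : Fin r' → Fin 4) {e e' p : Spacetime} {q : ℕ → Spacetime} (hq : Tendsto q atTop (𝓝 p))
    (hep : mdot e p ≠ 0) (hep' : mdot e' p ≠ 0) :
    Tendsto (fun s => massiveFormula κ s 1 μ μ' e e' (q s)) atTop
      (𝓝 (infFormula κ μ μ' e e' p)) := by
  have h1 := tendsto_stringPhase (κ := κ) hq hep
  have h2 := tendsto_stringPhase (κ := κ) hq hep'
  have h3 := tendsto_torusKernel hκ 1 μ μ' hq hep hep'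
  have h4 := tendsto_ofReal_of_tendsto ((tendsto_plMass_pow_mul_descFactorial κ r).mul
    (tendsto_plMass_pow_mul_descFactorial κ r'))
  rw [← pow_add] at h4
  refine Tendsto.mul ?_ ((((Complex.continuous_conj.tendsto _).comp h1).mul h2).mul_const _ |>.mul h3)
  rw [Complex.ofReal_pow] at h4
  refine (h4.inv₀ (pow_ne_zero _ (by exact_mod_cast hκ.ne'))).congr fun s => ?_
  push_cast
  rw [pow_add, one_mul]
  congr 1
  ring

lemma tendsto_massiveKernel {κ : ℝ} (hκ : 0 < κ)
    {T : ∀ s : ℕ, OrthonormalBasis (Fin (spinDim s)) ℝ (TracelessSym s)}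
    {B : ℕ → Spacetime → Matrix (Fin 4) (Fin 4) ℝ}
    (hB : ∀ s : ℕ, 1 ≤ s →
      IsBoostFamily (massShell (plMass κ s)) (massiveRef (plMass κ s)) (B s))
    {B₀ : Spacetime → Matrix (Fin 4) (Fin 4) ℝ}
    (hB₀ : IsBoostFamily (massShell 0) masslessRef B₀) {r r' : ℕ} (μ : Fin r → Fin 4)
    (μ' : Fin r' → Fin 4) {e e' p : Spacetime} {q : ℕ → Spacetime} (hp : p ∈ massShell 0)
    (hep : mdot e p ≠ 0) (hep' : mdot e' p ≠ 0)
    (hqs : ∀ s : ℕ, 1 ≤ s → q s ∈ massShell (plMass κ s)) (hq : Tendsto q atTop (𝓝 p)) :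
    Tendsto (fun s : ℕ => massiveKernel κ s (T s) (B s) μ μ' e e' (q s)) atTop
        (𝓝 (infKernel κ B₀ μ μ' e e' p)) := by
  rw [infKernel_eq_infFormula hκ hB₀ hp hep hep']
  refine (tendsto_massiveFormula hκ μ μ' hq hep hep').congr' ?_
  filter_upwards [eventually_ge_atTop 1, (tendsto_mdot hq e).eventually_ne hep,
    (tendsto_mdot hq e').eventually_ne hep'] with s hs h1 h2
  exact (massiveKernel_eq_massiveFormula hκ hs (T s) (hB s hs) (hqs s hs) h1 h2 μ μ'
    one_ne_zero).symm

/-! ### Convergence of Gram matrices -/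

section Gram

lemma orthonormal_snoc {E : Type*} [NormedAddCommGroup E] [InnerProductSpace ℂ E] {n : ℕ}
    {e : Fin n → E} (he : Orthonormal ℂ e) {x : E} (hx : ‖x‖ = 1)
    (hex : ∀ i, inner ℂ (e i) x = 0) :
    Orthonormal ℂ (Fin.snoc e x : Fin (n + 1) → E) := by
  refine ⟨fun i => ?_, fun i j hij => ?_⟩
  · refine Fin.lastCases ?_ (fun i => ?_) i
    · simpa using hx
    · simpa using he.1 i
  · induction i using Fin.lastCases with
    | last =>
      induction j using Fin.lastCases with
      | last => exact absurd rfl hij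
      | cast j => simpa using inner_eq_zero_symm.1 (hex j)
    | cast i =>
      induction j using Fin.lastCases with
      | last => simpa using hex i
      | cast j => simpa using he.2 (fun h => hij (congrArg _ h))

variable {X : ℕ → Type*} [∀ s, NormedAddCommGroup (X s)] [∀ s, InnerProductSpace ℂ (X s)]

lemma tendsto_norm_of_tendsto_inner_self {y : ∀ s, X s} {c : ℝ} (hc : 0 ≤ c)
    (h : Tendsto (fun s => inner ℂ (y s) (y s)) atTop (𝓝 ((c ^ 2 : ℝ) : ℂ))) :
    Tendsto (fun s => ‖y s‖) atTop (𝓝 c) := by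
  have h1 := (Real.continuous_sqrt.tendsto _).comp ((Complex.continuous_re.tendsto _).comp h)
  rw [Complex.ofReal_re, Real.sqrt_sq hc] at h1
  refine h1.congr fun s => ?_
  simp only [Function.comp_apply]
  rw [inner_self_eq_norm_sq_to_K]
  norm_cast
  exact Real.sqrt_sq (norm_nonneg _)

/-- Asymptotically orthonormal families are close to orthonormal families. -/
lemma exists_orthonormal_of_tendsto_gram (n : ℕ) : ∀ y : ∀ s, Fin n → X s,
    (∀ i j, Tendsto (fun s => inner ℂ (y s i) (y s j)) atTop (𝓝 (if i = j then 1 else 0))) →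
    ∃ z : ∀ s, Fin n → X s, (∀ᶠ s in atTop, Orthonormal ℂ (z s)) ∧
      ∀ i, Tendsto (fun s => ‖z s i - y s i‖) atTop (𝓝 0) := by
  induction n with
  | zero =>
    intro y _
    exact ⟨y, Eventually.of_forall fun s => ⟨fun i => i.elim0, fun i => i.elim0⟩,
      fun i => i.elim0⟩
  | succ n ih =>
    intro y hy
    obtain ⟨z, hz, hzy⟩ := ih (fun s i => y s i.castSucc) fun i j => by
      simpa using hy i.castSucc j.castSucc
    set u : ∀ s, X s := fun s => y s (Fin.last n) with hu
    set w : ∀ s, X s := fun s => u s - ∑ i, inner ℂ (z s i) (u s) • z s i with hw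
    have hun : Tendsto (fun s => ‖u s‖) atTop (𝓝 1) :=
      tendsto_norm_of_tendsto_inner_self zero_le_one (by
        simpa using hy (Fin.last n) (Fin.last n))
    have hzu : ∀ i, Tendsto (fun s => inner ℂ (z s i) (u s)) atTop (𝓝 0) := by
      intro i
      have h1 : Tendsto (fun s => inner ℂ (z s i - y s i.castSucc) (u s)) atTop (𝓝 0) := by
        refine squeeze_zero_norm (fun s => norm_inner_le_norm _ _) ?_
        simpa using (hzy i).mul hun
      have h2 := hy i.castSucc (Fin.last n)
      rw [if_neg (Fin.castSucc_lt_last i).ne] at h2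
      have h3 := h1.add h2
      rw [add_zero] at h3
      refine h3.congr fun s => ?_
      rw [inner_sub_left, sub_add_cancel]
    have hwu : Tendsto (fun s => ‖w s - u s‖) atTop (𝓝 0) := by
      have h1 : Tendsto (fun s => ∑ i, ‖(inner ℂ (z s i) (u s) : ℂ)‖) atTop (𝓝 0) := by
        have := tendsto_finsetSum Finset.univ fun i _ => (hzu i).norm
        simpa using this
      refine squeeze_zero' (Eventually.of_forall fun s => norm_nonneg _) ?_ h1
      filter_upwards [hz] with s hs
      rw [hw]
      simp only [sub_sub_cancel_left, norm_neg]
      refine (norm_sum_le _ _).trans (Finset.sum_le_sum fun i _ => ?_)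
      rw [norm_smul, hs.1 i, mul_one]
    have hwn : Tendsto (fun s => ‖w s‖) atTop (𝓝 1) := by
      have h1 : Tendsto (fun s => ‖w s‖ - ‖u s‖) atTop (𝓝 0) :=
        squeeze_zero_norm (fun s => abs_norm_sub_norm_le _ _) hwu
      simpa using h1.add hun
    set v : ∀ s, X s := fun s => ((‖w s‖⁻¹ : ℝ) : ℂ) • w s with hv
    have hvw : Tendsto (fun s => ‖v s - w s‖) atTop (𝓝 0) := by
      have h1 : Tendsto (fun s => |‖w s‖⁻¹ - 1| * ‖w s‖) atTop (𝓝 0) := by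
        have := (((hwn.inv₀ one_ne_zero).sub_const 1).abs).mul hwn
        simpa using this
      refine h1.congr fun s => ?_
      have : v s - w s = ((‖w s‖⁻¹ - 1 : ℝ) : ℂ) • w s := by
        simp only [hv]; push_cast; rw [sub_smul, one_smul]
      rw [this, norm_smul, Complex.norm_real, Real.norm_eq_abs]
    refine ⟨fun s => Fin.snoc (z s) (v s), ?_, ?_⟩
    · filter_upwards [hz, hwn.eventually_ne one_ne_zero] with s hs hs'
      refine orthonormal_snoc hs ?_ fun i => ?_
      · simp only [hv]
        rw [norm_smul, Complex.norm_real, norm_inv, norm_norm, inv_mul_cancel₀ hs']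
      · simp only [hv]
        rw [inner_smul_right]
        have : inner ℂ (z s i) (w s) = 0 := by
          simp only [hw]
          rw [inner_sub_right, hs.inner_right_fintype, sub_self]
        rw [this, mul_zero]
    · intro i
      refine Fin.lastCases ?_ (fun i => ?_) i
      · simp only [Fin.snoc_last]
        refine squeeze_zero (fun s => norm_nonneg _) (fun s => ?_)
          (by simpa using hvw.add hwu)
        calc ‖v s - u s‖ = ‖(v s - w s) + (w s - u s)‖ := by rw [sub_add_sub_cancel]
          _ ≤ _ := norm_add_le _ _
      · simpa using hzy i

variable {H : Type*} [NormedAddCommGroup H] [InnerProductSpace ℂ H]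

lemma exists_orthonormal_extension (hH : ¬FiniteDimensional ℂ H) {n : ℕ} {e : Fin n → H}
    (he : Orthonormal ℂ e) (k : ℕ) :
    ∃ e' : Fin (n + k) → H, Orthonormal ℂ e' ∧ ∀ i, e' (Fin.castAdd k i) = e i := by
  induction k with
  | zero => exact ⟨e, he, fun i => rfl⟩
  | succ k ih =>
    obtain ⟨e', he', hee⟩ := ih
    let W := Submodule.span ℂ (Set.range e')
    have : FiniteDimensional ℂ W := FiniteDimensional.span_of_finite ℂ (Set.finite_range e')
    have hW : W ≠ ⊤ := by
      intro h
      refine hH ?_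
      have := this
      rw [h] at this
      exact Module.Finite.equiv (Submodule.topEquiv (R := ℂ) (M := H))
    have hW' : Wᗮ ≠ ⊥ := fun h => hW ((Submodule.orthogonal_eq_bot_iff).1 h)
    obtain ⟨x, hx, hx0⟩ := Submodule.exists_mem_ne_zero_of_ne_bot hW'
    have hxn : ‖x‖ ≠ 0 := norm_ne_zero_iff.2 hx0
    refine ⟨Fin.snoc e' (((‖x‖⁻¹ : ℝ) : ℂ) • x), orthonormal_snoc he' ?_ ?_, fun i => ?_⟩
    · rw [norm_smul, Complex.norm_real, norm_inv, norm_norm, inv_mul_cancel₀ hxn]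
    · intro i
      rw [inner_smul_right, (Submodule.mem_orthogonal W x).1 hx _
        (Submodule.subset_span ⟨i, rfl⟩), mul_zero]
    · rw [← hee i]
      have : Fin.castAdd (k + 1) i = (Fin.castAdd k i).castSucc := rfl
      rw [this, Fin.snoc_castSucc]

/-- Both orthonormal families are completed to the dimension of E; infinite dimension of H
guarantees the room for it. -/
lemma exists_isometry_of_orthonormal (hH : ¬FiniteDimensional ℂ H) {E : Type*}
    [NormedAddCommGroup E] [InnerProductSpace ℂ E] [FiniteDimensional ℂ E] {n : ℕ} {z : Fin n → E}
    (hz : Orthonormal ℂ z) {e : Fin n → H} (he : Orthonormal ℂ e) :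
    ∃ V : E →ₗᵢ[ℂ] H, ∀ i, V (z i) = e i := by
  have hn : n ≤ Module.finrank ℂ E := by
    simpa using hz.linearIndependent.fintype_card_le_finrank
  obtain ⟨k, hk⟩ := Nat.exists_eq_add_of_le hn
  let v : Fin (n + k) → E := Fin.append z 0
  have hvi : ∀ i, v (Fin.castAdd k i) = z i := fun i => Fin.append_left z 0 i
  have hv : Orthonormal ℂ
      ((Set.range (Fin.castAdd k : Fin n → Fin (n + k))).domRestrict v) := by
    refine ⟨?_, ?_⟩
    · rintro ⟨_, i, rfl⟩
      exact (congrArg norm (hvi i)).trans (hz.1 i)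
    · rintro ⟨_, i, rfl⟩ ⟨_, j, rfl⟩ hij
      change inner ℂ (v _) (v _) = 0
      rw [hvi, hvi]
      exact hz.2 fun h => hij (Subtype.ext (congrArg (Fin.castAdd k) h))
  obtain ⟨b, hb⟩ := hv.exists_orthonormalBasis_extension_of_card_eq (by simp [hk])
  obtain ⟨e', he', hee⟩ := exists_orthonormal_extension hH he k
  have hbo : Orthonormal ℂ b.toBasis := by
    rw [OrthonormalBasis.coe_toBasis]; exact b.orthonormal
  have hf : Orthonormal ℂ ((b.toBasis.constr ℂ e') ∘ b.toBasis) := by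
    have : (b.toBasis.constr ℂ e') ∘ b.toBasis = e' := by
      funext i; exact Module.Basis.constr_basis _ _ _ _
    rw [this]; exact he'
  refine ⟨(b.toBasis.constr ℂ e').isometryOfOrthonormal hbo hf, fun i => ?_⟩
  have h1 : z i = b.toBasis (Fin.castAdd k i) := by
    rw [OrthonormalBasis.coe_toBasis, hb _ ⟨i, rfl⟩, hvi]
  rw [h1, LinearMap.coe_isometryOfOrthonormal, Module.Basis.constr_basis, hee]

lemma exists_isometry_tendsto_of_orthonormal (hH : ¬FiniteDimensional ℂ H)
    [∀ s, FiniteDimensional ℂ (X s)] {ι : Type*} [Fintype ι] {e : ι → H} (he : Orthonormal ℂ e)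
    (y : ∀ s, ι → X s)
    (hy : ∀ i j, Tendsto (fun s => inner ℂ (y s i) (y s j)) atTop (𝓝 (inner ℂ (e i) (e j)))) :
    ∃ V : ∀ s, X s →ₗᵢ[ℂ] H, ∀ i, Tendsto (fun s => V s (y s i)) atTop (𝓝 (e i)) := by
  classical
  let f := Fintype.equivFin ι
  obtain ⟨z, hz, hzy⟩ := exists_orthonormal_of_tendsto_gram (Fintype.card ι)
    (fun s i => y s (f.symm i)) fun i j => by
      have := hy (f.symm i) (f.symm j)
      rw [orthonormal_iff_ite.1 he] at this
      simpa using this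
  have he' : Orthonormal ℂ (e ∘ f.symm) := he.comp _ f.symm.injective
  have hV : ∀ s, ∃ V : X s →ₗᵢ[ℂ] H, Orthonormal ℂ (z s) → ∀ i, V (z s i) = e (f.symm i) := by
    intro s
    by_cases h : Orthonormal ℂ (z s)
    · obtain ⟨V, hV⟩ := exists_isometry_of_orthonormal hH h he'
      exact ⟨V, fun _ => hV⟩
    -- Orthonormality holds only for large s; elsewhere an arbitrary isometry is taken.
    · obtain ⟨V, -⟩ := exists_isometry_of_orthonormal hH (E := X s) (n := 0) (z := Fin.elim0)
        ⟨fun i => i.elim0, fun i => i.elim0⟩ (e := (Fin.elim0 : Fin 0 → H))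
        ⟨fun i => i.elim0, fun i => i.elim0⟩
      exact ⟨V, fun h' => absurd h' h⟩
  choose V hV using hV
  refine ⟨V, fun i => ?_⟩
  rw [tendsto_iff_norm_sub_tendsto_zero]
  refine (hzy (f i)).congr' ?_
  filter_upwards [hz] with s hs
  have h1 := hV s hs (f i)
  rw [Equiv.symm_apply_apply] at h1
  rw [← h1, ← map_sub, LinearIsometry.norm_map, norm_sub_rev, Equiv.symm_apply_apply]

variable {I : Type*}

lemma tendsto_inner_linearCombination {ψ : I → H} {x : ∀ s, I → X s}
    (h : ∀ i j, Tendsto (fun s => inner ℂ (x s i) (x s j)) atTop (𝓝 (inner ℂ (ψ i) (ψ j))))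
    (c c' : I →₀ ℂ) :
    Tendsto (fun s => inner ℂ (Finsupp.linearCombination ℂ (x s) c)
      (Finsupp.linearCombination ℂ (x s) c')) atTop
      (𝓝 (inner ℂ (Finsupp.linearCombination ℂ ψ c) (Finsupp.linearCombination ℂ ψ c'))) := by
  simp only [Finsupp.linearCombination_apply, Finsupp.sum, sum_inner, inner_sum, inner_smul_left,
    inner_smul_right]
  exact tendsto_finsetSum _ fun j _ => 
    (tendsto_finsetSum _ fun i _ => (h i j).const_mul _).const_mul _

lemma tendsto_norm_linearCombination {ψ : I → H} {x : ∀ s, I → X s}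
    (h : ∀ i j, Tendsto (fun s => inner ℂ (x s i) (x s j)) atTop (𝓝 (inner ℂ (ψ i) (ψ j))))
    (c : I →₀ ℂ) :
    Tendsto (fun s => ‖Finsupp.linearCombination ℂ (x s) c‖) atTop
      (𝓝 ‖Finsupp.linearCombination ℂ ψ c‖) := by
  refine tendsto_norm_of_tendsto_inner_self (norm_nonneg _) ?_
  have h1 := tendsto_inner_linearCombination h c c
  rw [inner_self_eq_norm_sq_to_K] at h1
  simpa using h1

lemma linearCombination_single_sub {E : Type*} [AddCommGroup E] [Module ℂ E] (ξ : I → E) (i : I)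
    (a : ℕ →₀ ℂ) (c : ℕ → I →₀ ℂ) :
    Finsupp.linearCombination ℂ ξ (Finsupp.single i 1 - a.sum fun n z => z • c n) =
      ξ i - a.sum fun n z => z • Finsupp.linearCombination ℂ ξ (c n) := by
  simp only [map_sub, Finsupp.linearCombination_single, one_smul, Finsupp.sum, map_sum, map_smul]

/-- If the Gram matrices of families of vectors converge, then the vectors converge up to
isometric embeddings. -/
theorem exists_isometry_tendsto_of_tendsto_gram (hH : ¬FiniteDimensional ℂ H)
    [SecondCountableTopology H] [∀ s, FiniteDimensional ℂ (X s)] (ψ : I → H) (x : ∀ s, I → X s)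
    (h : ∀ i j, Tendsto (fun s => inner ℂ (x s i) (x s j)) atTop (𝓝 (inner ℂ (ψ i) (ψ j)))) :
    ∃ V : ∀ s, X s →ₗᵢ[ℂ] H, ∀ i, Tendsto (fun s => V s (x s i)) atTop (𝓝 (ψ i)) := by
  classical
  obtain ⟨t, hts, htc, hst⟩ := (TopologicalSpace.IsSeparable.of_separableSpace
    (Set.range ψ)).exists_countable_dense_subset
  obtain ⟨f, hf⟩ : ∃ f : ℕ → H, (∀ n, f n ∈ Submodule.span ℂ (Set.range ψ)) ∧
      t ⊆ Set.range f := by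
    rcases t.eq_empty_or_nonempty with rfl | hne
    · exact ⟨0, fun n => Submodule.zero_mem _, Set.empty_subset _⟩
    · obtain ⟨f, rfl⟩ := htc.exists_eq_range hne
      exact ⟨f, fun n => Submodule.subset_span (hts ⟨n, rfl⟩), le_rfl⟩
  -- A countable orthonormal system, apart from zeros at linearly dependent entries, whose span is
  -- dense enough to approximate every ψ i.
  let g := InnerProductSpace.gramSchmidtNormed ℂ f
  have hspan : Submodule.span ℂ (Set.range g) = Submodule.span ℂ (Set.range f) := by
    rw [InnerProductSpace.span_gramSchmidtNormed_range, InnerProductSpace.span_gramSchmidt]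
  have hg : ∀ n, ∃ c : I →₀ ℂ, Finsupp.linearCombination ℂ ψ c = g n := by
    intro n
    have h1 : g n ∈ Submodule.span ℂ (Set.range f) := hspan ▸ Submodule.subset_span ⟨n, rfl⟩
    have h2 : Submodule.span ℂ (Set.range f) ≤ Submodule.span ℂ (Set.range ψ) :=
      Submodule.span_le.2 (by rintro _ ⟨k, rfl⟩; exact hf.1 k)
    exact (Finsupp.mem_span_range_iff_exists_finsupp).1 (h2 h1)
  choose c hc using hg
  -- The same combinations that form g n out of ψ, taken in X s. By sesquilinearity their Gram
  -- matrices converge to that of g.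
  let y : ∀ s, ℕ → X s := fun s n => Finsupp.linearCombination ℂ (x s) (c n)
  have hy : ∀ m n, Tendsto (fun s => inner ℂ (y s m) (y s n)) atTop (𝓝 (inner ℂ (g m) (g n))) := by
    intro m n
    rw [← hc, ← hc]
    exact tendsto_inner_linearCombination h _ _
  have hfin : ∀ N : ℕ, ∃ V : ∀ s, X s →ₗᵢ[ℂ] H, ∀ n, n < N → g n ≠ 0 →
      Tendsto (fun s => V s (y s n)) atTop (𝓝 (g n)) := by
    intro N
    let ι := {n : Fin N // g n ≠ 0}
    have ho : Orthonormal ℂ fun i : ι => g i.1 :=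
      (InnerProductSpace.gramSchmidtNormed_orthonormal' f).comp
        (fun i : ι => (⟨i.1, i.2⟩ : {i | InnerProductSpace.gramSchmidtNormed ℂ f i ≠ 0})) (by
          intro i j hij
          simp only [Subtype.mk.injEq] at hij
          exact Subtype.ext (Fin.ext hij))
    obtain ⟨V, hV⟩ := exists_isometry_tendsto_of_orthonormal hH ho (fun s i => y s i.1)
      fun i j => hy _ _
    exact ⟨V, fun n hn hn0 => hV ⟨⟨n, hn⟩, hn0⟩⟩
  choose W hW using hfin
  have hS : ∀ N : ℕ, ∃ S : ℕ, ∀ s, S ≤ s → ∀ n, n < N → g n ≠ 0 →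
      ‖W N s (y s n) - g n‖ < 1 / ((N : ℝ) + 1) := by
    intro N
    have : ∀ᶠ s in atTop, ∀ n ∈ Finset.range N, g n ≠ 0 →
        ‖W N s (y s n) - g n‖ < 1 / ((N : ℝ) + 1) := by
      rw [Filter.eventually_all_finset]
      intro n hn
      by_cases hn0 : g n = 0
      · exact Eventually.of_forall fun s h => absurd hn0 h
      · have h1 := tendsto_iff_norm_sub_tendsto_zero.1 (hW N n (Finset.mem_range.1 hn) hn0)
        filter_upwards [h1.eventually_lt_const (by positivity : (0 : ℝ) < 1 / ((N : ℝ) + 1))]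
          with s hs _ using hs
    obtain ⟨S, hS⟩ := eventually_atTop.1 this
    exact ⟨S, fun s hs n hn => hS s hs n (Finset.mem_range.2 hn)⟩
  choose S hS using hS
  -- A diagonal choice: at s the isometry for the first N(s) vectors is used, N(s) being the largest
  -- number up to s whose threshold has been passed.
  let N : ℕ → ℕ := fun s => Nat.findGreatest (fun k => S k ≤ s) s
  have hN : Tendsto N atTop atTop := by
    refine tendsto_atTop.2 fun M => ?_
    filter_upwards [eventually_ge_atTop (max M (S M))] with s hs
    exact Nat.le_findGreatest ((le_max_left _ _).trans hs) ((le_max_right _ _).trans hs)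
  let V : ∀ s, X s →ₗᵢ[ℂ] H := fun s => W (N s) s
  have hV : ∀ n, Tendsto (fun s => V s (y s n)) atTop (𝓝 (g n)) := by
    intro n
    by_cases hn0 : g n = 0
    -- For g n = 0 no isometry has been adapted to y n, but the norms of y n tend to 0 anyway.
    · rw [hn0, tendsto_zero_iff_norm_tendsto_zero]
      simp_rw [LinearIsometry.norm_map]
      have := tendsto_norm_linearCombination h (c n)
      rwa [hc, hn0, norm_zero] at this
    · rw [tendsto_iff_norm_sub_tendsto_zero]
      have h0 : Tendsto (fun s => 1 / ((N s : ℝ) + 1)) atTop (𝓝 0) :=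
        tendsto_one_div_add_atTop_nhds_zero_nat.comp hN
      refine squeeze_zero' (Eventually.of_forall fun s => norm_nonneg _) ?_ h0
      filter_upwards [hN.eventually_gt_atTop n] with s hs
      refine (hS (N s) s ?_ n hs hn0).le
      exact Nat.findGreatest_of_ne_zero (P := fun k => S k ≤ s) (rfl : N s = _).symm (by omega)
  refine ⟨V, fun i => Metric.tendsto_atTop'.2 fun ε hε => ?_⟩
  have hcl : ψ i ∈ closure (Submodule.span ℂ (Set.range g) : Set H) := by
    rw [hspan]
    exact closure_mono (hf.2.trans Submodule.subset_span) (hst ⟨i, rfl⟩)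
  obtain ⟨v, hv, hvε⟩ := Metric.mem_closure_iff.1 hcl (ε / 3) (by positivity)
  obtain ⟨a, rfl⟩ := (Finsupp.mem_span_range_iff_exists_finsupp).1 hv
  have h1 : Tendsto (fun s => V s (a.sum fun n z => z • y s n)) atTop
      (𝓝 (a.sum fun n z => z • g n)) := by
    simp only [Finsupp.sum, map_sum, map_smul]
    exact tendsto_finsetSum _ fun n _ => (hV n).const_smul _
  -- The approximation error as a formal combination: its norm in X s converges to its norm in H, so
  -- one approximation serves for all large s.
  let b : I →₀ ℂ := Finsupp.single i 1 - a.sum fun n z => z • c n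
  have h2 := tendsto_norm_linearCombination h b
  have hb1 : ‖Finsupp.linearCombination ℂ ψ b‖ < ε / 3 := by
    rw [linearCombination_single_sub, ← dist_eq_norm]
    simpa only [hc] using hvε
  have h3 := h2.eventually_lt_const hb1
  have h4 := (tendsto_iff_norm_sub_tendsto_zero.1 h1).eventually_lt_const
    (by positivity : (0 : ℝ) < ε / 3)
  obtain ⟨s₀, hs₀⟩ := eventually_atTop.1 (h3.and h4)
  refine ⟨s₀, fun s hs => ?_⟩
  obtain ⟨h5, h6⟩ := hs₀ s hs.le
  have h7 : ‖V s (x s i) - V s (a.sum fun n z => z • y s n)‖ < ε / 3 := by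
    rw [← map_sub, LinearIsometry.norm_map]
    rwa [linearCombination_single_sub] at h5
  calc dist (V s (x s i)) (ψ i) ≤ dist (V s (x s i)) (V s (a.sum fun n z => z • y s n)) +
        dist (V s (a.sum fun n z => z • y s n)) (a.sum fun n z => z • g n) +
        dist (a.sum fun n z => z • g n) (ψ i) := dist_triangle4 _ _ _ _
    _ < ε / 3 + ε / 3 + ε / 3 := by
        rw [dist_eq_norm, dist_eq_norm, dist_comm _ (ψ i)]
        exact add_lt_add (add_lt_add h7 h6) hvε
    _ = ε := by ring

end Gram

/-! ### The Hilbert space on the circle and the intertwiners. -/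

lemma memLp_circleMeasure {f : ℝ → ℂ} (hf : Continuous f) : MemLp f 2 circleMeasure := by
  obtain ⟨C, hC⟩ := (isCompact_Icc (a := (0 : ℝ)) (b := 2 * Real.pi)).exists_bound_of_continuousOn
    hf.continuousOn
  refine MemLp.of_bound hf.aestronglyMeasurable C ?_
  refine Measure.ae_smul_measure ?_ _
  filter_upwards [ae_restrict_mem measurableSet_Ioc] with φ hφ
  exact hC φ (Set.Ioc_subset_Icc_self hφ)

lemma inner_toLp_circleMeasure {f g : ℝ → ℂ} (hf : MemLp f 2 circleMeasure)
    (hg : MemLp g 2 circleMeasure) :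
    inner ℂ (hf.toLp f) (hg.toLp g) = ∫ φ, (starRingEnd ℂ) (f φ) * g φ ∂circleMeasure := by
  rw [L2.inner_def]
  refine integral_congr_ae ?_
  filter_upwards [hf.coeFn_toLp, hg.coeFn_toLp] with φ h1 h2
  rw [h1, h2, RCLike.inner_apply, mul_comm]

lemma continuous_unitPhase_zpow (n : ℤ) : Continuous fun φ => unitPhase φ ^ n :=
  continuous_unitPhase.zpow₀ n fun φ => Or.inl (unitPhase_ne_zero φ)

lemma conj_unitPhase (φ : ℝ) : (starRingEnd ℂ) (unitPhase φ) = (unitPhase φ)⁻¹ := by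
  rw [unitPhase, ← Complex.exp_conj, ← Complex.exp_neg]
  simp

lemma not_finiteDimensional_Lp_circleMeasure :
    ¬FiniteDimensional ℂ (Lp ℂ 2 circleMeasure) := by
  intro h
  have ho : Orthonormal ℂ fun n : ℤ =>
      (memLp_circleMeasure (continuous_unitPhase_zpow n)).toLp (fun φ => unitPhase φ ^ n) := by
    rw [orthonormal_iff_ite]
    intro m n
    rw [inner_toLp_circleMeasure]
    have : ∀ φ, (starRingEnd ℂ) (unitPhase φ ^ m) * unitPhase φ ^ n = unitPhase φ ^ (n - m) := by
      intro φ
      rw [map_zpow₀, conj_unitPhase, inv_zpow, zpow_sub₀ (unitPhase_ne_zero φ)]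
      ring
    simp_rw [this, integral_unitPhase_zpow, sub_eq_zero, eq_comm]
  exact Infinite.not_finite (α := ℤ) ho.linearIndependent.finite

lemma continuous_infIntertwiner (κ : ℝ) (B : Spacetime → Matrix (Fin 4) (Fin 4) ℝ)
    (r : ℕ) (e p : Spacetime) (μ : Fin r → Fin 4) : Continuous (infIntertwiner κ B r e p μ) := by
  have h := continuous_transverse κ (B p)
  have h1 : ∀ ν, Continuous fun φ => transverse κ (B p) φ ν := fun ν =>
    (continuous_apply ν).comp h
  unfold infIntertwiner standardIntertwiner lower mdot
  fun_prop

/-- Convergence of the intertwiners up to isometric embeddings. -/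
lemma exists_isometry_tendsto_intertwiner {κ : ℝ} (hκ : 0 < κ)
    (T : ∀ s : ℕ, OrthonormalBasis (Fin (spinDim s)) ℝ (TracelessSym s))
    {B : ℕ → Spacetime → Matrix (Fin 4) (Fin 4) ℝ}
    (hB : ∀ s : ℕ, 1 ≤ s →
      IsBoostFamily (massShell (plMass κ s)) (massiveRef (plMass κ s)) (B s))
    {B₀ : Spacetime → Matrix (Fin 4) (Fin 4) ℝ}
    (hB₀ : IsBoostFamily (massShell 0) masslessRef B₀) {p : Spacetime} {q : ℕ → Spacetime}
    (hp : p ∈ massShell 0) (hqs : ∀ s : ℕ, 1 ≤ s → q s ∈ massShell (plMass κ s))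
    (hq : Tendsto q atTop (𝓝 p)) :
    ∃ V : ∀ s : ℕ, EuclideanSpace ℂ (Fin (spinDim s)) →ₗᵢ[ℂ] Lp ℂ 2 circleMeasure,
      ∀ (r : ℕ) (μ : Fin r → Fin 4) (e : Spacetime), mdot e e < 0 → mdot e p ≠ 0 →
        ∃ ψ : Lp ℂ 2 circleMeasure,
          ψ =ᵐ[circleMeasure] infIntertwiner κ B₀ r e p μ ∧
          Tendsto (fun s : ℕ => V s (massiveIntertwiner κ s (T s) (B s) r e (q s) μ)) atTop
            (𝓝 ψ) := by
  -- All ranks, components and strings form one index set, so that a single sequence of isometries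
  -- works for all of them.
  let I := Σ r : ℕ, (Fin r → Fin 4) × {e : Spacetime // mdot e p ≠ 0}
  let ψ : I → Lp ℂ 2 circleMeasure := fun i =>
    (memLp_circleMeasure (continuous_infIntertwiner κ B₀ i.1 i.2.2.1 p i.2.1)).toLp _
  have : Fact ((2 : ENNReal) ≠ ⊤) := ⟨by simp⟩
  obtain ⟨V, hV⟩ := exists_isometry_tendsto_of_tendsto_gram
    (X := fun s => EuclideanSpace ℂ (Fin (spinDim s))) not_finiteDimensional_Lp_circleMeasure ψ
    (fun s (i : I) => massiveIntertwiner κ s (T s) (B s) i.1 i.2.2.1 (q s) i.2.1) (by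
      intro i j
      have h := tendsto_massiveKernel hκ (T := T) hB hB₀ i.2.1 j.2.1 hp i.2.2.2 j.2.2.2 hqs hq
      rw [inner_toLp_circleMeasure]
      refine h.congr fun s => ?_
      rw [PiLp.inner_apply, massiveKernel]
      exact Finset.sum_congr rfl fun n _ => by rw [RCLike.inner_apply, mul_comm])
  exact ⟨V, fun r μ e _ hep => ⟨ψ ⟨r, μ, e, hep⟩, MemLp.coeFn_toLp _, hV ⟨r, μ, e, hep⟩⟩⟩

/-! ### Uniform bounds on the two-point kernels -/

lemma abs_mdot_le (x y : Spacetime) : |mdot x y| ≤ 4 * (‖x‖ * ‖y‖) := by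
  refine (Finset.abs_sum_le_sum_abs _ _).trans ?_
  have h : ∀ ν ∈ Finset.univ, |eta ν * x ν * y ν| ≤ ‖x‖ * ‖y‖ := by
    intro ν _
    have h1 : |eta ν| = 1 := by fin_cases ν <;> simp [eta]
    rw [abs_mul, abs_mul, h1, one_mul]
    exact mul_le_mul (norm_le_pi_norm x ν) (norm_le_pi_norm y ν) (abs_nonneg _) (norm_nonneg _)
  refine (Finset.sum_le_sum h).trans ?_
  simp

lemma norm_stringDir_le {C : ℝ} {e p : Spacetime} (hC : 0 ≤ C) (h : ‖e‖ ≤ C * |mdot e p|) :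
    ‖stringDir e p‖ ≤ C := by
  refine (pi_norm_le_iff_of_nonneg hC).2 fun ν => ?_
  rw [stringDir, Complex.norm_real, norm_div, Real.norm_eq_abs (mdot e p)]
  exact div_le_of_le_mul₀ (abs_nonneg _) hC ((norm_le_pi_norm e ν).trans h)

lemma norm_projRow_le {C : ℝ} {e p : Spacetime} (hC : 0 ≤ C) (h : ‖e‖ ≤ C * |mdot e p|)
    (μ : Fin 4) : ‖projRow e p μ‖ ≤ 1 + C * ‖p‖ := by
  refine (pi_norm_le_iff_of_nonneg (by positivity)).2 fun ν => ?_
  rw [projRow, Complex.norm_real, stringProj]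
  refine (norm_sub_le _ _).trans (add_le_add ?_ ?_)
  · split_ifs <;> simp
  · have h1 : ‖lower p μ‖ ≤ ‖p‖ := by
      have h2 : ‖eta μ‖ = 1 := by fin_cases μ <;> simp [eta]
      rw [lower, norm_mul, h2, one_mul]
      exact norm_le_pi_norm p μ
    rw [norm_div, norm_mul, Real.norm_eq_abs (mdot e p)]
    refine div_le_of_le_mul₀ (abs_nonneg _) (by positivity) ?_
    calc ‖lower p μ‖ * ‖e ν‖ ≤ ‖p‖ * (C * |mdot e p|) :=
          mul_le_mul h1 ((norm_le_pi_norm e ν).trans h) (norm_nonneg _) (norm_nonneg _)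
      _ = _ := by ring

lemma norm_stringPhase_le {κ : ℝ} (hκ : 0 < κ) (s : ℕ) {C : ℝ} {e p : Spacetime} (hC : 0 ≤ C)
    (h : ‖e‖ ≤ C * |mdot e p|) :
    ‖stringPhase s (plMass κ s) e p‖ ≤ Real.exp (κ * (2 * C)) := by
  rw [stringPhase, sub_eq_add_neg]
  refine norm_one_add_pow_le ?_
  have h1 : Real.sqrt (-mdot e e) ≤ 2 * ‖e‖ := by
    refine Real.sqrt_le_iff.2 ⟨by positivity, ?_⟩
    have := (neg_le_abs (mdot e e)).trans (abs_mdot_le e e)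
    nlinarith
  have h2 : ‖-((plMass κ s : ℂ) * (Real.sqrt (-mdot e e) : ℂ) * stringInt e p)‖ ≤
      plMass κ s * (2 * C) := by
    rw [norm_neg, norm_mul, norm_mul, Complex.norm_real, Complex.norm_real,
      Real.norm_of_nonneg (plMass_nonneg hκ s), Real.norm_of_nonneg (Real.sqrt_nonneg _),
      mul_assoc]
    refine mul_le_mul_of_nonneg_left ?_ (plMass_nonneg hκ s)
    rw [stringInt, norm_div, Complex.norm_I, Complex.norm_real, Real.norm_eq_abs, mul_one_div]
    refine div_le_of_le_mul₀ (abs_nonneg _) (by positivity) ?_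
    linarith
  calc (s : ℝ) * _ ≤ s * (plMass κ s * (2 * C)) := mul_le_mul_of_nonneg_left h2 (Nat.cast_nonneg _)
    _ = (s * plMass κ s) * (2 * C) := by ring
    _ ≤ _ := mul_le_mul_of_nonneg_right (natCast_mul_plMass_le hκ s) (by positivity)

/-- The inverses converge to κ^{−r} and are therefore bounded; for s < r they are 0 by the
convention for division. -/
lemma exists_inv_bound {κ : ℝ} (hκ : 0 < κ) (r : ℕ) :
    ∃ K, 0 ≤ K ∧ ∀ s : ℕ, ‖((plMass κ s : ℂ) ^ r * (s.descFactorial r : ℂ))⁻¹‖ ≤ K := by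
  have h := (tendsto_plMass_pow_mul_descFactorial κ r).inv₀ (pow_ne_zero r hκ.ne')
  obtain ⟨K, hK⟩ := h.norm.bddAbove_range
  refine ⟨K, (norm_nonneg _).trans (hK ⟨0, rfl⟩), fun s => ?_⟩
  have : ((plMass κ s : ℂ) ^ r * (s.descFactorial r : ℂ))⁻¹ =
      (((plMass κ s ^ r * (s.descFactorial r : ℝ))⁻¹ : ℝ) : ℂ) := by push_cast; rfl
  rw [this, Complex.norm_real]
  exact hK ⟨s, rfl⟩

lemma norm_torusKernel_le {κ : ℝ} (hκ : 0 < κ) (s : ℕ) {lam R : ℝ} {r r' : ℕ} {μ : Fin r → Fin 4}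
    {μ' : Fin r' → Fin 4} {e e' p : Spacetime} (h : ∀ θ, ‖genVec lam e p μ θ‖ ≤ R)
    (h' : ∀ θ, ‖genVec lam e' p μ' θ‖ ≤ R) :
    ‖torusKernel s (plMass κ s) lam μ μ' e e' p‖ ≤ pairBound κ R := by
  have hb : ∀ θ : (Fin r → ℝ) × (Fin r' → ℝ), ‖torusChar θ.1 * torusChar θ.2 *
      pairKernel s (plMass κ s) (genVec lam e p μ θ.1) (genVec lam e' p μ' θ.2)‖ ≤
      pairBound κ R := by
    intro θ
    rw [norm_mul, norm_mul, norm_torusChar, norm_torusChar, one_mul, one_mul]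
    exact norm_pairKernel_le_pairBound hκ s (h _) (h' _)
  refine (norm_integral_le_of_norm_le_const (Eventually.of_forall hb)).trans ?_
  simp

/-- The two-point kernels of the massive fields are polynomially bounded, uniformly in the spin. -/
lemma exists_massiveKernel_bound {κ : ℝ} (hκ : 0 < κ)
    (T : ∀ s : ℕ, OrthonormalBasis (Fin (spinDim s)) ℝ (TracelessSym s))
    {B : ℕ → Spacetime → Matrix (Fin 4) (Fin 4) ℝ}
    (hB : ∀ s : ℕ, 1 ≤ s →
      IsBoostFamily (massShell (plMass κ s)) (massiveRef (plMass κ s)) (B s)) {r r' : ℕ}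
    (μ : Fin r → Fin 4) (μ' : Fin r' → Fin 4) {C : ℝ} (hC : 0 ≤ C) :
    ∃ K, 0 ≤ K ∧ ∀ s : ℕ, 1 ≤ s → ∀ e e' p : Spacetime, p ∈ massShell (plMass κ s) →
      mdot e p ≠ 0 → mdot e' p ≠ 0 → ‖e‖ ≤ C * |mdot e p| → ‖e'‖ ≤ C * |mdot e' p| →
      ‖massiveKernel κ s (T s) (B s) μ μ' e e' p‖ ≤ K * (1 + ‖p‖) ^ (r + r') := by
  obtain ⟨K₁, hK₁, h₁⟩ := exists_inv_bound hκ r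
  obtain ⟨K₂, hK₂, h₂⟩ := exists_inv_bound hκ r'
  refine ⟨(1 + C) ^ (r + r') * (K₁ * K₂) * (Real.exp (κ * (2 * C)) * Real.exp (κ * (2 * C)) *
    pairBound κ (C + (r + r'))), by unfold pairBound; positivity, ?_⟩
  intro s hs e e' p hp hep hep' he he'
  -- The entries of J_e(p) grow linearly in p, and the generating kernel is bounded only
  -- exponentially in the square of its arguments. This radius keeps the generating vectors bounded,
  -- so the growth in p is confined to the polynomial factor λ^{−(r+r')}.
  set lam : ℝ := (1 + C * ‖p‖)⁻¹ with hlam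
  have hpos : 0 < 1 + C * ‖p‖ := by positivity
  have hlam0 : 0 < lam := inv_pos.2 hpos
  rw [massiveKernel_eq_massiveFormula hκ hs (T s) (hB s hs) hp hep hep' μ μ' hlam0.ne',
    massiveFormula]
  have hsum : ∀ {n : ℕ} (ν : Fin n → Fin 4) {ε : Spacetime}, ‖ε‖ ≤ C * |mdot ε p| →
      ∀ θ, ‖genVec lam ε p ν θ‖ ≤ C + n := by
    intro n ν ε hε θ
    refine (norm_genVec_apply_le lam ε p ν θ).trans (add_le_add (norm_stringDir_le hC hε) ?_)
    refine (Finset.sum_le_card_nsmul _ _ 1 fun i _ => ?_).trans (by simp)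
    rw [abs_of_pos hlam0, hlam, inv_mul_le_iff₀ hpos, mul_one]
    exact norm_projRow_le hC hε _
  have h3 := norm_torusKernel_le (μ := μ) (μ' := μ') hκ s
    (fun θ => (hsum μ he θ).trans (by simp : C + (r : ℝ) ≤ C + (r + r')))
    (fun θ => (hsum μ' he' θ).trans (by simp : C + (r' : ℝ) ≤ C + (r + r')))
  have h4 := norm_stringPhase_le hκ s hC he
  have h5 := norm_stringPhase_le hκ s hC he'
  have h6 : ‖(((lam * plMass κ s : ℝ) : ℂ) ^ (r + r') *
      ((s.descFactorial r : ℂ) * (s.descFactorial r' : ℂ)))⁻¹‖ ≤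
      ((1 + C) ^ (r + r') * (1 + ‖p‖) ^ (r + r')) * (K₁ * K₂) := by
    have e1 : (((lam * plMass κ s : ℝ) : ℂ) ^ (r + r') *
        ((s.descFactorial r : ℂ) * (s.descFactorial r' : ℂ)))⁻¹ =
        (((1 + C * ‖p‖ : ℝ) : ℂ) ^ (r + r')) *
        (((plMass κ s : ℂ) ^ r * (s.descFactorial r : ℂ))⁻¹ *
          ((plMass κ s : ℂ) ^ r' * (s.descFactorial r' : ℂ))⁻¹) := by
      rw [Complex.ofReal_mul, mul_pow, hlam, Complex.ofReal_inv, inv_pow, mul_inv, mul_inv _ (_ ^ _), inv_inv,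
        mul_assoc, ← mul_inv, ← mul_inv, pow_add (plMass κ s : ℂ)]
      congr 2
      ring
    rw [e1, norm_mul, norm_mul, norm_pow, Complex.norm_real, Real.norm_of_nonneg hpos.le]
    refine mul_le_mul ?_ (mul_le_mul (h₁ s) (h₂ s) (norm_nonneg _) hK₁) (by positivity)
      (by positivity)
    rw [← mul_pow]
    refine pow_le_pow_left₀ hpos.le ?_ _
    nlinarith [norm_nonneg p, hC]
  have h7 : ‖(starRingEnd ℂ) (stringPhase s (plMass κ s) e p) * stringPhase s (plMass κ s) e' p *
      (Complex.I ^ r * (-Complex.I) ^ r') * torusKernel s (plMass κ s) lam μ μ' e e' p‖ ≤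
      Real.exp (κ * (2 * C)) * Real.exp (κ * (2 * C)) * pairBound κ (C + (r + r')) := by
    have e1 : ‖Complex.I ^ r * (-Complex.I) ^ r'‖ = 1 := by simp
    rw [norm_mul, norm_mul, norm_mul, e1, mul_one, RCLike.norm_conj]
    exact mul_le_mul (mul_le_mul h4 h5 (norm_nonneg _) (Real.exp_nonneg _)) h3 (norm_nonneg _)
      (by positivity)
  rw [norm_mul]
  refine (mul_le_mul h6 h7 (norm_nonneg _) (by positivity)).trans (le_of_eq ?_)
  ring

/-! ### Measurability -/

lemma measurable_mdot {α : Type*} [MeasurableSpace α] {f g : α → Spacetime} (hf : Measurable f)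
    (hg : Measurable g) : Measurable fun x => mdot (f x) (g x) := by
  have h := continuous_mdot.measurable.comp (hf.prodMk hg)
  exact h

lemma measurable_stringDir {α : Type*} [MeasurableSpace α] {f g : α → Spacetime}
    (hf : Measurable f) (hg : Measurable g) : Measurable fun x => stringDir (f x) (g x) := by
  refine measurable_pi_lambda _ fun ν => Complex.measurable_ofReal.comp ?_
  exact ((measurable_pi_apply ν).comp hf).div (measurable_mdot hf hg)

lemma measurable_projRow {α : Type*} [MeasurableSpace α] {f g : α → Spacetime}
    (hf : Measurable f) (hg : Measurable g) (μ : Fin 4) :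
    Measurable fun x => projRow (f x) (g x) μ := by
  refine measurable_pi_lambda _ fun ν => Complex.measurable_ofReal.comp ?_
  exact measurable_const.sub (((((measurable_pi_apply μ).comp hg).const_mul (eta μ)).mul
    ((measurable_pi_apply ν).comp hf)).div (measurable_mdot hf hg))

lemma measurable_genVec {α : Type*} [MeasurableSpace α] {f g : α → Spacetime}
    (hf : Measurable f) (hg : Measurable g) (lam : ℝ) {r : ℕ} (μ : Fin r → Fin 4)
    {θ : α → Fin r → ℝ} (hθ : Measurable θ) :
    Measurable fun x => genVec lam (f x) (g x) μ (θ x) := by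
  refine (measurable_stringDir hf hg).add (Finset.measurable_fun_sum _ fun i _ => ?_)
  have h1 : Measurable fun x => unitPhase (θ x i) * (lam : ℂ) :=
    (continuous_unitPhase.measurable.comp ((measurable_pi_apply i).comp hθ)).mul_const _
  exact h1.smul (measurable_projRow hf hg (μ i))

lemma measurable_stringPhase {α : Type*} [MeasurableSpace α] {f g : α → Spacetime}
    (hf : Measurable f) (hg : Measurable g) (s : ℕ) (m : ℝ) :
    Measurable fun x => stringPhase s m (f x) (g x) := by
  have h1 : Measurable fun x => (mdot (f x) (g x) : ℂ) :=
    Complex.measurable_ofReal.comp (measurable_mdot hf hg)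
  have h2 : Measurable fun x => (Real.sqrt (-mdot (f x) (f x)) : ℂ) :=
    Complex.measurable_ofReal.comp (measurable_mdot hf hf).neg.sqrt
  unfold stringPhase stringInt
  exact (measurable_const.sub ((h2.const_mul _).mul (measurable_const.div h1))).pow_const s

lemma measurable_limPhase {α : Type*} [MeasurableSpace α] {f g : α → Spacetime}
    (hf : Measurable f) (hg : Measurable g) (κ : ℝ) :
    Measurable fun x => limPhase κ (f x) (g x) := by
  unfold limPhase
  refine Complex.measurable_exp.comp (Measurable.const_mul (Complex.measurable_ofReal.comp ?_) _)
  exact ((measurable_mdot hf hf).neg.sqrt.const_mul κ).div (measurable_mdot hf hg)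

section

variable {r r' : ℕ} (μ : Fin r → Fin 4) (μ' : Fin r' → Fin 4)

lemma measurable_torusKernel (s : ℕ) (m lam : ℝ) :
    Measurable fun x : Spacetime × Spacetime × Spacetime =>
      torusKernel s m lam μ μ' x.1 x.2.1 x.2.2 := by
  unfold torusKernel
  refine (StronglyMeasurable.integral_prod_right'
    (f := fun y : (Spacetime × Spacetime × Spacetime) × ((Fin r → ℝ) × (Fin r' → ℝ)) =>
      torusChar y.2.1 * torusChar y.2.2 *
        pairKernel s m (genVec lam y.1.1 y.1.2.2 μ y.2.1) (genVec lam y.1.2.1 y.1.2.2 μ' y.2.2))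
    (Measurable.stronglyMeasurable ?_)).measurable
  have h1 : Measurable fun y : (Spacetime × Spacetime × Spacetime) × ((Fin r → ℝ) × (Fin r' → ℝ)) =>
      torusChar y.2.1 * torusChar y.2.2 :=
    (by fun_prop : Continuous _).measurable
  have h2 := measurable_pairKernel_comp
    (measurable_genVec (α := (Spacetime × Spacetime × Spacetime) × ((Fin r → ℝ) × (Fin r' → ℝ)))
      (f := fun y => y.1.1) (g := fun y => y.1.2.2) (θ := fun y => y.2.1) (by fun_prop)
      (by fun_prop) lam μ (by fun_prop))
    (measurable_genVec (α := (Spacetime × Spacetime × Spacetime) × ((Fin r → ℝ) × (Fin r' → ℝ)))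
      (f := fun y => y.1.2.1) (g := fun y => y.1.2.2) (θ := fun y => y.2.2) (by fun_prop)
      (by fun_prop) lam μ' (by fun_prop)) s m
  exact h1.mul h2

lemma measurable_torusLimit (κ lam : ℝ) :
    Measurable fun x : Spacetime × Spacetime × Spacetime =>
      torusLimit κ lam μ μ' x.1 x.2.1 x.2.2 := by
  unfold torusLimit
  refine (StronglyMeasurable.integral_prod_right'
    (f := fun y : (Spacetime × Spacetime × Spacetime) × ((Fin r → ℝ) × (Fin r' → ℝ)) =>
      torusChar y.2.1 * torusChar y.2.2 *
        limKernel κ (genVec lam y.1.1 y.1.2.2 μ y.2.1) (genVec lam y.1.2.1 y.1.2.2 μ' y.2.2))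
    (Measurable.stronglyMeasurable ?_)).measurable
  have h1 : Measurable fun y : (Spacetime × Spacetime × Spacetime) × ((Fin r → ℝ) × (Fin r' → ℝ)) =>
      torusChar y.2.1 * torusChar y.2.2 :=
    (by fun_prop : Continuous _).measurable
  have h2 := (measurable_limKernel κ).comp ((measurable_genVec
      (α := (Spacetime × Spacetime × Spacetime) × ((Fin r → ℝ) × (Fin r' → ℝ)))
      (f := fun y => y.1.1) (g := fun y => y.1.2.2) (θ := fun y => y.2.1) (by fun_prop)
      (by fun_prop) lam μ (by fun_prop)).prodMk
    (measurable_genVec (α := (Spacetime × Spacetime × Spacetime) × ((Fin r → ℝ) × (Fin r' → ℝ)))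
      (f := fun y => y.1.2.1) (g := fun y => y.1.2.2) (θ := fun y => y.2.2) (by fun_prop)
      (by fun_prop) lam μ' (by fun_prop)))
  exact h1.mul h2

lemma measurable_massiveFormula (κ : ℝ) (s : ℕ) (lam : ℝ) :
    Measurable fun x : Spacetime × Spacetime × Spacetime =>
      massiveFormula κ s lam μ μ' x.1 x.2.1 x.2.2 := by
  have h1 := measurable_stringPhase (α := Spacetime × Spacetime × Spacetime) (f := fun x => x.1)
    (g := fun x => x.2.2) (by fun_prop) (by fun_prop) s (plMass κ s)
  have h2 := measurable_stringPhase (α := Spacetime × Spacetime × Spacetime) (f := fun x => x.2.1)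
    (g := fun x => x.2.2) (by fun_prop) (by fun_prop) s (plMass κ s)
  have h3 := measurable_torusKernel μ μ' s (plMass κ s) lam
  exact ((((Complex.continuous_conj.measurable.comp h1).mul h2).mul_const _).mul h3).const_mul _

lemma measurable_infFormula (κ : ℝ) :
    Measurable fun x : Spacetime × Spacetime × Spacetime =>
      infFormula κ μ μ' x.1 x.2.1 x.2.2 := by
  have h1 := measurable_limPhase (α := Spacetime × Spacetime × Spacetime) (f := fun x => x.1)
    (g := fun x => x.2.2) (by fun_prop) (by fun_prop) κ
  have h2 := measurable_limPhase (α := Spacetime × Spacetime × Spacetime) (f := fun x => x.2.1)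
    (g := fun x => x.2.2) (by fun_prop) (by fun_prop) κ
  have h3 := measurable_torusLimit μ μ' κ 1
  exact ((((Complex.continuous_conj.measurable.comp h1).mul h2).mul_const _).mul h3).const_mul _

end

/-! ### Smearing in momentum space -/

/-- The density of the invariant measure on the mass shell. -/
def shellWeight (m : ℝ) (k : Fin 3 → ℝ) : ℝ := 1 / ((2 * Real.pi) ^ 3 * (2 * shellPoint m k 0))

/-- The parametrization of the domain of smearing by the spatial momentum. -/
def shellMap (m : ℝ) (x : Spacetime × Spacetime × (Fin 3 → ℝ)) :
    Spacetime × Spacetime × Spacetime := (x.1, x.2.1, shellPoint m x.2.2)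

lemma continuous_shellPoint (m : ℝ) : Continuous (shellPoint m) := by
  refine continuous_pi fun i => ?_
  refine Fin.cases ?_ (fun j => ?_) i
  · simp only [shellPoint, Fin.cons_zero]
    fun_prop
  · simp only [shellPoint, Fin.cons_succ]
    fun_prop

lemma continuous_shellPoint_mass (k : Fin 3 → ℝ) : Continuous fun m => shellPoint m k := by
  refine continuous_pi fun i => ?_
  refine Fin.cases ?_ (fun j => ?_) i
  · simp only [shellPoint, Fin.cons_zero]
    fun_prop
  · simp only [shellPoint, Fin.cons_succ]
    fun_prop

lemma tendsto_shellPoint {m : ℕ → ℝ} {m₀ : ℝ} (hm : Tendsto m atTop (𝓝 m₀)) (k : Fin 3 → ℝ) :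
    Tendsto (fun s => shellPoint (m s) k) atTop (𝓝 (shellPoint m₀ k)) :=
  ((continuous_shellPoint_mass k).tendsto m₀).comp hm

lemma norm_le_shellPoint_zero (m : ℝ) (k : Fin 3 → ℝ) : ‖k‖ ≤ shellPoint m k 0 := by
  rw [shellPoint, Fin.cons_zero]
  refine (pi_norm_le_iff_of_nonneg (Real.sqrt_nonneg _)).2 fun i => ?_
  refine Real.le_sqrt_of_sq_le ?_
  rw [Real.norm_eq_abs, sq_abs]
  have := Finset.single_le_sum (f := fun i => k i ^ 2) (fun i _ => sq_nonneg _) (Finset.mem_univ i)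
  have h2 := sq_nonneg m
  linarith

lemma norm_le_norm_shellPoint (m : ℝ) (k : Fin 3 → ℝ) : ‖k‖ ≤ ‖shellPoint m k‖ :=
  (norm_le_shellPoint_zero m k).trans ((le_abs_self _).trans (norm_le_pi_norm (shellPoint m k) 0))

lemma shellPoint_mem_massShell (m : ℝ) {k : Fin 3 → ℝ} (hk : k ≠ 0) :
    shellPoint m k ∈ massShell m := by
  refine ⟨?_, (norm_pos_iff.2 hk).trans_le (norm_le_shellPoint_zero m k)⟩
  have h : 0 ≤ m ^ 2 + ∑ i, k i ^ 2 := by positivity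
  have h0 : shellPoint m k 0 * shellPoint m k 0 = m ^ 2 + ∑ i, k i ^ 2 := Real.mul_self_sqrt h
  rw [mdot, Fin.sum_univ_succ]
  have h1 : ∀ i : Fin 3, eta i.succ * shellPoint m k i.succ * shellPoint m k i.succ =
      -(k i ^ 2) := by
    intro i
    have h2 : eta i.succ = -1 := by fin_cases i <;> rfl
    rw [h2, shellPoint, Fin.cons_succ]
    ring
  have h3 : eta 0 = 1 := rfl
  rw [Finset.sum_congr rfl fun i _ => h1 i, Finset.sum_neg_distrib, h3, one_mul, h0]
  ring

lemma shellWeight_nonneg (m : ℝ) (k : Fin 3 → ℝ) : 0 ≤ shellWeight m k := by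
  have := (norm_nonneg k).trans (norm_le_shellPoint_zero m k)
  unfold shellWeight
  positivity

lemma shellWeight_le (m : ℝ) {k : Fin 3 → ℝ} (hk : k ≠ 0) : shellWeight m k ≤ ‖k‖⁻¹ := by
  have h1 := norm_pos_iff.2 hk
  have h2 := norm_le_shellPoint_zero m k
  have h3 : 1 ≤ (2 * Real.pi) ^ 3 := one_le_pow₀ (by linarith [Real.two_le_pi])
  rw [shellWeight, one_div]
  refine inv_anti₀ h1 ?_
  nlinarith

lemma tendsto_shellWeight {m : ℕ → ℝ} {m₀ : ℝ} (hm : Tendsto m atTop (𝓝 m₀)) {k : Fin 3 → ℝ}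
    (hk : k ≠ 0) : Tendsto (fun s => shellWeight (m s) k) atTop (𝓝 (shellWeight m₀ k)) := by
  have h1 := (norm_pos_iff.2 hk).trans_le (norm_le_shellPoint_zero m₀ k)
  have h2 := (tendsto_pi_nhds.1 (tendsto_shellPoint hm k)) 0
  refine tendsto_const_nhds.div ((h2.const_mul 2).const_mul _) ?_
  positivity

lemma measurable_shellWeight (m : ℝ) : Measurable (shellWeight m) := by
  have h : Measurable fun k => shellPoint m k 0 :=
    (measurable_pi_apply 0).comp (continuous_shellPoint m).measurable
  exact measurable_const.div ((h.const_mul 2).const_mul _)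

lemma measurable_shellWeight_snd (m : ℝ) :
    Measurable fun x : Spacetime × Spacetime × (Fin 3 → ℝ) => shellWeight m x.2.2 :=
  (measurable_shellWeight m).comp measurable_snd.snd

lemma measurable_shellMap (m : ℝ) : Measurable (shellMap m) :=
  measurable_fst.prodMk (measurable_snd.fst.prodMk
    ((continuous_shellPoint m).measurable.comp measurable_snd.snd))

/-- The mass shells vary with s; parametrized by spatial momentum, all integrals live on one measure
space, where dominated convergence applies. -/
lemma smearingMeasure_eq (m : ℝ) : smearingMeasure m = Measure.map (shellMap m)
    ((volume : Measure (Spacetime × Spacetime × (Fin 3 → ℝ))).withDensity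
      fun x => ENNReal.ofReal (shellWeight m x.2.2)) := by
  have hw : Measurable fun k => ENNReal.ofReal (shellWeight m k) :=
    (measurable_shellWeight m).ennreal_ofReal
  have hs : SFinite ((volume : Measure (Fin 3 → ℝ)).withDensity
      fun k => ENNReal.ofReal (shellWeight m k)) := inferInstance
  have h1 : shellMeasure m = Measure.map (shellPoint m)
    ((volume : Measure (Fin 3 → ℝ)).withDensity fun k => ENNReal.ofReal (shellWeight m k)) := rfl
  have h2 : (volume : Measure Spacetime).prod (shellMeasure m) =
      Measure.map (Prod.map id (shellPoint m)) ((volume : Measure (Spacetime ×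
        (Fin 3 → ℝ))).withDensity fun x => ENNReal.ofReal (shellWeight m x.2)) := by
    rw [h1]
    conv_lhs => rw [← Measure.map_id (μ := (volume : Measure Spacetime))]
    rw [Measure.map_prod_map _ _ measurable_id (continuous_shellPoint m).measurable,
      prod_withDensity_right hw]
    rfl
  rw [smearingMeasure, h2]
  conv_lhs => rw [← Measure.map_id (μ := (volume : Measure Spacetime))]
  rw [Measure.map_prod_map _ _ measurable_id
    (measurable_id.prodMap (continuous_shellPoint m).measurable),
    prod_withDensity_right (μ := (volume : Measure Spacetime))
      (g := fun x : Spacetime × (Fin 3 → ℝ) => ENNReal.ofReal (shellWeight m x.2))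
      (hw.comp measurable_snd)]
  rfl

lemma ae_snd_snd_ne_zero :
    ∀ᵐ x ∂(volume : Measure (Spacetime × Spacetime × (Fin 3 → ℝ))), x.2.2 ≠ 0 := by
  have h : ∀ᵐ k ∂(volume : Measure (Fin 3 → ℝ)), k ≠ 0 := Measure.ae_ne volume 0
  exact Measure.quasiMeasurePreserving_snd.ae (Measure.quasiMeasurePreserving_snd.ae h)

lemma integrable_smearing_iff {m : ℝ} {g : Spacetime × Spacetime × Spacetime → ℂ}
    (hg : Measurable g) : Integrable g (smearingMeasure m) ↔
      Integrable fun x => shellWeight m x.2.2 • g (shellMap m x) := by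
  rw [smearingMeasure_eq, integrable_map_measure hg.aestronglyMeasurable
    (measurable_shellMap m).aemeasurable, integrable_withDensity_iff_integrable_smul'
    (measurable_shellWeight_snd m).ennreal_ofReal
    (Eventually.of_forall fun _ => ENNReal.ofReal_lt_top)]
  simp only [ENNReal.toReal_ofReal (shellWeight_nonneg m _), Function.comp_apply]

lemma integral_smearing {m : ℝ} {g : Spacetime × Spacetime × Spacetime → ℂ}
    (hg : Measurable g) : ∫ y, g y ∂smearingMeasure m =
      ∫ x, shellWeight m x.2.2 • g (shellMap m x) := by
  rw [smearingMeasure_eq, integral_map (measurable_shellMap m).aemeasurable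
    hg.aestronglyMeasurable, integral_withDensity_eq_integral_toReal_smul
    (measurable_shellWeight_snd m).ennreal_ofReal
    (Eventually.of_forall fun _ => ENNReal.ofReal_lt_top)]
  simp only [ENNReal.toReal_ofReal (shellWeight_nonneg m _)]

/-- Only k = 0 can miss the shell, and it has measure zero. No measurability of `P` is needed, so
this applies to kernels with arbitrary boosts. -/
lemma ae_smearingMeasure {m : ℝ} {P : Spacetime × Spacetime × Spacetime → Prop}
    (hP : ∀ y, y.2.2 ∈ massShell m → P y) : ∀ᵐ y ∂smearingMeasure m, P y := by
  have hs : MeasurableSet {y : Spacetime × Spacetime × Spacetime | y.2.2 ∈ massShell m} := by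
    have h1 : MeasurableSet {y : Spacetime × Spacetime × Spacetime |
        mdot y.2.2 y.2.2 = m ^ 2} :=
      measurableSet_eq_fun (measurable_mdot (by fun_prop) (by fun_prop)) measurable_const
    have h2 : MeasurableSet {y : Spacetime × Spacetime × Spacetime | 0 < y.2.2 0} :=
      measurableSet_lt measurable_const (by fun_prop)
    exact h1.inter h2
  suffices h : ∀ᵐ y ∂smearingMeasure m, y.2.2 ∈ massShell m from h.mono hP
  rw [smearingMeasure_eq, ae_map_iff (measurable_shellMap m).aemeasurable hs]
  refine (withDensity_absolutelyContinuous _ _).ae_le ?_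
  filter_upwards [ae_snd_snd_ne_zero] with x hx using shellPoint_mem_massShell m hx

lemma integrable_inv_one_add_norm_pow :
    Integrable fun e : Spacetime => ((1 + ‖e‖) ^ 5)⁻¹ := by
  have h := integrable_one_add_norm (E := Spacetime) (μ := volume) (r := 5)
    (by rw [Module.finrank_fin_fun]; norm_num)
  refine h.congr (Eventually.of_forall fun e => ?_)
  have h1 : (0 : ℝ) ≤ 1 + ‖e‖ := by positivity
  simp only [Real.rpow_neg h1, Real.rpow_ofNat]

/-- The singularity 1/|k| of the massless measure is absorbed by the radial volume element |k|² in
three dimensions. -/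
lemma integrable_inv_norm_mul :
    Integrable fun k : Fin 3 → ℝ => ‖k‖⁻¹ * ((1 + ‖k‖) ^ 4)⁻¹ := by
  refine (integrable_fun_norm_addHaar (volume : Measure (Fin 3 → ℝ))
    (f := fun y : ℝ => y⁻¹ * ((1 + y) ^ 4)⁻¹)).2 ?_
  have h := integrableOn_add_rpow_Ioi_of_lt (a := -3) (c := 0) (m := 1) (by norm_num) (by norm_num)
  refine Integrable.mono' h (by fun_prop) ?_
  filter_upwards [ae_restrict_mem measurableSet_Ioi] with y hy
  have hy : 0 < y := hy
  have h1 : (0 : ℝ) < y + 1 := by positivity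
  have h2 : (y + 1) ^ (-3 : ℝ) = ((y + 1) ^ 3)⁻¹ := by
    rw [Real.rpow_neg h1.le, Real.rpow_ofNat]
  rw [Module.finrank_fin_fun, h2, smul_eq_mul, Real.norm_of_nonneg (by positivity)]
  have h3 : y ^ (3 - 1) * (y⁻¹ * ((1 + y) ^ 4)⁻¹) = y / (1 + y) * ((y + 1) ^ 3)⁻¹ := by
    norm_num
    field_simp
    ring
  rw [h3]
  refine mul_le_of_le_one_left (by positivity) ?_
  rw [div_le_one (by positivity)]
  linarith

/-- An integrable function that dominates the smeared two-point kernels of all spins. -/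
def smearBound (x : Spacetime × Spacetime × (Fin 3 → ℝ)) : ℝ :=
  ((1 + ‖x.1‖) ^ 5)⁻¹ * (((1 + ‖x.2.1‖) ^ 5)⁻¹ * (‖x.2.2‖⁻¹ * ((1 + ‖x.2.2‖) ^ 4)⁻¹))

lemma integrable_smearBound : Integrable smearBound :=
  integrable_inv_one_add_norm_pow.mul_prod
    (integrable_inv_one_add_norm_pow.mul_prod integrable_inv_norm_mul)

lemma exists_schwartz_bound (f : SchwartzMap (Spacetime × Spacetime × Spacetime) ℂ) (N : ℕ) :
    ∃ D, 0 ≤ D ∧ ∀ (m : ℝ) (x : Spacetime × Spacetime × (Fin 3 → ℝ)), x.2.2 ≠ 0 →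
      shellWeight m x.2.2 * (‖f (shellMap m x)‖ * (1 + ‖shellPoint m x.2.2‖) ^ N) ≤
        D * smearBound x := by
  -- The order N + 14 pays for the growth N in p and for the decay of orders 5, 5 and 4 in e, e' and
  -- k.
  have h := SchwartzMap.one_add_le_sup_seminorm_apply (𝕜 := ℝ) (m := (N + 14, 0)) le_rfl le_rfl f
  set D := 2 ^ (N + 14) * ((Finset.Iic (N + 14, 0)).sup fun m =>
    SchwartzMap.seminorm ℝ m.1 m.2) f
  refine ⟨D, (by positivity : (0 : ℝ) ≤ _).trans (h 0), fun m x hx => ?_⟩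
  have h1 := h (shellMap m x)
  rw [norm_iteratedFDeriv_zero] at h1
  have hp := norm_le_norm_shellPoint m x.2.2
  have n1 : ‖x.1‖ ≤ ‖shellMap m x‖ := norm_fst_le (shellMap m x)
  have n2' : ‖(shellMap m x).2‖ ≤ ‖shellMap m x‖ := norm_snd_le (shellMap m x)
  have n2 : ‖x.2.1‖ ≤ ‖shellMap m x‖ := (norm_fst_le (shellMap m x).2).trans n2'
  have n3 : ‖shellPoint m x.2.2‖ ≤ ‖shellMap m x‖ := (norm_snd_le (shellMap m x).2).trans n2'
  have n4 := hp.trans n3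
  set M := ‖shellMap m x‖
  set P := ‖shellPoint m x.2.2‖
  set F := ‖f (shellMap m x)‖
  have hk := norm_pos_iff.2 hx
  have h2 : (F * (1 + P) ^ N) * ((1 + ‖x.1‖) ^ 5 * ((1 + ‖x.2.1‖) ^ 5 * (1 + ‖x.2.2‖) ^ 4)) ≤
      D := by
    refine le_trans ?_ h1
    have : (1 + M) ^ (N + 14, 0).1 * F =
        (F * (1 + M) ^ N) * ((1 + M) ^ 5 * ((1 + M) ^ 5 * (1 + M) ^ 4)) := by
      change (1 + M) ^ (N + 14) * F = _
      ring
    rw [this]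
    gcongr
  have h3 : F * (1 + P) ^ N ≤
      D * ((1 + ‖x.1‖) ^ 5 * ((1 + ‖x.2.1‖) ^ 5 * (1 + ‖x.2.2‖) ^ 4))⁻¹ := by
    rw [← div_eq_mul_inv, le_div_iff₀ (by positivity)]
    exact h2
  refine (mul_le_mul (shellWeight_le m hx) h3 (by positivity) (by positivity)).trans (le_of_eq ?_)
  rw [smearBound, mul_inv, mul_inv]
  ring

section

variable {κ : ℝ} {r r' : ℕ} {f : SchwartzMap (Spacetime × Spacetime × Spacetime) ℂ}

lemma mdot_ne_zero_of_norm_le {e p : Spacetime} {C : ℝ} (he : mdot e e < 0)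
    (h : ‖e‖ ≤ C * |mdot e p|) : mdot e p ≠ 0 := by
  intro h0
  rw [h0, abs_zero, mul_zero, norm_le_zero_iff] at h
  simp [h, mdot] at he

lemma IsStringTest.mdot_ne_zero (hf : IsStringTest f) {x : Spacetime × Spacetime × Spacetime}
    (hx : f x ≠ 0) : mdot x.1 x.2.2 ≠ 0 ∧ mdot x.2.1 x.2.2 ≠ 0 := by
  obtain ⟨C, hC⟩ := hf
  obtain ⟨h1, h2, h3, h4⟩ := hC _ _ _ hx
  exact ⟨mdot_ne_zero_of_norm_le h1 h3, mdot_ne_zero_of_norm_le h2 h4⟩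

lemma IsStringTest.mul_massiveKernel (hf : IsStringTest f) (hκ : 0 < κ) {s : ℕ} (hs : 1 ≤ s)
    (T : OrthonormalBasis (Fin (spinDim s)) ℝ (TracelessSym s))
    {B : Spacetime → Matrix (Fin 4) (Fin 4) ℝ}
    (hB : IsBoostFamily (massShell (plMass κ s)) (massiveRef (plMass κ s)) B)
    (μ : Fin r → Fin 4) (μ' : Fin r' → Fin 4) {x : Spacetime × Spacetime × Spacetime}
    (hx : x.2.2 ∈ massShell (plMass κ s)) :
    f x * massiveKernel κ s T B μ μ' x.1 x.2.1 x.2.2 =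
      f x * massiveFormula κ s 1 μ μ' x.1 x.2.1 x.2.2 := by
  rcases eq_or_ne (f x) 0 with h | h
  · rw [h, zero_mul, zero_mul]
  · obtain ⟨h1, h2⟩ := hf.mdot_ne_zero h
    rw [massiveKernel_eq_massiveFormula hκ hs T hB hx h1 h2 μ μ' one_ne_zero]

lemma IsStringTest.mul_infKernel (hf : IsStringTest f) (hκ : 0 < κ)
    {B : Spacetime → Matrix (Fin 4) (Fin 4) ℝ} (hB : IsBoostFamily (massShell 0) masslessRef B)
    (μ : Fin r → Fin 4) (μ' : Fin r' → Fin 4) {x : Spacetime × Spacetime × Spacetime}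
    (hx : x.2.2 ∈ massShell 0) :
    f x * infKernel κ B μ μ' x.1 x.2.1 x.2.2 =
      f x * infFormula κ μ μ' x.1 x.2.1 x.2.2 := by
  rcases eq_or_ne (f x) 0 with h | h
  · rw [h, zero_mul, zero_mul]
  · obtain ⟨h1, h2⟩ := hf.mdot_ne_zero h
    rw [infKernel_eq_infFormula hκ hB hx h1 h2 μ μ']

lemma IsStringTest.exists_norm_mul_massiveKernel_le (hf : IsStringTest f) (hκ : 0 < κ)
    (T : ∀ s : ℕ, OrthonormalBasis (Fin (spinDim s)) ℝ (TracelessSym s))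
    {B : ℕ → Spacetime → Matrix (Fin 4) (Fin 4) ℝ}
    (hB : ∀ s : ℕ, 1 ≤ s →
      IsBoostFamily (massShell (plMass κ s)) (massiveRef (plMass κ s)) (B s))
    (μ : Fin r → Fin 4) (μ' : Fin r' → Fin 4) :
    ∃ K, 0 ≤ K ∧ ∀ s : ℕ, 1 ≤ s → ∀ x : Spacetime × Spacetime × Spacetime,
      x.2.2 ∈ massShell (plMass κ s) →
      ‖f x * massiveFormula κ s 1 μ μ' x.1 x.2.1 x.2.2‖ ≤
        K * (‖f x‖ * (1 + ‖x.2.2‖) ^ (r + r')) := by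
  obtain ⟨C, hC⟩ := id hf
  obtain ⟨K, hK, h⟩ := exists_massiveKernel_bound hκ T hB μ μ' (abs_nonneg C)
  refine ⟨K, hK, fun s hs x hx => ?_⟩
  -- The formula with λ = 1 is bounded by way of the kernel, whose bound rests on the formula with a
  -- different λ.
  rw [← hf.mul_massiveKernel hκ hs (T s) (hB s hs) μ μ' hx]
  rcases eq_or_ne (f x) 0 with h0 | h0
  · simp [h0]
  · obtain ⟨-, -, h3, h4⟩ := hC _ _ _ h0
    obtain ⟨h1, h2⟩ := hf.mdot_ne_zero h0
    have hle : ∀ y : ℝ, C * |y| ≤ |C| * |y| := fun y =>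
      mul_le_mul_of_nonneg_right (le_abs_self C) (abs_nonneg y)
    have h5 := h s hs _ _ _ hx h1 h2 (h3.trans (hle _)) (h4.trans (hle _))
    rw [norm_mul]
    refine (mul_le_mul_of_nonneg_left h5 (norm_nonneg _)).trans (le_of_eq ?_)
    ring

lemma IsStringTest.tendsto_mul_massiveFormula (hf : IsStringTest f) (hκ : 0 < κ)
    (T : ∀ s : ℕ, OrthonormalBasis (Fin (spinDim s)) ℝ (TracelessSym s))
    {B : ℕ → Spacetime → Matrix (Fin 4) (Fin 4) ℝ}
    (hB : ∀ s : ℕ, 1 ≤ s →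
      IsBoostFamily (massShell (plMass κ s)) (massiveRef (plMass κ s)) (B s))
    (μ : Fin r → Fin 4) (μ' : Fin r' → Fin 4) (e e' : Spacetime) {p : Spacetime}
    {q : ℕ → Spacetime} (hqs : ∀ s : ℕ, 1 ≤ s → q s ∈ massShell (plMass κ s))
    (hq : Tendsto q atTop (𝓝 p)) :
    Tendsto (fun s => f (e, e', q s) * massiveFormula κ s 1 μ μ' e e' (q s)) atTop
      (𝓝 (f (e, e', p) * infFormula κ μ μ' e e' p)) := by
  have h1 : Tendsto (fun s => f (e, e', q s)) atTop (𝓝 (f (e, e', p))) :=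
    (f.continuous.tendsto _).comp
      (tendsto_const_nhds.prodMk_nhds (tendsto_const_nhds.prodMk_nhds hq))
  rcases eq_or_ne (f (e, e', p)) 0 with h0 | h0
  -- Where f vanishes in the limit, (ep) or (e'p) may be 0 and the kernel need not converge. The
  -- uniform bound forces the product to 0 because f(e,e',q s) tends to 0.
  · obtain ⟨K, hK, h⟩ := hf.exists_norm_mul_massiveKernel_le hκ T hB μ μ'
    rw [h0, zero_mul]
    have h2 : Tendsto (fun s => K * (‖f (e, e', q s)‖ * (1 + ‖q s‖) ^ (r + r'))) atTop (𝓝 0) := by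
      have := (h1.norm.mul ((hq.norm.const_add 1).pow (r + r'))).const_mul K
      simpa [h0] using this
    refine squeeze_zero_norm' ?_ h2
    filter_upwards [eventually_ge_atTop 1] with s hs using h s hs (e, e', q s) (hqs s hs)
  · obtain ⟨h2, h3⟩ := hf.mdot_ne_zero h0
    exact h1.mul (tendsto_massiveFormula hκ μ μ' hq h2 h3)

lemma tendsto_integral_smearing (hκ : 0 < κ)
    (T : ∀ s : ℕ, OrthonormalBasis (Fin (spinDim s)) ℝ (TracelessSym s))
    {B : ℕ → Spacetime → Matrix (Fin 4) (Fin 4) ℝ}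
    (hB : ∀ s : ℕ, 1 ≤ s →
      IsBoostFamily (massShell (plMass κ s)) (massiveRef (plMass κ s)) (B s))
    {B₀ : Spacetime → Matrix (Fin 4) (Fin 4) ℝ} (hB₀ : IsBoostFamily (massShell 0) masslessRef B₀)
    (μ : Fin r → Fin 4) (μ' : Fin r' → Fin 4) (hf : IsStringTest f) :
    (∀ s : ℕ, 1 ≤ s → Integrable
      (fun x : Spacetime × Spacetime × Spacetime =>
        f x * massiveKernel κ s (T s) (B s) μ μ' x.1 x.2.1 x.2.2)
      (smearingMeasure (plMass κ s))) ∧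
    Integrable
      (fun x : Spacetime × Spacetime × Spacetime =>
        f x * infKernel κ B₀ μ μ' x.1 x.2.1 x.2.2)
      (smearingMeasure 0) ∧
    Tendsto
      (fun s : ℕ => ∫ x, f x * massiveKernel κ s (T s) (B s) μ μ' x.1 x.2.1 x.2.2
        ∂(smearingMeasure (plMass κ s)))
      atTop
      (𝓝 (∫ x, f x * infKernel κ B₀ μ μ' x.1 x.2.1 x.2.2 ∂(smearingMeasure 0))) := by
  let G : ℕ → Spacetime × Spacetime × Spacetime → ℂ := fun s x =>
    f x * massiveFormula κ s 1 μ μ' x.1 x.2.1 x.2.2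
  let G₀ : Spacetime × Spacetime × Spacetime → ℂ := fun x =>
    f x * infFormula κ μ μ' x.1 x.2.1 x.2.2
  have hG : ∀ s, Measurable (G s) := fun s =>
    f.continuous.measurable.mul (measurable_massiveFormula μ μ' κ s 1)
  have hG₀ : Measurable G₀ := f.continuous.measurable.mul (measurable_infFormula μ μ' κ)
  have hmeas : ∀ (m : ℝ) {g : Spacetime × Spacetime × Spacetime → ℂ}, Measurable g →
      Measurable fun x : Spacetime × Spacetime × (Fin 3 → ℝ) =>
        shellWeight m x.2.2 • g (shellMap m x) := fun m g hg =>
    (measurable_shellWeight_snd m).smul (hg.comp (measurable_shellMap m))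
  have ae₁ : ∀ s : ℕ, 1 ≤ s →
      (fun x => f x * massiveKernel κ s (T s) (B s) μ μ' x.1 x.2.1 x.2.2)
        =ᵐ[smearingMeasure (plMass κ s)] G s := fun s hs =>
    ae_smearingMeasure fun y hy => hf.mul_massiveKernel hκ hs (T s) (hB s hs) μ μ' hy
  have ae₀ : (fun x => f x * infKernel κ B₀ μ μ' x.1 x.2.1 x.2.2) =ᵐ[smearingMeasure 0] G₀ :=
    ae_smearingMeasure fun y hy => hf.mul_infKernel hκ hB₀ μ μ' hy
  obtain ⟨K, hK, hbound⟩ := hf.exists_norm_mul_massiveKernel_le hκ T hB μ μ'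
  obtain ⟨D, -, hD⟩ := exists_schwartz_bound f (r + r')
  have hdom : ∀ s : ℕ, 1 ≤ s → ∀ x : Spacetime × Spacetime × (Fin 3 → ℝ), x.2.2 ≠ 0 →
      ‖shellWeight (plMass κ s) x.2.2 • G s (shellMap (plMass κ s) x)‖ ≤
        K * (D * smearBound x) := by
    intro s hs x hx
    rw [norm_smul, Real.norm_of_nonneg (shellWeight_nonneg _ _)]
    refine (mul_le_mul_of_nonneg_left (hbound s hs _ (shellPoint_mem_massShell _ hx))
      (shellWeight_nonneg _ _)).trans ?_
    rw [mul_left_comm]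
    exact mul_le_mul_of_nonneg_left (hD _ x hx) hK
  have hlim : ∀ x : Spacetime × Spacetime × (Fin 3 → ℝ), x.2.2 ≠ 0 →
      Tendsto (fun s => shellWeight (plMass κ s) x.2.2 • G s (shellMap (plMass κ s) x)) atTop
        (𝓝 (shellWeight 0 x.2.2 • G₀ (shellMap 0 x))) := fun x hx =>
    (tendsto_shellWeight (tendsto_plMass κ) hx).smul
      (hf.tendsto_mul_massiveFormula hκ T hB μ μ' x.1 x.2.1
        (fun s _ => shellPoint_mem_massShell _ hx) (tendsto_shellPoint (tendsto_plMass κ) x.2.2))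
  have hint : Integrable fun x => K * (D * smearBound x) :=
    (integrable_smearBound.const_mul D).const_mul K
  refine ⟨fun s hs => ?_, ?_, ?_⟩
  · rw [integrable_congr (ae₁ s hs), integrable_smearing_iff (hG s)]
    refine hint.mono' (hmeas _ (hG s)).aestronglyMeasurable ?_
    filter_upwards [ae_snd_snd_ne_zero] with x hx using hdom s hs x hx
  · rw [integrable_congr ae₀, integrable_smearing_iff hG₀]
    refine hint.mono' (hmeas _ hG₀).aestronglyMeasurable ?_
    filter_upwards [ae_snd_snd_ne_zero] with x hx
    -- The massless integrand inherits the dominating function as a pointwise limit.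
    refine le_of_tendsto (hlim x hx).norm ?_
    filter_upwards [eventually_ge_atTop 1] with s hs using hdom s hs x hx
  · rw [integral_congr_ae ae₀, integral_smearing hG₀]
    have h : Tendsto (fun s => ∫ x, shellWeight (plMass κ s) x.2.2 • G s (shellMap (plMass κ s) x))
        atTop (𝓝 (∫ x, shellWeight 0 x.2.2 • G₀ (shellMap 0 x))) := by
      refine tendsto_integral_filter_of_dominated_convergence (fun x => K * (D * smearBound x))
        (Eventually.of_forall fun s => (hmeas _ (hG s)).aestronglyMeasurable) ?_ hint ?_
      · filter_upwards [eventually_ge_atTop 1] with s hs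
        filter_upwards [ae_snd_snd_ne_zero] with x hx using hdom s hs x hx
      · filter_upwards [ae_snd_snd_ne_zero] with x hx using hlim x hx
    refine h.congr' ?_
    filter_upwards [eventually_ge_atTop 1] with s hs
    rw [integral_congr_ae (ae₁ s hs), integral_smearing (hG s)]

end

end InfiniteSpin

end

open MeasureTheory Filter Topology InfiniteSpin in
theorem propositionp (κ : ℝ) (hκ : 0 < κ)
    -- orthonormal bases of the spin representations
    (T : ∀ s : ℕ, OrthonormalBasis (Fin (spinDim s)) ℝ (TracelessSym s))
    -- standard boosts for the massive and for the massless mass shells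
    (B : ℕ → Spacetime → Matrix (Fin 4) (Fin 4) ℝ)
    (hB : ∀ s : ℕ, 1 ≤ s →
      IsBoostFamily (massShell (plMass κ s)) (massiveRef (plMass κ s)) (B s))
    (B₀ : Spacetime → Matrix (Fin 4) (Fin 4) ℝ)
    (hB₀ : IsBoostFamily (massShell 0) masslessRef B₀) :
    -- pointwise convergence of the two-point kernels
    (∀ (r r' : ℕ) (μ : Fin r → Fin 4) (μ' : Fin r' → Fin 4) (e e' p : Spacetime)
        (q : ℕ → Spacetime),
      mdot e e < 0 → mdot e' e' < 0 → p ∈ massShell 0 → mdot e p ≠ 0 → mdot e' p ≠ 0 →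
      (∀ s : ℕ, 1 ≤ s → q s ∈ massShell (plMass κ s)) → Tendsto q atTop (𝓝 p) →
      Tendsto (fun s : ℕ => massiveKernel κ s (T s) (B s) μ μ' e e' (q s)) atTop
        (𝓝 (infKernel κ B₀ μ μ' e e' p))) ∧
    -- convergence of the two-point functions smeared with test functions
    (∀ (r r' : ℕ) (μ : Fin r → Fin 4) (μ' : Fin r' → Fin 4)
        (f : SchwartzMap (Spacetime × Spacetime × Spacetime) ℂ), IsStringTest f →
      (∀ s : ℕ, 1 ≤ s → Integrable
        (fun x : Spacetime × Spacetime × Spacetime =>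
          f x * massiveKernel κ s (T s) (B s) μ μ' x.1 x.2.1 x.2.2)
        (smearingMeasure (plMass κ s))) ∧
      Integrable
        (fun x : Spacetime × Spacetime × Spacetime =>
          f x * infKernel κ B₀ μ μ' x.1 x.2.1 x.2.2)
        (smearingMeasure 0) ∧
      Tendsto
        (fun s : ℕ => ∫ x, f x * massiveKernel κ s (T s) (B s) μ μ' x.1 x.2.1 x.2.2
          ∂(smearingMeasure (plMass κ s)))
        atTop
        (𝓝 (∫ x, f x * infKernel κ B₀ μ μ' x.1 x.2.1 x.2.2 ∂(smearingMeasure 0)))) ∧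
    -- convergence of the intertwiners up to unitary equivalence
    (∀ (p : Spacetime) (q : ℕ → Spacetime), p ∈ massShell 0 →
      (∀ s : ℕ, 1 ≤ s → q s ∈ massShell (plMass κ s)) → Tendsto q atTop (𝓝 p) →
      ∃ V : ∀ s : ℕ, EuclideanSpace ℂ (Fin (spinDim s)) →ₗᵢ[ℂ] Lp ℂ 2 circleMeasure,
        ∀ (r : ℕ) (μ : Fin r → Fin 4) (e : Spacetime), mdot e e < 0 → mdot e p ≠ 0 →
          ∃ ψ : Lp ℂ 2 circleMeasure,
            ψ =ᵐ[circleMeasure] infIntertwiner κ B₀ r e p μ ∧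
            Tendsto (fun s : ℕ => V s (massiveIntertwiner κ s (T s) (B s) r e (q s) μ)) atTop
              (𝓝 ψ)) := by
  refine ⟨fun r r' μ μ' e e' p q _ _ hp hep hep' hqs hq => ?_, fun r r' μ μ' f hf => ?_,
    fun p q hp hqs hq => ?_⟩
  · exact tendsto_massiveKernel hκ hB hB₀ μ μ' hp hep hep' hqs hq
  · exact tendsto_integral_smearing hκ T hB hB₀ μ μ' hf
  · exact exists_isometry_tendsto_intertwiner hκ T hB hB₀ hp hqs hq
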